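/- Let $n\ge 1$, let $K$ be a field of characteristic zero, let $t\in K^\times$ not be a root of unity, and put $q=t^{-2}$. Let $\widehat{\mathfrak S}_n$ be the extended affine symmetric group, i.e. the group of bijections $w:\mathbb Z\to\mathbb Z$ with $w(i+n)=w(i)+n$. It is generated by $\pi:i\mapsto i+1$ and the simple reflections $s_i$, $i\in\mathbb Z/n$ (for $n\ge2$; there are none for $n=1$), where $s_i$ exchanges $k$ and $k+1$ for all integers $k\equiv i \bmod n$. The length $\ell(w)$ is the least $m$ such that $w=s_{i_1}\cdots s_{i_m}\pi^k$; such an expression with $m=\ell(w)$ is called reduced. The symmetric group $\mathfrak S_n\subset\widehat{\mathfrak S}_n$ consists of the $w$ preserving $\{1,\dots,n\}$. Let $\gamma\in\widehat{\mathfrak S}_n$ be the translation by $-\rho=(0,-1,\dots,1-n)$, i.e. $\gamma(i+mn)=i+mn+n(1-i)$ for $1\le i\le n$, $m\in\mathbb Z$. Let $\mathbb H$ be the $GL_n$ double affine Hecke algebra over $K$ with parameters $q,t$: it is generated by $T_i$ ($i\in\mathbb Z/n$; no $T_i$ if $n=1$), $\pi^{\pm1}$, and commuting invertible $Y_1,\dots,Y_n$.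 With $Y_{i+mn}:=q^{-m}Y_i$, the relations are: $(T_i-t)(T_i+t^{-1})=0$; for $n\geq 3$, $T_iT_jT_i=T_jT_iT_j$ if $j\equiv i\pm1$ and $T_iT_j=T_jT_i$ otherwise; $\pi T_i\pi^{-1}=T_{i+1}$; $T_iY_iT_i=Y_{i+1}$; $T_iY_j=Y_jT_i$ if $j\not\equiv i,i+1 \bmod n$; $\pi Y_i\pi^{-1}=Y_{i+1}$. Put $f_{i,j}=tY_i-t^{-1}Y_j$, and let $K[\widetilde{\mathcal Y}]$ and $\widetilde{\mathbb H}$ be the localizations of $K[Y_1^{\pm1},\dots,Y_n^{\pm1}]$ and of $\mathbb H$ at all $f_{i,j}$ with $i\not\equiv j \bmod n$. In $\widetilde{\mathbb H}$ set $\nu_i=(T_iY_i-Y_iT_i)f_{i,i+1}^{-1}$. For a reduced expression $w=s_{i_1}\cdots s_{i_m}\pi^k$ set $T_w=T_{i_1}\cdots T_{i_m}\pi^k$ and $\nu_w=\nu_{i_1}\cdots\nu_{i_m}\pi^k$; these do not depend on the reduced expression. The normal ordering of $h\in\widetilde{\mathbb H}$ is its expression as a finite sum $h=\sum_{x\in\widehat{\mathfrak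 S}_n}T_xg_x$ with $g_x\in K[\widetilde{\mathcal Y}]$. It has leading term $T_w$, with leading coefficient $g_w$, if $g_w\ne0$ and every $x\ne w$ with $g_x\neq0$ satisfies $\ell(x)<\ell(w)$. Let $t^{-2\rho}$ be the point $(Y_1,\dots,Y_n)=(1,t^{-2},\dots,t^{2-2n})$. An element $g\in K[\widetilde{\mathcal Y}]$ has no pole at this point if $g=P/Q$ for polynomials $P,Q$ in $Y_1,\dots,Y_n$ with $Q(t^{-2\rho})\neq0$; it has a zero there if moreover $P(t^{-2\rho})=0$. **Theorem.** Let $w\in\mathfrak S_n$. Then $\nu_{\gamma^{-1}w\gamma}$ has a unique normal ordering $\sum_{x}T_xg_x$. It has leading term $T_{\gamma^{-1}w\gamma}$, and its leading coefficient $g_{\gamma^{-1}w\gamma}$ has neither a zero nor a pole at $t^{-2\rho}$. Moreover, no coefficient $g_x$ with $x\ne\gamma^{-1}w\gamma$ has a pole at $t^{-2\rho}$. -/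

import Mathlib

namespace QDaha

/-! ### The extended affine symmetric group -/

/-- The extended affine symmetric group, realised as the group of affine permutations: the
bijections `w : ℤ → ℤ` with `w (i + n) = w i + n` for all `i`. -/
def AffinePerm (n : ℕ) : Subgroup (Equiv.Perm ℤ) where
  carrier := {w | ∀ i : ℤ, w (i + n) = w i + n}
  one_mem' := fun _ => rfl
  mul_mem' := fun {a b} ha hb i => by
    simp only [Set.mem_ofPred_eq] at ha hb
    simp [Equiv.Perm.mul_apply, hb, ha]
  inv_mem' := fun {a} ha i => by
    simp only [Set.mem_ofPred_eq] at ha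
    rw [Equiv.Perm.inv_eq_iff_eq, ha]
    simp

/-- Labels of the simple reflections: the residues modulo `n`. For `n ≥ 2` the side condition is
automatic; for `n = 1` there are no simple reflections. -/
abbrev SimpleIdx (n : ℕ) := {i : ZMod n // i + 1 ≠ i}

/-- The map exchanging `k` and `k + 1` for each integer `k` in the residue class `i`. -/
def simpleFun {n : ℕ} (i : SimpleIdx n) (j : ℤ) : ℤ :=
  if (j : ZMod n) = i.1 then j + 1 else if (j : ZMod n) = i.1 + 1 then j - 1 else j

theorem simpleFun_invol {n : ℕ} (i : SimpleIdx n) : Function.Involutive (simpleFun i) := by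
  intro j
  have hi := i.2
  unfold simpleFun
  by_cases h1 : (j : ZMod n) = i.1
  · simp [h1, hi]
  · by_cases h2 : (j : ZMod n) = i.1 + 1
    · simp [h2, hi]
    · simp [h1, h2]

/-- The simple reflection `s_i`. -/
def simple {n : ℕ} (i : SimpleIdx n) : AffinePerm n :=
  ⟨(simpleFun_invol i).toPerm, fun j => by
    change simpleFun i (j + n) = simpleFun i j + n
    unfold simpleFun
    push_cast
    simp only [ZMod.natCast_self, add_zero]
    split_ifs <;> ring⟩

/-- The element `π : i ↦ i + 1`. -/
def shift (n : ℕ) : AffinePerm n :=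
  ⟨Equiv.addRight 1, fun j => by simp; ring⟩

/-- The affine permutation `s_{i₁} ⋯ s_{iₘ} π ^ k`. -/
def evalWord {n : ℕ} (p : List (SimpleIdx n) × ℤ) : AffinePerm n :=
  (p.1.map simple).prod * shift n ^ p.2

/-- The length: the least number of simple reflections in an expression
`w = s_{i₁} ⋯ s_{iₘ} π ^ k`. -/
noncomputable def len {n : ℕ} (w : AffinePerm n) : ℕ :=
  sInf {m | ∃ p : List (SimpleIdx n) × ℤ, evalWord p = w ∧ p.1.length = m}

/-- `p` is a reduced expression of `w`. -/
def IsReduced {n : ℕ} (w : AffinePerm n) (p : List (SimpleIdx n) × ℤ) : Prop :=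
  evalWord p = w ∧ p.1.length = len w

theorem affine_add {n : ℕ} (w : AffinePerm n) (i : ℤ) :
    w.1 (i + n) = w.1 i + n := w.2 i

theorem affine_add_mul {n : ℕ} (w : AffinePerm n) (i m : ℤ) :
    w.1 (i + m * n) = w.1 i + m * n := by
  induction m using Int.induction_on with
  | zero => simp
  | succ m ih => rw [add_mul, one_mul, ← add_assoc, affine_add w, ih]; ring
  | pred m ih =>
    have := affine_add w (i + (-(m : ℤ) - 1) * n)
    rw [show i + (-(m : ℤ) - 1) * n + n = i + (-(m : ℤ)) * n by ring, ih] at this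
    linarith

/-- The displacement `w k - k`, which depends only on `k` modulo `n`. -/
def disp {n : ℕ} (w : AffinePerm n) (r : ZMod n) : ℤ := w.1 (r.cast : ℤ) - (r.cast : ℤ)

theorem disp_eq {n : ℕ} (w : AffinePerm n) (k : ℤ) :
    w.1 k - k = disp w (k : ZMod n) := by
  unfold disp
  rw [ZMod.coe_intCast]
  have h := affine_add_mul w (k % n) (k / n)
  have h2 : k % n + k / n * n = k := by rw [mul_comm]; exact Int.emod_add_mul_ediv k n
  rw [h2] at h
  rw [h]
  linarith

theorem simple_apply {n : ℕ} (i : SimpleIdx n) (j : ℤ) : (simple i).1 j = simpleFun i j := rfl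

theorem simple_mul_self {n : ℕ} (i : SimpleIdx n) : simple i * simple i = 1 := by
  ext j
  exact simpleFun_invol i j

theorem exists_word {n : ℕ} [NeZero n] (w : AffinePerm n) :
    ∃ p : List (SimpleIdx n) × ℤ, evalWord p = w := by
  suffices H : ∀ (N : ℕ) (w : AffinePerm n), (∑ r, disp w r ^ 2).toNat < N →
      ∃ p : List (SimpleIdx n) × ℤ, evalWord p = w⁻¹ by
    simpa using H _ w⁻¹ (Nat.lt_succ_self _)
  intro N
  induction N with
  | zero => intro w h; omega
  | succ N ih =>
    intro w hN
    by_cases hw : ∀ i : ℤ, w.1 i < w.1 (i + 1)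
    · have hmono : StrictMono w.1 := strictMono_int_of_lt_succ hw
      have hstep : ∀ i : ℤ, w.1 (i + 1) = w.1 i + 1 := by
        intro i
        obtain ⟨j, hj⟩ := w.1.surjective (w.1 i + 1)
        have h1 : i < j := hmono.lt_iff_lt.1 (by omega)
        have h2 : w.1 (i + 1) ≤ w.1 j := hmono.monotone (by omega)
        have := hw i
        omega
      have hall : ∀ i : ℤ, w.1 i = i + w.1 0 := by
        intro i
        induction i using Int.induction_on with
        | zero => simp
        | succ m ihm => rw [hstep, ihm]; ring
        | pred m ihm =>
          have := hstep (-(m : ℤ) - 1)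
          rw [sub_add_cancel] at this
          linarith
      have hpow : ∀ (k : ℤ) (i : ℤ), (shift n ^ k).1 i = i + k := by
        intro k
        induction k using Int.induction_on with
        | zero => intro i; simp
        | succ m ihm =>
          intro i
          rw [zpow_add_one]
          change (shift n ^ (m : ℤ)).1 (i + 1) = _
          rw [ihm]
          ring
        | pred m ihm =>
          intro i
          have h9 := ihm (i - 1)
          rw [show (-(m : ℤ)) = -(m : ℤ) - 1 + 1 by ring, zpow_add_one] at h9
          change (shift n ^ (-(m : ℤ) - 1)).1 (i - 1 + 1) = _ at h9
          rw [sub_add_cancel] at h9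
          rw [h9]
          ring
      refine ⟨([], -(w.1 0)), ?_⟩
      rw [eq_inv_iff_mul_eq_one]
      ext i
      simp only [evalWord, List.map_nil, List.prod_nil, one_mul]
      change (shift n ^ (-(w.1 0))).1 (w.1 i) = i
      rw [hpow, hall i]
      ring
    · push Not at hw
      obtain ⟨i, hi⟩ := hw
      have hne : w.1 (i + 1) ≠ w.1 i := fun h => by
        have := w.1.injective h
        omega
      have hlt : w.1 (i + 1) < w.1 i := lt_of_le_of_ne hi hne
      have hidx : (i : ZMod n) + 1 ≠ (i : ZMod n) := by
        intro h
        have h1 := disp_eq w i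
        have h2 := disp_eq w (i + 1)
        push_cast at h2
        rw [h] at h2
        omega
      let s : SimpleIdx n := ⟨i, hidx⟩
      set a : ZMod n := (i : ZMod n) with ha
      have hda : w.1 i - i = disp w a := disp_eq w i
      have hdb : w.1 (i + 1) - (i + 1) = disp w (a + 1) := by
        have := disp_eq w (i + 1)
        push_cast at this
        exact this
      have e1 : disp (w * simple s) a = disp w (a + 1) + 1 := by
        rw [← hdb, ha, ← disp_eq]
        change w.1 (simpleFun s i) - i = _
        simp [simpleFun, s]
        ring
      have e2 : disp (w * simple s) (a + 1) = disp w a - 1 := by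
        have h := disp_eq (w * simple s) (i + 1)
        push_cast at h
        rw [← h, ← hda]
        change w.1 (simpleFun s (i + 1)) - (i + 1) = _
        have h3 : simpleFun s (i + 1) = i := by
          have h10 : (1 : ZMod n) ≠ 0 := by simpa using hidx
          simp [simpleFun, s, h10]
        rw [h3]
        ring
      have e3 : ∀ r, r ≠ a → r ≠ a + 1 → disp (w * simple s) r = disp w r := by
        intro r h1 h2
        unfold disp
        change w.1 (simpleFun s (r.cast : ℤ)) - _ = _
        have h4 : simpleFun s (r.cast : ℤ) = (r.cast : ℤ) := by
          have h5 : ((r.cast : ℤ) : ZMod n) = r := ZMod.intCast_zmod_cast r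
          have h6 : ¬ r = s.1 := h1
          have h7 : ¬ r = s.1 + 1 := h2
          simp [simpleFun, h5, h6, h7]
        rw [h4]
      have hsum : ∑ r, disp (w * simple s) r ^ 2 < ∑ r, disp w r ^ 2 := by
        rw [← Finset.sum_add_sum_compl {a, a + 1} (fun r => disp (w * simple s) r ^ 2),
          ← Finset.sum_add_sum_compl {a, a + 1} (fun r => disp w r ^ 2),
          Finset.sum_pair hidx.symm, Finset.sum_pair hidx.symm, e1, e2]
        have h6 : ∑ r ∈ ({a, a + 1} : Finset (ZMod n))ᶜ, disp (w * simple s) r ^ 2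
            = ∑ r ∈ ({a, a + 1} : Finset (ZMod n))ᶜ, disp w r ^ 2 := by
          refine Finset.sum_congr rfl fun r hr => ?_
          simp only [Finset.mem_compl, Finset.mem_insert, Finset.mem_singleton, not_or] at hr
          rw [e3 r hr.1 hr.2]
        rw [h6]
        nlinarith
      have hnn : 0 ≤ ∑ r, disp (w * simple s) r ^ 2 :=
        Finset.sum_nonneg fun r _ => sq_nonneg _
      obtain ⟨p, hp⟩ := ih (w * simple s) (by omega)
      refine ⟨(s :: p.1, p.2), ?_⟩
      have h8 : evalWord (s :: p.1, p.2) = simple s * evalWord p := by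
        simp [evalWord, mul_assoc]
      rw [h8, hp, mul_inv_rev, ← mul_assoc, mul_inv_cancel, one_mul]

theorem exists_reduced {n : ℕ} [NeZero n] (w : AffinePerm n) : ∃ p, IsReduced w p := by
  have h : (len w) ∈ {m | ∃ p : List (SimpleIdx n) × ℤ, evalWord p = w ∧ p.1.length = m} := by
    obtain ⟨p, hp⟩ := exists_word w
    exact Nat.sInf_mem ⟨_, p, hp, rfl⟩
  exact h

/-- A chosen reduced expression. -/
noncomputable def redWord {n : ℕ} [NeZero n] (w : AffinePerm n) : List (SimpleIdx n) × ℤ :=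
  (exists_reduced w).choose

/-- The finite symmetric group inside the extended affine one: the affine permutations that
preserve each block `{m n + 1, …, m n + n}`. Equivalently, the stabilizer of `(0, …, 0)`, that is,
of the quasi-periodic sequence `b_{r + m n} = -m` (`1 ≤ r ≤ n`). -/
def finSymm (n : ℕ) : Subgroup (AffinePerm n) where
  carrier := {w | ∀ i : ℤ, (w.1 i - 1) / n = (i - 1) / n}
  one_mem' := fun _ => rfl
  mul_mem' := fun {a b} ha hb i => by
    simp only [Set.mem_ofPred_eq] at ha hb
    exact (ha (b.1 i)).trans (hb i)
  inv_mem' := fun {a} ha i => by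
    simp only [Set.mem_ofPred_eq] at ha
    have h := ha (a⁻¹.1 i)
    have h2 : a.1 (a⁻¹.1 i) = i := Equiv.apply_symm_apply a.1 i
    rw [h2] at h
    exact h.symm

/-- The residue of `i` modulo `n`; the representatives `1, …, n` correspond to the elements
`0, …, n - 1` of `Fin n`. -/
def resid (n : ℕ) [NeZero n] (i : ℤ) : Fin n :=
  ⟨((i - 1) % n).toNat, by
    have hn : (0 : ℤ) < n := by exact_mod_cast Nat.pos_of_ne_zero (NeZero.ne n)
    have h1 := Int.emod_nonneg (i - 1) hn.ne'
    have h2 := Int.emod_lt_of_pos (i - 1) hn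
    omega⟩

theorem resid_add_mul (n : ℕ) [NeZero n] (i m : ℤ) : resid n (i + n * m) = resid n i := by
  unfold resid
  congr 2
  rw [show i + n * m - 1 = i - 1 + n * m by ring, Int.add_mul_emod_self_left]

/-- Translation by `β`, the affine permutation `i ↦ i + n β_{i mod n}`. -/
def translation {n : ℕ} [NeZero n] (β : Fin n → ℤ) : AffinePerm n :=
  ⟨{ toFun := fun i => i + n * β (resid n i)
     invFun := fun i => i + n * (-β (resid n i))
     left_inv := fun i => by
       simp only [resid_add_mul]
       ring
     right_inv := fun i => by
       simp only [resid_add_mul]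
       ring }, fun i => by
    have h := resid_add_mul n i 1
    rw [mul_one] at h
    simp only [Equiv.coe_fn_mk, h]
    ring⟩

/-- Translation by `-ρ = (0, -1, …, 1 - n)`. -/
def gamma (n : ℕ) [NeZero n] : AffinePerm n := translation fun i => -((i : ℕ) : ℤ)

/-! ### The commutative subalgebras -/

section Algebra

open MvPolynomial

variable {K : Type*} [Field K]

/-- `Y_k` for every integer `k`, with `Y_{r + m n} = q ^ (-m) Y_r`. -/
noncomputable def Ypoly (n : ℕ) [NeZero n] (q : K) (k : ℤ) : MvPolynomial (Fin n) K :=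
  C (q ^ (-((k - 1) / n))) * X (resid n k)

/-- `f_{i,j} = t Y_i - t⁻¹ Y_j`. -/
noncomputable def fpoly (n : ℕ) [NeZero n] (q t : K) (i j : ℤ) : MvPolynomial (Fin n) K :=
  C t * Ypoly n q i - C t⁻¹ * Ypoly n q j

/-- The monomials: inverting them gives the Laurent polynomials `K[𝒴]`. -/
noncomputable def monomials (K : Type*) [Field K] (n : ℕ) : Submonoid (MvPolynomial (Fin n) K) :=
  Submonoid.closure (Set.range X)

/-- The monoid generated by the variables and by all `f_{i,j}` with `i ≢ j` modulo `n`: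
inverting it gives `K[𝒴~]`, the localization of the Laurent polynomials at the `f_{i,j}`. -/
noncomputable def denominators (n : ℕ) [NeZero n] (q t : K) : Submonoid (MvPolynomial (Fin n) K) :=
  Submonoid.closure
    (Set.range X ∪ {p | ∃ i j : ℤ, (i : ZMod n) ≠ (j : ZMod n) ∧ p = fpoly n q t i j})

/-! ### The double affine Hecke algebra and its localization -/

/-- Generators: `T_i`, `π`, `π⁻¹`, and the elements of the commutative algebra `A`. -/
inductive Gen (n : ℕ) (A : Type*)
  | T (i : SimpleIdx n) : Gen n A
  | pi : Gen n A
  | piInv : Gen n A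
  | y (a : A) : Gen n A

/-- The defining relations of the `GL_n` double affine Hecke algebra, with the polynomial ring in
the `Y_k` replaced by its localization at `S`. As the `Y_k` are indexed by all integers,
`T_i Y_i T_i = Y_{i+1}` contains `T_0 Y_n T_0 = q⁻¹ Y_1`, and `π Y_k π⁻¹ = Y_{k+1}` contains
`π Y_n π⁻¹ = q⁻¹ Y_1`. The braid and commutation relations among the `T_i` are dropped for
`n = 2`. -/
inductive Rel (n : ℕ) [NeZero n] (q t : K) (S : Submonoid (MvPolynomial (Fin n) K)) :
    FreeAlgebra K (Gen n (Localization S)) → FreeAlgebra K (Gen n (Localization S)) → Prop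
  | y_add (a b : Localization S) : Rel n q t S
      (FreeAlgebra.ι K (Gen.y (a + b))) (FreeAlgebra.ι K (Gen.y a) + FreeAlgebra.ι K (Gen.y b))
  | y_mul (a b : Localization S) : Rel n q t S
      (FreeAlgebra.ι K (Gen.y (a * b))) (FreeAlgebra.ι K (Gen.y a) * FreeAlgebra.ι K (Gen.y b))
  | y_scalar (c : K) : Rel n q t S
      (FreeAlgebra.ι K (Gen.y (algebraMap K (Localization S) c)))
      (algebraMap K (FreeAlgebra K (Gen n (Localization S))) c)
  | pi_mul_inv : Rel n q t S (FreeAlgebra.ι K Gen.pi * FreeAlgebra.ι K Gen.piInv) 1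
  | inv_mul_pi : Rel n q t S (FreeAlgebra.ι K Gen.piInv * FreeAlgebra.ι K Gen.pi) 1
  | hecke (i : SimpleIdx n) : Rel n q t S
      ((FreeAlgebra.ι K (Gen.T i) - algebraMap K _ t) *
        (FreeAlgebra.ι K (Gen.T i) + algebraMap K _ t⁻¹)) 0
  | braid (i j : SimpleIdx n) (hn : n ≠ 2) (hij : j.1 = i.1 + 1) : Rel n q t S
      (FreeAlgebra.ι K (Gen.T i) * FreeAlgebra.ι K (Gen.T j) * FreeAlgebra.ι K (Gen.T i))
      (FreeAlgebra.ι K (Gen.T j) * FreeAlgebra.ι K (Gen.T i) * FreeAlgebra.ι K (Gen.T j))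
  | comm (i j : SimpleIdx n) (hn : n ≠ 2) (hij : j.1 ≠ i.1 + 1) (hji : i.1 ≠ j.1 + 1) :
      Rel n q t S
        (FreeAlgebra.ι K (Gen.T i) * FreeAlgebra.ι K (Gen.T j))
        (FreeAlgebra.ι K (Gen.T j) * FreeAlgebra.ι K (Gen.T i))
  | pi_T (i j : SimpleIdx n) (hij : j.1 = i.1 + 1) : Rel n q t S
      (FreeAlgebra.ι K Gen.pi * FreeAlgebra.ι K (Gen.T i) * FreeAlgebra.ι K Gen.piInv)
      (FreeAlgebra.ι K (Gen.T j))
  | T_Y_T (i : SimpleIdx n) (k : ℤ) (hk : (k : ZMod n) = i.1) : Rel n q t S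
      (FreeAlgebra.ι K (Gen.T i) *
        FreeAlgebra.ι K (Gen.y (algebraMap _ (Localization S) (Ypoly n q k))) *
        FreeAlgebra.ι K (Gen.T i))
      (FreeAlgebra.ι K (Gen.y (algebraMap _ (Localization S) (Ypoly n q (k + 1)))))
  | T_Y (i : SimpleIdx n) (k : ℤ) (hk : (k : ZMod n) ≠ i.1) (hk' : (k : ZMod n) ≠ i.1 + 1) :
      Rel n q t S
        (FreeAlgebra.ι K (Gen.T i) *
          FreeAlgebra.ι K (Gen.y (algebraMap _ (Localization S) (Ypoly n q k))))
        (FreeAlgebra.ι K (Gen.y (algebraMap _ (Localization S) (Ypoly n q k))) *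
          FreeAlgebra.ι K (Gen.T i))
  | pi_Y (k : ℤ) : Rel n q t S
      (FreeAlgebra.ι K Gen.pi *
        FreeAlgebra.ι K (Gen.y (algebraMap _ (Localization S) (Ypoly n q k))) *
        FreeAlgebra.ι K Gen.piInv)
      (FreeAlgebra.ι K (Gen.y (algebraMap _ (Localization S) (Ypoly n q (k + 1)))))

/-- The algebra with the above generators and relations. -/
def HeckeOver (n : ℕ) [NeZero n] (q t : K) (S : Submonoid (MvPolynomial (Fin n) K)) : Type _ :=
  RingQuot (Rel n q t S)

noncomputable instance (n : ℕ) [NeZero n] (q t : K) (S : Submonoid (MvPolynomial (Fin n) K)) :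
    Ring (HeckeOver n q t S) :=
  inferInstanceAs (Ring (RingQuot (Rel n q t S)))

noncomputable instance (n : ℕ) [NeZero n] (q t : K) (S : Submonoid (MvPolynomial (Fin n) K)) :
    Algebra K (HeckeOver n q t S) :=
  inferInstanceAs (Algebra K (RingQuot (Rel n q t S)))

/-- The `GL_n` double affine Hecke algebra: the `Y_k` generate the Laurent polynomials. -/
abbrev DAHA (n : ℕ) [NeZero n] (q t : K) : Type _ := HeckeOver n q t (monomials K n)

/-- The localization of the double affine Hecke algebra at the `f_{i,j}`, `i ≢ j` modulo `n`
(`locDAHA_isUnit` and `locDAHA_universal` below give its universal property, which is the one of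
the Ore localization). -/
abbrev LocDAHA (n : ℕ) [NeZero n] (q t : K) : Type _ := HeckeOver n q t (denominators n q t)

variable {n : ℕ} [NeZero n] {q t : K} {S : Submonoid (MvPolynomial (Fin n) K)}

/-- The quotient map. -/
noncomputable def quot (n : ℕ) [NeZero n] (q t : K) (S : Submonoid (MvPolynomial (Fin n) K)) :
    FreeAlgebra K (Gen n (Localization S)) →ₐ[K] HeckeOver n q t S :=
  RingQuot.mkAlgHom K (Rel n q t S)

theorem quot_rel {x y : FreeAlgebra K (Gen n (Localization S))} (h : Rel n q t S x y) :
    quot n q t S x = quot n q t S y :=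
  RingQuot.mkAlgHom_rel K h

noncomputable def genT (i : SimpleIdx n) : HeckeOver n q t S :=
  quot n q t S (FreeAlgebra.ι K (Gen.T i))

noncomputable def genY (a : Localization S) : HeckeOver n q t S :=
  quot n q t S (FreeAlgebra.ι K (Gen.y a))

noncomputable def genPi : (HeckeOver n q t S)ˣ where
  val := quot n q t S (FreeAlgebra.ι K Gen.pi)
  inv := quot n q t S (FreeAlgebra.ι K Gen.piInv)
  val_inv := by
    have h := quot_rel (Rel.pi_mul_inv (n := n) (q := q) (t := t) (S := S))
    rw [map_mul, map_one] at h
    exact h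
  inv_val := by
    have h := quot_rel (Rel.inv_mul_pi (n := n) (q := q) (t := t) (S := S))
    rw [map_mul, map_one] at h
    exact h

/-- Images of the generators in an algebra `B` that satisfy the defining relations. -/
structure HeckeData (n : ℕ) [NeZero n] (q t : K) (S : Submonoid (MvPolynomial (Fin n) K))
    (B : Type*) [Ring B] [Algebra K B] where
  T : SimpleIdx n → B
  P : Bˣ
  Y : Localization S →ₐ[K] B
  hecke : ∀ i, (T i - algebraMap K B t) * (T i + algebraMap K B t⁻¹) = 0
  braid : ∀ i j : SimpleIdx n, n ≠ 2 → j.1 = i.1 + 1 → T i * T j * T i = T j * T i * T j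
  comm : ∀ i j : SimpleIdx n, n ≠ 2 → j.1 ≠ i.1 + 1 → i.1 ≠ j.1 + 1 → T i * T j = T j * T i
  pi_T : ∀ i j : SimpleIdx n, j.1 = i.1 + 1 → (P : B) * T i * ((P⁻¹ : Bˣ) : B) = T j
  T_Y_T : ∀ (i : SimpleIdx n) (k : ℤ), (k : ZMod n) = i.1 →
    T i * Y (algebraMap _ _ (Ypoly n q k)) * T i = Y (algebraMap _ _ (Ypoly n q (k + 1)))
  T_Y : ∀ (i : SimpleIdx n) (k : ℤ), (k : ZMod n) ≠ i.1 → (k : ZMod n) ≠ i.1 + 1 →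
    T i * Y (algebraMap _ _ (Ypoly n q k)) = Y (algebraMap _ _ (Ypoly n q k)) * T i
  pi_Y : ∀ k : ℤ, (P : B) * Y (algebraMap _ _ (Ypoly n q k)) * ((P⁻¹ : Bˣ) : B) =
    Y (algebraMap _ _ (Ypoly n q (k + 1)))

/-- The algebra homomorphism determined by the images of the generators. -/
noncomputable def HeckeData.lift {B : Type*} [Ring B] [Algebra K B] (d : HeckeData n q t S B) :
    HeckeOver n q t S →ₐ[K] B :=
  RingQuot.liftAlgHom K ⟨FreeAlgebra.lift K fun
    | Gen.T i => d.T i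
    | Gen.pi => (d.P : B)
    | Gen.piInv => ((d.P⁻¹ : Bˣ) : B)
    | Gen.y a => d.Y a, by
    intro x y h
    cases h with
    | y_add a b => simp
    | y_mul a b => simp
    | y_scalar c => simp
    | pi_mul_inv => simp
    | inv_mul_pi => simp
    | hecke i => simpa using d.hecke i
    | braid i j hn hij => simpa using d.braid i j hn hij
    | comm i j hn hij hji => simpa using d.comm i j hn hij hji
    | pi_T i j hij => simpa using d.pi_T i j hij
    | T_Y_T i k hk => simpa using d.T_Y_T i k hk
    | T_Y i k hk hk' => simpa using d.T_Y i k hk hk'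
    | pi_Y k => simpa using d.pi_Y k⟩

section Lift

variable {B : Type*} [Ring B] [Algebra K B]

theorem HeckeData.lift_T (d : HeckeData n q t S B) (i : SimpleIdx n) :
    d.lift (genT i) = d.T i :=
  (RingQuot.liftAlgHom_mkAlgHom_apply K _ _ _).trans (by simp)

theorem HeckeData.lift_Y (d : HeckeData n q t S B) (a : Localization S) :
    d.lift (genY a) = d.Y a :=
  (RingQuot.liftAlgHom_mkAlgHom_apply K _ _ _).trans (by simp)

theorem HeckeData.lift_Pi (d : HeckeData n q t S B) :
    d.lift ((genPi : (HeckeOver n q t S)ˣ) : HeckeOver n q t S) = d.P :=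
  (RingQuot.liftAlgHom_mkAlgHom_apply K _ _ _).trans (by simp)

theorem heckeOver_hom_ext {f g : HeckeOver n q t S →ₐ[K] B}
    (hT : ∀ i, f (genT i) = g (genT i)) (hY : ∀ a, f (genY a) = g (genY a))
    (hP : f ((genPi : (HeckeOver n q t S)ˣ) : HeckeOver n q t S) =
      g ((genPi : (HeckeOver n q t S)ˣ) : HeckeOver n q t S)) : f = g := by
  refine RingQuot.ringQuot_ext' K _ _ ?_
  refine FreeAlgebra.hom_ext ?_
  funext x
  cases x with
  | T i => exact hT i
  | pi => exact hP
  | piInv =>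
    have h : Units.map (f : HeckeOver n q t S →* B) genPi
        = Units.map (g : HeckeOver n q t S →* B) genPi := Units.ext hP
    exact congrArg (fun u : Bˣ => ((u⁻¹ : Bˣ) : B)) h
  | y a => exact hY a

/-- The inclusion of the commutative subalgebra. -/
noncomputable def genYHom : Localization S →ₐ[K] HeckeOver n q t S where
  toFun := genY
  map_one' := by
    have h := quot_rel (Rel.y_scalar (n := n) (q := q) (t := t) (S := S) 1)
    rw [map_one, map_one, map_one] at h
    exact h
  map_mul' a b := by
    have h := quot_rel (Rel.y_mul (n := n) (q := q) (t := t) (S := S) a b)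
    rw [map_mul] at h
    exact h
  map_zero' := by
    have h := quot_rel (Rel.y_scalar (n := n) (q := q) (t := t) (S := S) 0)
    rw [map_zero, map_zero, map_zero] at h
    exact h
  map_add' a b := by
    have h := quot_rel (Rel.y_add (n := n) (q := q) (t := t) (S := S) a b)
    rw [map_add] at h
    exact h
  commutes' c := by
    have h := quot_rel (Rel.y_scalar (n := n) (q := q) (t := t) (S := S) c)
    rw [AlgHom.commutes] at h
    exact h

/-- The images of the generators under a homomorphism, with the commutative part replaced by an
algebra homomorphism that agrees with it on polynomials. -/
noncomputable def HeckeData.ofHom {S' : Submonoid (MvPolynomial (Fin n) K)}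
    (f : HeckeOver n q t S →ₐ[K] B) (Y : Localization S' →ₐ[K] B)
    (h : ∀ p : MvPolynomial (Fin n) K,
      Y (algebraMap _ _ p) = f (genY (algebraMap _ (Localization S) p))) :
    HeckeData n q t S' B where
  T i := f (genT i)
  P := Units.map (f : HeckeOver n q t S →* B) genPi
  Y := Y
  hecke i := by
    have h := congrArg f (quot_rel (Rel.hecke (q := q) (t := t) (S := S) i))
    simp only [map_mul, map_sub, map_add, map_zero, AlgHom.commutes] at h
    exact h
  braid i j hn hij := by
    have h := congrArg f
      (quot_rel (Rel.braid (q := q) (t := t) (S := S) i j hn hij))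
    simp only [map_mul] at h
    exact h
  comm i j hn hij hji := by
    have h := congrArg f
      (quot_rel (Rel.comm (q := q) (t := t) (S := S) i j hn hij hji))
    simp only [map_mul] at h
    exact h
  pi_T i j hij := by
    have h := congrArg f
      (quot_rel (Rel.pi_T (q := q) (t := t) (S := S) i j hij))
    simp only [map_mul] at h
    exact h
  T_Y_T i k hk := by
    have h1 := congrArg f
      (quot_rel (Rel.T_Y_T (q := q) (t := t) (S := S) i k hk))
    rw [h, h]
    simp only [map_mul] at h1
    exact h1
  T_Y i k hk hk' := by
    have h1 := congrArg f
      (quot_rel (Rel.T_Y (q := q) (t := t) (S := S) i k hk hk'))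
    rw [h]
    simp only [map_mul] at h1
    exact h1
  pi_Y k := by
    have h1 := congrArg f
      (quot_rel (Rel.pi_Y (q := q) (t := t) (S := S) k))
    rw [h, h]
    simp only [map_mul] at h1
    exact h1

theorem monomials_le : monomials K n ≤ denominators n q t :=
  Submonoid.closure_mono Set.subset_union_left

/-- The inclusion of the Laurent polynomials `K[𝒴]` into `K[𝒴~]`. -/
noncomputable def laurentToLoc (n : ℕ) [NeZero n] (q t : K) :
    Localization (monomials K n) →ₐ[K] Localization (denominators n q t) :=
  { IsLocalization.map (Localization (denominators n q t)) (RingHom.id _)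
      (show monomials K n ≤ (denominators n q t).comap (RingHom.id _) from monomials_le) with
    commutes' := fun c => by
      rw [IsScalarTower.algebraMap_apply K (MvPolynomial (Fin n) K) (Localization (monomials K n)),
        IsScalarTower.algebraMap_apply K (MvPolynomial (Fin n) K)
          (Localization (denominators n q t))]
      exact IsLocalization.map_eq _ _ }

theorem laurentToLoc_algebraMap (p : MvPolynomial (Fin n) K) :
    laurentToLoc n q t (algebraMap _ _ p) = algebraMap _ _ p :=
  IsLocalization.map_eq (M := monomials K n)
    (show monomials K n ≤ (denominators n q t).comap (RingHom.id _) from monomials_le) p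

/-- The canonical homomorphism from the double affine Hecke algebra to its localization. -/
noncomputable def toLoc (n : ℕ) [NeZero n] (q t : K) : DAHA n q t →ₐ[K] LocDAHA n q t :=
  (HeckeData.ofHom (AlgHom.id K (LocDAHA n q t)) (genYHom.comp (laurentToLoc n q t)) fun p => by
    change genY (laurentToLoc n q t (algebraMap _ _ p)) = genY (algebraMap _ _ p)
    rw [laurentToLoc_algebraMap]).lift

theorem locDAHA_isUnit (i j : ℤ) (hij : (i : ZMod n) ≠ (j : ZMod n)) :
    IsUnit (toLoc n q t (genY (algebraMap _ _ (fpoly n q t i j)))) := by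
  rw [toLoc, HeckeData.lift_Y]
  change IsUnit (genYHom (laurentToLoc n q t (algebraMap _ _ _)))
  rw [laurentToLoc_algebraMap]
  refine IsUnit.map genYHom ?_
  exact IsLocalization.map_units (M := denominators n q t) (Localization (denominators n q t))
    ⟨fpoly n q t i j, Submonoid.subset_closure (Or.inr ⟨i, j, hij, rfl⟩)⟩

theorem locDAHA_universal (f : DAHA n q t →ₐ[K] B)
    (hf : ∀ i j : ℤ, (i : ZMod n) ≠ (j : ZMod n) →
      IsUnit (f (genY (algebraMap _ _ (fpoly n q t i j))))) :
    ∃! g : LocDAHA n q t →ₐ[K] B, g.comp (toLoc n q t) = f := by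
  let f₀ : MvPolynomial (Fin n) K →ₐ[K] B :=
    (f.comp genYHom).comp (Algebra.algHom K _ (Localization (monomials K n)))
  have hunit : ∀ s ∈ denominators n q t, IsUnit (f₀ s) := by
    intro s hs
    induction hs using Submonoid.closure_induction with
    | mem x hx =>
      rcases hx with ⟨i, rfl⟩ | ⟨i, j, hij, rfl⟩
      · refine IsUnit.map (f.comp genYHom) ?_
        exact IsLocalization.map_units (M := monomials K n) (Localization (monomials K n))
          ⟨X i, Submonoid.subset_closure ⟨i, rfl⟩⟩
      · exact hf i j hij
    | one => simp
    | mul x y _ _ hx hy => rw [map_mul]; exact hx.mul hy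
  let fS : denominators n q t →* Bˣ :=
    IsUnit.liftRight ((f₀ : MvPolynomial (Fin n) K →* B).comp (denominators n q t).subtype)
      fun s => hunit s.1 s.2
  have hfS : ∀ s : denominators n q t, (f₀ : MvPolynomial (Fin n) K →+* B) s = fS s := fun s => rfl
  let Y₀ : Localization (denominators n q t) →+* B :=
    OreLocalization.universalHom (f₀ : MvPolynomial (Fin n) K →+* B) fS hfS
  have hY₀ : ∀ p, Y₀ (algebraMap _ _ p) = f₀ p := fun p =>
    OreLocalization.universalHom_commutes (f₀ : MvPolynomial (Fin n) K →+* B) fS hfS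
  let Y : Localization (denominators n q t) →ₐ[K] B :=
    { Y₀ with
      commutes' := fun c => by
        rw [IsScalarTower.algebraMap_apply K (MvPolynomial (Fin n) K)
          (Localization (denominators n q t))]
        exact (hY₀ _).trans (f₀.commutes c) }
  have hY : ∀ p : MvPolynomial (Fin n) K,
      Y (algebraMap _ _ p) = f (genY (algebraMap _ (Localization (monomials K n)) p)) := hY₀
  have hcomp : Y.comp (laurentToLoc n q t) = f.comp genYHom := by
    refine AlgHom.coe_ringHom_injective (IsLocalization.ringHom_ext (monomials K n) ?_)
    refine RingHom.ext fun p => ?_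
    change Y (laurentToLoc n q t (algebraMap _ _ p)) = _
    rw [laurentToLoc_algebraMap]
    exact hY p
  refine ⟨(HeckeData.ofHom f Y hY).lift, ?_, ?_⟩
  · refine heckeOver_hom_ext (fun i => ?_) (fun a => ?_) ?_
    · rw [AlgHom.comp_apply, toLoc, HeckeData.lift_T]
      exact HeckeData.lift_T _ i
    · rw [AlgHom.comp_apply, toLoc, HeckeData.lift_Y]
      exact (HeckeData.lift_Y _ _).trans (congrArg (fun h => h a) hcomp)
    · rw [AlgHom.comp_apply, toLoc, HeckeData.lift_Pi]
      exact HeckeData.lift_Pi _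
  · intro g hg
    have hg' : ∀ x, g (toLoc n q t x) = f x := fun x => congrArg (fun h => h x) hg
    refine heckeOver_hom_ext (fun i => ?_) (fun a => ?_) ?_
    · have h := hg' (genT i)
      rw [toLoc, HeckeData.lift_T] at h
      rw [HeckeData.lift_T]
      exact h
    · rw [HeckeData.lift_Y]
      have h : g.comp genYHom = Y := by
        refine AlgHom.coe_ringHom_injective (IsLocalization.ringHom_ext (denominators n q t) ?_)
        refine RingHom.ext fun p => ?_
        have h := hg' (genY (algebraMap _ _ p))
        rw [toLoc, HeckeData.lift_Y] at h
        change g (genY (laurentToLoc n q t (algebraMap _ _ p))) = _ at h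
        rw [laurentToLoc_algebraMap] at h
        exact h.trans (hY p).symm
      exact congrArg (fun h => h a) h
    · have h := hg' ((genPi : (DAHA n q t)ˣ) : DAHA n q t)
      rw [toLoc, HeckeData.lift_Pi] at h
      rw [HeckeData.lift_Pi]
      exact h

end Lift

/-- `T_w = T_{i₁} ⋯ T_{iₘ} π ^ k` for a reduced expression `w = s_{i₁} ⋯ s_{iₘ} π ^ k`. -/
noncomputable def Tw (w : AffinePerm n) : HeckeOver n q t S :=
  ((redWord w).1.map genT).prod * ((genPi ^ (redWord w).2 : (HeckeOver n q t S)ˣ) :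
    HeckeOver n q t S)

/-! ### Intertwiners and normal ordering -/

theorem fpoly_mem (i : SimpleIdx n) :
    fpoly n q t (i.1.cast : ℤ) ((i.1.cast : ℤ) + 1) ∈ denominators n q t := by
  refine Submonoid.subset_closure (Or.inr ⟨_, _, ?_, rfl⟩)
  rw [Int.cast_add, Int.cast_one, ZMod.intCast_zmod_cast]
  exact i.2.symm

/-- Cherednik's intertwiner `φ_i = T_i Y_i - Y_i T_i`, for the representative `0 ≤ i ≤ n - 1`. -/
noncomputable def phi (i : SimpleIdx n) : HeckeOver n q t S :=
  genT i * genY (algebraMap _ (Localization S) (Ypoly n q (i.1.cast : ℤ))) -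
    genY (algebraMap _ (Localization S) (Ypoly n q (i.1.cast : ℤ))) * genT i

/-- The renormalized intertwiner `ν_i = φ_i f_{i,i+1}⁻¹`. -/
noncomputable def nuSimple (i : SimpleIdx n) : LocDAHA n q t :=
  phi i * genY (Localization.mk 1 ⟨fpoly n q t (i.1.cast : ℤ) ((i.1.cast : ℤ) + 1), fpoly_mem i⟩)

/-- `ν_w = ν_{i₁} ⋯ ν_{iₘ} π ^ k` for a reduced expression `w = s_{i₁} ⋯ s_{iₘ} π ^ k`. -/
noncomputable def nu (w : AffinePerm n) : LocDAHA n q t :=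
  ((redWord w).1.map nuSimple).prod * ((genPi ^ (redWord w).2 : (LocDAHA n q t)ˣ) : LocDAHA n q t)

/-- `h = ∑ T_x g_x`, a finite sum with coefficients `g_x` in `K[𝒴~]` on the right. -/
def IsNormalOrdering (h : LocDAHA n q t)
    (g : AffinePerm n →₀ Localization (denominators n q t)) : Prop :=
  h = g.sum fun x c => Tw x * genY c

/-- The normally ordered expression `∑ T_x g_x` has leading term `T_w`. -/
def HasLeadingTerm (g : AffinePerm n →₀ Localization (denominators n q t)) (w : AffinePerm n) :
    Prop :=
  g w ≠ 0 ∧ ∀ x, x ≠ w → g x ≠ 0 → len x < len w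

/-- `g` has a pole at `a`: it is not a quotient `P / Q` of polynomials with `Q(a) ≠ 0`. -/
def HasPoleAt (a : Fin n → K) (g : Localization S) : Prop :=
  ¬ ∃ P Q : MvPolynomial (Fin n) K, eval a Q ≠ 0 ∧
    g * algebraMap _ (Localization S) Q = algebraMap _ (Localization S) P

/-- `g` has a zero at `a`: it is a quotient `P / Q` of polynomials with `Q(a) ≠ 0`, `P(a) = 0`. -/
def HasZeroAt (a : Fin n → K) (g : Localization S) : Prop :=
  ∃ P Q : MvPolynomial (Fin n) K, eval a Q ≠ 0 ∧ eval a P = 0 ∧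
    g * algebraMap _ (Localization S) Q = algebraMap _ (Localization S) P

/-- The point `t^{-2ρ}`, that is `Y_i = t ^ (2 - 2 i)` for `1 ≤ i ≤ n`. -/
def tRho (n : ℕ) (t : K) : Fin n → K := fun i => t ^ (-2 * ((i : ℕ) : ℤ))

end Algebra

end QDaha

/-!
The localized double affine Hecke algebra acts on the field `F` of rational functions in the `Y_k`:
an affine permutation `w` acts by `Y_k ↦ Y_{w k}` (`ratAct`, `permOp`), functions act by
multiplication (`mulOp`), and `T_i` acts by the Demazure–Lusztig operator `opT`. Under this
representation `rep` the intertwiner `ν_w` becomes the bare permutation `w` (`rep_nu`). Since `q` is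
not a root of unity, distinct affine permutations are linearly independent over `F`
(`skewSum_injective`), and `T_x` is triangular with respect to them: it is `x` times a nonzero
function `leadCoef x`, plus permutations of smaller length. Hence the operators `T_x` are linearly
independent over `F`, which gives uniqueness of the normal ordering, and the normal ordering of
`ν_w` has leading term `T_w` with coefficient `(leadCoef w)⁻¹`
(`leading_of_normalSum_eq_permOp`). Existence is a matter of moving functions to the right
(`exists_isNormalOrdering`); that `T_w` behaves well under multiplication by `T_i` rests on
Matsumoto's theorem `prod_eq_of_isReduced`.

It remains to see that `γ⁻¹ w γ` is a combination `∑ T_x g_x` with coefficients regular at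
`t^{-2ρ}`. Points of the form `Y_k = t ^ (2 e_k)` are described by integral sequences `e`, and
`regularOps e` is the set of operators with coefficients regular at such a point. If `v` is regular
at `e` and `u` is regular at the image `e ∘ v⁻¹`, then `u v` is regular at `e`
(`mul_permOp_mem_regularOps`). So it suffices to treat `w = s_i`, as `γ⁻¹ w γ` fixes the point. Now
`γ⁻¹ s_i γ = v s_j v⁻¹` with `v = s_i s_{i+1} ⋯ s_{i+n-2}` and `j = i + n - 1`. The operator `v⁻¹` is
regular at `t^{-2ρ}`. At the image of the point under `v⁻¹`, which is fixed by `s_j`, the operator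
`v` has a simple pole along the wall of `s_j` (`permOp_up_eq`), and therefore `v (1 + s_j)` is
regular, being of the form `E (1 - s_j) (Y_j - Y_{j+1})⁻¹` with `E` regular: the factor on the right
is `(t - T_j) f_{j,j+1}⁻¹`, and regular functions move through it, as Demazure's difference
quotients of regular functions are regular. Thus `1 + v s_j v⁻¹` is regular.

Finally the leading coefficient has no zero because its inverse `leadCoef (γ⁻¹ w γ)` is regular. The
latter is the product of `f_{a,b} / (Y_a - Y_b)` over the inversions `(a, b)`. Its poles at
`t^{-2ρ}` come from inversions with `e_a = e_b`, and its zeros from inversions with `e_b = e_a + 1`.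
An element of `γ⁻¹ 𝔖_n γ` permutes `{k | e_k = 0}`, whose elements are at least `n + 1` apart, so the
two kinds of inversions correspond to each other by `b ↦ b + n`, and the factors cancel
(`wordLead_mul_levelProd`, `leadCoef_mem_regularAt`).
-/

namespace QDaha

/-! ### Reduced words -/

section Words

variable {n : ℕ}

theorem intCast_eq_iff_exists (a b : ℤ) :
    (a : ZMod n) = (b : ZMod n) ↔ ∃ m : ℤ, b = a + m * n := by
  rw [ZMod.intCast_eq_intCast_iff_dvd_sub]
  constructor
  · rintro ⟨m, hm⟩
    exact ⟨m, by linarith⟩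
  · rintro ⟨m, hm⟩
    exact ⟨m, by rw [hm]; ring⟩

theorem simpleFun_left {i : SimpleIdx n} {k : ℤ} (h : (k : ZMod n) = i.1) :
    simpleFun i k = k + 1 := by
  simp [simpleFun, h]

theorem simpleFun_right {i : SimpleIdx n} {k : ℤ} (h : (k : ZMod n) = i.1) :
    simpleFun i (k + 1) = k := by
  have h' := i.2
  simp [simpleFun, h, h']

theorem simpleFun_other {i : SimpleIdx n} {k : ℤ} (h : (k : ZMod n) ≠ i.1)
    (h' : (k : ZMod n) ≠ i.1 + 1) : simpleFun i k = k := by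
  simp [simpleFun, h, h']

/-- A simple reflection reverses the order of two integers only if it exchanges them. -/
theorem simpleFun_reverses {i : SimpleIdx n} {c d : ℤ} (h : c < d)
    (h' : simpleFun i d < simpleFun i c) : d = c + 1 ∧ (c : ZMod n) = i.1 := by
  unfold simpleFun at h'
  split_ifs at h' with h1 h2 h3 h4 h5 h6 <;> try omega
  all_goals exact ⟨by omega, by assumption⟩

theorem inv_simple (i : SimpleIdx n) : (simple i)⁻¹ = simple i :=
  inv_eq_of_mul_eq_one_left (simple_mul_self i)

theorem simple_mul_cancel (i : SimpleIdx n) (w : AffinePerm n) :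
    simple i * (simple i * w) = w := by
  rw [← mul_assoc, simple_mul_self, one_mul]

theorem inv_apply_self (w : AffinePerm n) (k : ℤ) : w⁻¹.1 (w.1 k) = k :=
  Equiv.symm_apply_apply w.1 k

theorem apply_inv_self (w : AffinePerm n) (k : ℤ) : w.1 (w⁻¹.1 k) = k :=
  Equiv.apply_symm_apply w.1 k

/-- Conjugation carries `s_j` to `s_i` if adjacent positions `c, c + 1` go to `k, k + 1`. -/
theorem simple_mul_eq_mul_simple {u : AffinePerm n} {i j : SimpleIdx n} {c k : ℤ}
    (hc : (c : ZMod n) = j.1) (hk : (k : ZMod n) = i.1) (h1 : u.1 c = k)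
    (h2 : u.1 (c + 1) = k + 1) : simple i * u = u * simple j := by
  have hm : ∀ m : ℤ, ((k + m * n : ℤ) : ZMod n) = i.1 := fun m => by simp [hk]
  have hm' : ∀ m : ℤ, ((c + m * n : ℤ) : ZMod n) = j.1 := fun m => by simp [hc]
  ext x
  change simpleFun i (u.1 x) = u.1 (simpleFun j x)
  by_cases hx : (x : ZMod n) = j.1
  · obtain ⟨m, rfl⟩ := (intCast_eq_iff_exists c x).1 (hc.trans hx.symm)
    rw [simpleFun_left hx, affine_add_mul, h1, simpleFun_left (hm m),
      show c + m * n + 1 = c + 1 + m * n by ring, affine_add_mul, h2]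
    ring
  · by_cases hx' : (x : ZMod n) = j.1 + 1
    · obtain ⟨m, rfl⟩ := (intCast_eq_iff_exists (n := n) (c + 1) x).1 (by push_cast; rw [hc, hx'])
      rw [show c + 1 + m * n = c + m * n + 1 by ring, simpleFun_right (hm' m),
        show c + m * n + 1 = c + 1 + m * n by ring, affine_add_mul, h2, affine_add_mul, h1,
        show k + 1 + m * n = k + m * n + 1 by ring, simpleFun_right (hm m)]
    · rw [simpleFun_other hx hx', simpleFun_other]
      · intro h
        obtain ⟨m, h⟩ := (intCast_eq_iff_exists k (u.1 x)).1 (hk.trans h.symm)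
        rw [← h1, ← affine_add_mul] at h
        exact hx (by rw [u.1.injective h, hm'])
      · intro h
        obtain ⟨m, h⟩ := (intCast_eq_iff_exists (n := n) (k + 1) (u.1 x)).1
          (by push_cast; rw [hk, h])
        rw [← h2, ← affine_add_mul] at h
        exact hx' (by rw [u.1.injective h]; simp [hc])

theorem evalWord_cons (i : SimpleIdx n) (l : List (SimpleIdx n)) (k : ℤ) :
    evalWord (i :: l, k) = simple i * evalWord (l, k) := by
  simp [evalWord, mul_assoc]

theorem shift_zpow_apply (k i : ℤ) : (shift n ^ k).1 i = i + k := by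
  induction k using Int.induction_on generalizing i with
  | zero => simp
  | succ m ih =>
    rw [zpow_add_one]
    change (shift n ^ (m : ℤ)).1 (i + 1) = _
    rw [ih]
    ring
  | pred m ih =>
    have h := ih (i - 1)
    rw [show (-(m : ℤ)) = -(m : ℤ) - 1 + 1 by ring, zpow_add_one] at h
    change (shift n ^ (-(m : ℤ) - 1)).1 (i - 1 + 1) = _ at h
    rw [sub_add_cancel] at h
    rw [h]
    ring

theorem len_le_length {w : AffinePerm n} {p : List (SimpleIdx n) × ℤ} (h : evalWord p = w) :
    len w ≤ p.1.length :=
  Nat.sInf_le ⟨p, h, rfl⟩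

/-- `s_i` is a left descent of `w`: the values `i` and `i + 1` occur in `w` in reversed order. -/
def IsDescent (i : SimpleIdx n) (w : AffinePerm n) : Prop :=
  w⁻¹.1 ((i.1.cast : ℤ) + 1) < w⁻¹.1 (i.1.cast : ℤ)

theorem isDescent_iff {i : SimpleIdx n} {w : AffinePerm n} {k : ℤ} (hk : (k : ZMod n) = i.1) :
    IsDescent i w ↔ w⁻¹.1 (k + 1) < w⁻¹.1 k := by
  obtain ⟨m, rfl⟩ := (intCast_eq_iff_exists (i.1.cast : ℤ) k).1
    (by rw [ZMod.intCast_zmod_cast, hk])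
  rw [show (i.1.cast : ℤ) + m * n + 1 = (i.1.cast : ℤ) + 1 + m * n by ring, affine_add_mul,
    affine_add_mul, IsDescent]
  constructor <;> intro h <;> linarith

theorem not_isDescent_iff {i : SimpleIdx n} {w : AffinePerm n} {k : ℤ} (hk : (k : ZMod n) = i.1) :
    ¬ IsDescent i w ↔ w⁻¹.1 k < w⁻¹.1 (k + 1) := by
  rw [isDescent_iff hk, not_lt]
  refine ⟨fun h => lt_of_le_of_ne h fun h' => ?_, le_of_lt⟩
  have := w⁻¹.1.injective h'
  omega

theorem isDescent_simple_mul {i : SimpleIdx n} {w : AffinePerm n} :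
    IsDescent i (simple i * w) ↔ ¬ IsDescent i w := by
  have hk : (((i.1.cast : ℤ)) : ZMod n) = i.1 := ZMod.intCast_zmod_cast _
  rw [not_isDescent_iff hk, isDescent_iff hk, mul_inv_rev, inv_simple]
  change w⁻¹.1 (simpleFun i _) < w⁻¹.1 (simpleFun i _) ↔ _
  rw [simpleFun_left hk, simpleFun_right hk]

/-- The exchange condition with a prefix `u`: the letter to delete is the one at which the
relative order of the positions of `i` and `i + 1` changes. -/
theorem exists_exchange_aux (i : SimpleIdx n) (k : ℤ) (l : List (SimpleIdx n)) :
    ∀ u : AffinePerm n, ¬ IsDescent i u → IsDescent i (u * evalWord (l, k)) →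
      ∃ l' : List (SimpleIdx n), l'.length + 1 = l.length ∧
        u * evalWord (l', k) = simple i * (u * evalWord (l, k)) := by
  have hi : (((i.1.cast : ℤ)) : ZMod n) = i.1 := ZMod.intCast_zmod_cast _
  induction l with
  | nil =>
    intro u hu h
    exfalso
    rw [not_isDescent_iff hi] at hu
    rw [isDescent_iff hi, mul_inv_rev] at h
    have he : (evalWord ([], k) : AffinePerm n)⁻¹ = shift n ^ (-k) := by
      simp [evalWord]
    rw [he] at h
    change (shift n ^ (-k)).1 _ < (shift n ^ (-k)).1 _ at h
    rw [shift_zpow_apply, shift_zpow_apply] at h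
    omega
  | cons j l ih =>
    intro u hu h
    by_cases hj : IsDescent i (u * simple j)
    · refine ⟨l, rfl, ?_⟩
      rw [not_isDescent_iff hi] at hu
      rw [isDescent_iff hi, mul_inv_rev, inv_simple] at hj
      obtain ⟨h1, h2⟩ := simpleFun_reverses hu hj
      have h3 : simple i * u = u * simple j := by
        refine simple_mul_eq_mul_simple h2 hi (apply_inv_self u _) ?_
        rw [← h1, apply_inv_self]
      rw [evalWord_cons, ← mul_assoc, h3, mul_assoc, simple_mul_cancel]
    · rw [evalWord_cons, ← mul_assoc] at h
      obtain ⟨l', hl, he⟩ := ih _ hj h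
      refine ⟨j :: l', by simp [hl], ?_⟩
      rw [evalWord_cons, evalWord_cons, ← mul_assoc, he, mul_assoc u]

/-- The exchange condition. -/
theorem exists_exchange {i : SimpleIdx n} {k : ℤ} {l : List (SimpleIdx n)}
    (h : IsDescent i (evalWord (l, k))) :
    ∃ l' : List (SimpleIdx n), l'.length + 1 = l.length ∧
      evalWord (l', k) = simple i * evalWord (l, k) := by
  have h1 : ¬ IsDescent i (1 : AffinePerm n) := by
    simp [IsDescent]
  simpa using exists_exchange_aux i k l 1 h1 (by simpa using h)

theorem isDescent_simple_mul_of_comm {i j : SimpleIdx n} {w : AffinePerm n}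
    (h1 : j.1 ≠ i.1 + 1) (h2 : i.1 ≠ j.1 + 1) (h3 : i ≠ j) (h : IsDescent j w) :
    IsDescent j (simple i * w) := by
  have hk : (((j.1.cast : ℤ)) : ZMod n) = j.1 := ZMod.intCast_zmod_cast _
  have h3' : i.1 ≠ j.1 := fun h => h3 (Subtype.ext h)
  rw [isDescent_iff hk] at h ⊢
  rw [mul_inv_rev, inv_simple]
  change w⁻¹.1 (simpleFun i _) < w⁻¹.1 (simpleFun i _)
  rwa [simpleFun_other (k := (j.1.cast : ℤ)) (by rw [hk]; exact h3'.symm) (by rw [hk]; exact h1),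
    simpleFun_other (by push_cast [hk]; exact h2.symm)
      (by push_cast [hk]; simpa using h3'.symm)]

theorem simple_comm {i j : SimpleIdx n} (h1 : j.1 ≠ i.1 + 1) (h2 : i.1 ≠ j.1 + 1) (h3 : i ≠ j) :
    simple i * simple j = simple j * simple i := by
  have hk : (((i.1.cast : ℤ)) : ZMod n) = i.1 := ZMod.intCast_zmod_cast _
  have h3' : i.1 ≠ j.1 := fun h => h3 (Subtype.ext h)
  refine simple_mul_eq_mul_simple hk hk ?_ ?_
  · exact simpleFun_other (by rw [hk]; exact h3') (by rw [hk]; exact h2)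
  · exact simpleFun_other (by push_cast [hk]; exact h1.symm)
      (by push_cast [hk]; simpa using h3')

variable [NeZero n]

theorem len_simple_mul_le (i : SimpleIdx n) (w : AffinePerm n) :
    len (simple i * w) ≤ len w + 1 := by
  obtain ⟨⟨l, k⟩, h1, h2⟩ := exists_reduced w
  rw [← h2]
  exact len_le_length (p := (i :: l, k)) (by rw [evalWord_cons, h1])

theorem len_of_isDescent {i : SimpleIdx n} {w : AffinePerm n} (h : IsDescent i w) :
    len (simple i * w) + 1 = len w := by
  obtain ⟨⟨l, k⟩, h1, h2⟩ := exists_reduced w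
  obtain ⟨l', h3, h4⟩ := exists_exchange (h1 ▸ h)
  have h5 := len_le_length h4
  have h6 := len_simple_mul_le i (simple i * w)
  rw [simple_mul_cancel] at h6
  rw [h1] at h5
  simp only at h2 h5
  omega

theorem len_of_not_isDescent {i : SimpleIdx n} {w : AffinePerm n} (h : ¬ IsDescent i w) :
    len (simple i * w) = len w + 1 := by
  have h1 := len_of_isDescent (isDescent_simple_mul.2 h)
  rw [simple_mul_cancel] at h1
  exact h1.symm

theorem isReduced_cons {i : SimpleIdx n} {l : List (SimpleIdx n)} {k : ℤ} {w : AffinePerm n} :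
    IsReduced w (i :: l, k) ↔ IsDescent i w ∧ IsReduced (simple i * w) (l, k) := by
  constructor
  · rintro ⟨h1, h2⟩
    rw [evalWord_cons] at h1
    have h3 : simple i * w = evalWord (l, k) := by rw [← h1, simple_mul_cancel]
    have h4 : IsDescent i w := by
      by_contra h
      have h5 := len_of_not_isDescent h
      have h6 := len_le_length h3.symm
      simp only [List.length_cons] at h2 h6
      omega
    refine ⟨h4, h3.symm, ?_⟩
    have := len_of_isDescent h4
    simp only [List.length_cons] at h2 ⊢
    omega
  · rintro ⟨h1, h2, h3⟩
    have := len_of_isDescent h1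
    refine ⟨by rw [evalWord_cons, h2, simple_mul_cancel], ?_⟩
    simp only [List.length_cons] at h3 ⊢
    omega

/-- For `n ≥ 3` the residues of three consecutive integers are distinct. -/
theorem two_ne_zero_of_simpleIdx (i : SimpleIdx n) (hn : n ≠ 2) : (2 : ZMod n) ≠ 0 := by
  intro h
  have h1 : n ∣ 2 := (ZMod.natCast_eq_zero_iff 2 n).1 (by exact_mod_cast h)
  have h2 : n ≤ 2 := Nat.le_of_dvd (by norm_num) h1
  have h3 : n ≠ 0 := NeZero.ne n
  have h4 : n = 1 := by omega
  subst h4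
  exact i.2 (Subsingleton.elim _ _)

/-- Each of two adjacent simple reflections `s_i`, `s_{i+1}` fixes one of `i`, `i + 1`, `i + 2`. -/
theorem simpleFun_adjacent {i j : SimpleIdx n} (hn : n ≠ 2) (hij : j.1 = i.1 + 1) {k : ℤ}
    (hk : (k : ZMod n) = i.1) :
    simpleFun j k = k ∧ simpleFun i (k + 1 + 1) = k + 1 + 1 ∧ ((k + 1 : ℤ) : ZMod n) = j.1 := by
  have h2 := two_ne_zero_of_simpleIdx i hn
  have h1 : (1 : ZMod n) ≠ 0 := by simpa using i.2
  refine ⟨simpleFun_other ?_ ?_, simpleFun_other ?_ ?_, ?_⟩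
  · rw [hk, hij]
    simpa using h1
  · rw [hk, hij, add_assoc, one_add_one_eq_two]
    simpa using h2
  · push_cast
    rw [hk, add_assoc, one_add_one_eq_two]
    simpa using h2
  · push_cast
    rw [hk]
    simpa using h1
  · push_cast
    rw [hk, hij]

theorem simple_braid {i j : SimpleIdx n} (hn : n ≠ 2) (hij : j.1 = i.1 + 1) :
    simple i * simple j * simple i = simple j * simple i * simple j := by
  have hk : (((i.1.cast : ℤ)) : ZMod n) = i.1 := ZMod.intCast_zmod_cast _
  obtain ⟨e1, e2, hj⟩ := simpleFun_adjacent hn hij hk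
  have key : simple j * (simple i * simple j) = simple i * simple j * simple i := by
    refine simple_mul_eq_mul_simple hk hj ?_ ?_
    · change simpleFun i (simpleFun j _) = _
      rw [e1, simpleFun_left hk]
    · change simpleFun i (simpleFun j _) = _
      rw [simpleFun_left hj, e2]
  rw [← key, mul_assoc]

theorem exists_reduced_comm {i j : SimpleIdx n} {w : AffinePerm n}
    (h1 : j.1 ≠ i.1 + 1) (h2 : i.1 ≠ j.1 + 1) (h3 : i ≠ j) (hi : IsDescent i w)
    (hj : IsDescent j w) : ∃ q : List (SimpleIdx n) × ℤ, IsReduced w (i :: j :: q.1, q.2) ∧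
      IsReduced w (j :: i :: q.1, q.2) := by
  obtain ⟨q, hq⟩ := exists_reduced (simple j * (simple i * w))
  refine ⟨q, ?_, ?_⟩
  · exact isReduced_cons.2 ⟨hi, isReduced_cons.2 ⟨isDescent_simple_mul_of_comm h1 h2 h3 hj, hq⟩⟩
  · rw [← mul_assoc, ← simple_comm h1 h2 h3, mul_assoc] at hq
    exact isReduced_cons.2 ⟨hj,
      isReduced_cons.2 ⟨isDescent_simple_mul_of_comm h2 h1 h3.symm hi, hq⟩⟩

theorem exists_reduced_braid {i j : SimpleIdx n} {w : AffinePerm n} (hn : n ≠ 2)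
    (hij : j.1 = i.1 + 1) (hi : IsDescent i w) (hj : IsDescent j w) :
    ∃ q : List (SimpleIdx n) × ℤ, IsReduced w (i :: j :: i :: q.1, q.2) ∧
      IsReduced w (j :: i :: j :: q.1, q.2) := by
  have hk : (((i.1.cast : ℤ)) : ZMod n) = i.1 := ZMod.intCast_zmod_cast _
  obtain ⟨e1, e2, hj'⟩ := simpleFun_adjacent hn hij hk
  have hi2 := (isDescent_iff hk).1 hi
  have hj2 := (isDescent_iff hj').1 hj
  obtain ⟨q, hq⟩ := exists_reduced (simple i * (simple j * (simple i * w)))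
  have d1 : IsDescent j (simple i * w) := by
    rw [isDescent_iff hj', mul_inv_rev, inv_simple]
    change w⁻¹.1 (simpleFun i _) < w⁻¹.1 (simpleFun i _)
    rw [e2, simpleFun_right hk]
    exact hj2.trans hi2
  have d2 : IsDescent i (simple j * (simple i * w)) := by
    rw [isDescent_iff hk, mul_inv_rev, mul_inv_rev, inv_simple, inv_simple]
    change w⁻¹.1 (simpleFun i (simpleFun j _)) < w⁻¹.1 (simpleFun i (simpleFun j _))
    rw [e1, simpleFun_left hj', simpleFun_left hk, e2]
    exact hj2
  have d3 : IsDescent i (simple j * w) := by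
    rw [isDescent_iff hk, mul_inv_rev, inv_simple]
    change w⁻¹.1 (simpleFun j _) < w⁻¹.1 (simpleFun j _)
    rw [e1, simpleFun_left hj']
    exact hj2.trans hi2
  have d4 : IsDescent j (simple i * (simple j * w)) := by
    rw [isDescent_iff hj', mul_inv_rev, mul_inv_rev, inv_simple, inv_simple]
    change w⁻¹.1 (simpleFun j (simpleFun i _)) < w⁻¹.1 (simpleFun j (simpleFun i _))
    rw [e2, simpleFun_right hk, e1, simpleFun_right hj']
    exact hi2
  have hb : simple i * (simple j * (simple i * w)) = simple j * (simple i * (simple j * w)) := by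
    have := simple_braid hn hij
    simp only [← mul_assoc]
    rw [this]
  refine ⟨q, ?_, ?_⟩
  · exact isReduced_cons.2 ⟨hi, isReduced_cons.2 ⟨d1, isReduced_cons.2 ⟨d2, hq⟩⟩⟩
  · rw [hb] at hq
    exact isReduced_cons.2 ⟨hj, isReduced_cons.2 ⟨d3, isReduced_cons.2 ⟨d4, hq⟩⟩⟩

/-- For `n = 2` two distinct simple reflections are never both left descents. -/
theorem eq_of_isDescent_two (hn : n = 2) {i j : SimpleIdx n} {w : AffinePerm n}
    (hi : IsDescent i w) (hj : IsDescent j w) : i = j := by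
  by_contra hne
  have hk : (((i.1.cast : ℤ)) : ZMod n) = i.1 := ZMod.intCast_zmod_cast _
  have h1 : i.1 ≠ j.1 := fun h => hne (Subtype.ext h)
  have hj' : (((i.1.cast : ℤ) + 1 : ℤ) : ZMod n) = j.1 := by
    push_cast [hk]
    subst hn
    revert h1
    generalize i.1 = a
    generalize j.1 = b
    revert a b
    decide
  rw [isDescent_iff hk] at hi
  rw [isDescent_iff hj', show (i.1.cast : ℤ) + 1 + 1 = (i.1.cast : ℤ) + n by lia,
    affine_add] at hj
  omega

/-- Matsumoto's theorem: the product along a reduced word, in a monoid with elements that satisfy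
the braid relations, depends only on the affine permutation. -/
theorem prod_eq_of_isReduced {M : Type*} [Monoid M] (T : SimpleIdx n → M) (P : ℤ → M)
    (braid : ∀ i j : SimpleIdx n, n ≠ 2 → j.1 = i.1 + 1 → T i * T j * T i = T j * T i * T j)
    (comm : ∀ i j : SimpleIdx n, n ≠ 2 → j.1 ≠ i.1 + 1 → i.1 ≠ j.1 + 1 → T i * T j = T j * T i)
    {w : AffinePerm n} {p p' : List (SimpleIdx n) × ℤ} (hp : IsReduced w p)
    (hp' : IsReduced w p') :
    (p.1.map T).prod * P p.2 = (p'.1.map T).prod * P p'.2 := by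
  suffices H : ∀ (m : ℕ) (w : AffinePerm n) (p p' : List (SimpleIdx n) × ℤ), len w = m →
      IsReduced w p → IsReduced w p' →
      (p.1.map T).prod * P p.2 = (p'.1.map T).prod * P p'.2 from H _ w p p' rfl hp hp'
  intro m
  induction m with
  | zero =>
    rintro w ⟨l, k⟩ ⟨l', k'⟩ hm ⟨h1, h2⟩ ⟨h3, h4⟩
    simp only at h2 h4
    obtain rfl : l = [] := List.length_eq_zero_iff.1 (h2.trans hm)
    obtain rfl : l' = [] := List.length_eq_zero_iff.1 (h4.trans hm)
    have h5 : (shift n ^ k).1 0 = (shift n ^ k').1 0 := by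
      rw [← h3] at h1
      simp only [evalWord, List.map_nil, List.prod_nil, one_mul] at h1
      rw [h1]
    rw [shift_zpow_apply, shift_zpow_apply, zero_add, zero_add] at h5
    rw [h5]
  | succ m ih =>
    rintro w ⟨l, k⟩ ⟨l', k'⟩ hm h h'
    -- Words with the same first letter are compared by the inductive hypothesis.
    have same : ∀ (i : SimpleIdx n) (l l' : List (SimpleIdx n)) (k k' : ℤ),
        IsReduced w (i :: l, k) → IsReduced w (i :: l', k') →
        ((i :: l).map T).prod * P k = ((i :: l').map T).prod * P k' := by
      intro i l l' k k' h h'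
      have h1 := isReduced_cons.1 h
      have h2 := isReduced_cons.1 h'
      have h3 := len_of_isDescent h1.1
      have := ih _ _ _ (by omega) h1.2 h2.2
      simp only [List.map_cons, List.prod_cons, mul_assoc]
      rw [this]
    obtain ⟨i, l, rfl⟩ : ∃ i l₁, l = i :: l₁ :=
      List.exists_cons_of_length_eq_add_one (n := m) (h.2.trans hm)
    obtain ⟨j, l', rfl⟩ : ∃ i l₁, l' = i :: l₁ :=
      List.exists_cons_of_length_eq_add_one (n := m) (h'.2.trans hm)
    have hi := (isReduced_cons.1 h).1
    have hj := (isReduced_cons.1 h').1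
    by_cases hij : i = j
    · subst hij
      exact same i _ _ _ _ h h'
    · by_cases hn : n = 2
      · exact absurd (eq_of_isDescent_two hn hi hj) hij
      · by_cases h1 : j.1 = i.1 + 1
        · obtain ⟨q, hq, hq'⟩ := exists_reduced_braid hn h1 hi hj
          refine (same i _ _ _ _ h hq).trans (Eq.trans ?_ (same j _ _ _ _ hq' h'))
          simp only [List.map_cons, List.prod_cons, ← mul_assoc]
          rw [braid i j hn h1]
        · by_cases h2 : i.1 = j.1 + 1
          · obtain ⟨q, hq, hq'⟩ := exists_reduced_braid hn h2 hj hi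
            refine (same i _ _ _ _ h hq').trans (Eq.trans ?_ (same j _ _ _ _ hq h'))
            simp only [List.map_cons, List.prod_cons, ← mul_assoc]
            rw [braid j i hn h2]
          · obtain ⟨q, hq, hq'⟩ := exists_reduced_comm h1 h2 hij hi hj
            refine (same i _ _ _ _ h hq).trans (Eq.trans ?_ (same j _ _ _ _ hq' h'))
            simp only [List.map_cons, List.prod_cons, ← mul_assoc]
            rw [comm i j hn h1 h2]

end Words

end QDaha

namespace QDaha

open MvPolynomial

/-! ### The action on rational functions -/

section Action

variable {K : Type*} [Field K] {n : ℕ} [NeZero n] {q t : K}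

theorem cast_pos : (0 : ℤ) < n := by exact_mod_cast Nat.pos_of_ne_zero (NeZero.ne n)

theorem resid_val_add_one (r : Fin n) : resid n ((r : ℕ) + 1 : ℤ) = r := by
  apply Fin.ext
  have h : ((r : ℕ) : ℤ) < n := by exact_mod_cast r.2
  simp only [resid, add_sub_cancel_right]
  rw [Int.emod_eq_of_lt (by positivity) h, Int.toNat_natCast]

theorem block_val_add_one {n : ℕ} (r : Fin n) : (((r : ℕ) + 1 : ℤ) - 1) / n = 0 := by
  have h : ((r : ℕ) : ℤ) < n := by exact_mod_cast r.2
  rw [add_sub_cancel_right]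
  exact Int.ediv_eq_zero_of_lt (by positivity) h

theorem eq_resid_add (k : ℤ) : k = ((resid n k : ℕ) + 1 : ℤ) + (k - 1) / n * n := by
  have h := Int.emod_nonneg (k - 1) (cast_pos (n := n)).ne'
  have h1 := Int.emod_add_mul_ediv (k - 1) n
  simp only [resid]
  rw [Int.toNat_of_nonneg h]
  linarith

theorem resid_eq_iff (k l : ℤ) : resid n k = resid n l ↔ (k : ZMod n) = (l : ZMod n) := by
  rw [intCast_eq_iff_exists]
  constructor
  · intro h
    refine ⟨(l - 1) / n - (k - 1) / n, ?_⟩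
    have h1 := eq_resid_add (n := n) k
    have h2 := eq_resid_add (n := n) l
    rw [← h] at h2
    linarith
  · rintro ⟨m, rfl⟩
    rw [mul_comm, resid_add_mul]

theorem Ypoly_val_add_one (r : Fin n) : Ypoly n q ((r : ℕ) + 1 : ℤ) = X r := by
  rw [Ypoly, block_val_add_one, resid_val_add_one]
  simp

theorem Ypoly_add_mul (hq : q ≠ 0) (k m : ℤ) :
    Ypoly n q (k + m * n) = C (q ^ (-m)) * Ypoly n q k := by
  rw [Ypoly, Ypoly, ← mul_assoc, ← C_mul, ← zpow_add₀ hq, mul_comm m, resid_add_mul]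
  congr 3
  rw [show k + n * m - 1 = k - 1 + n * m by ring, Int.add_mul_ediv_left _ _ cast_pos.ne']
  ring

/-- The action `Y_k ↦ Y_{w k}` of an affine permutation on polynomials. -/
noncomputable def polyAct (q : K) (w : AffinePerm n) :
    MvPolynomial (Fin n) K →ₐ[K] MvPolynomial (Fin n) K :=
  aeval fun r => Ypoly n q (w.1 ((r : ℕ) + 1 : ℤ))

theorem polyAct_Ypoly (hq : q ≠ 0) (w : AffinePerm n) (k : ℤ) :
    polyAct q w (Ypoly n q k) = Ypoly n q (w.1 k) := by
  conv_rhs => rw [eq_resid_add (n := n) k, affine_add_mul, Ypoly_add_mul hq]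
  rw [Ypoly, map_mul, polyAct, aeval_X, ← algebraMap_eq, AlgHom.commutes]

theorem polyAct_one : polyAct (n := n) q 1 = AlgHom.id K _ := by
  refine MvPolynomial.algHom_ext fun r => ?_
  rw [polyAct, aeval_X, AlgHom.id_apply]
  exact Ypoly_val_add_one r

theorem polyAct_polyAct (hq : q ≠ 0) (v w : AffinePerm n) (p : MvPolynomial (Fin n) K) :
    polyAct q v (polyAct q w p) = polyAct q (v * w) p := by
  refine AlgHom.congr_fun (φ₁ := (polyAct q v).comp (polyAct q w)) ?_ p
  refine MvPolynomial.algHom_ext fun r => ?_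
  rw [AlgHom.comp_apply, ← Ypoly_val_add_one (q := q) r, polyAct_Ypoly hq, polyAct_Ypoly hq,
    polyAct_Ypoly hq]
  rfl

theorem polyAct_injective (hq : q ≠ 0) (w : AffinePerm n) : Function.Injective (polyAct q w) := by
  intro a b h
  have h1 := congrArg (polyAct q w⁻¹) h
  rw [polyAct_polyAct hq, polyAct_polyAct hq, inv_mul_cancel, polyAct_one] at h1
  exact h1

/-! Rational functions in `Y_1, …, Y_n` form a fraction field `F` of the polynomial ring. -/

variable {F : Type*} [Field F] [Algebra K F] [Algebra (MvPolynomial (Fin n) K) F]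
  [IsScalarTower K (MvPolynomial (Fin n) K) F]

variable (F) in
/-- The inclusion of polynomials into rational functions. -/
noncomputable abbrev ofPoly : MvPolynomial (Fin n) K →ₐ[K] F :=
  Algebra.algHom K _ _

variable (F n) in
/-- `Y_k` as a rational function. -/
noncomputable def Yrat (q : K) (k : ℤ) : F := ofPoly F (Ypoly n q k)

theorem Yrat_add_mul (hq : q ≠ 0) (k m : ℤ) :
    Yrat n F q (k + m * n) = algebraMap K _ (q ^ (-m)) * Yrat n F q k := by
  rw [Yrat, Ypoly_add_mul hq, map_mul, ← algebraMap_eq, AlgHom.commutes, Yrat]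

variable (F n) in
/-- `f_{k,l} = t Y_k - t⁻¹ Y_l` as a rational function. -/
noncomputable def frat (q t : K) (k l : ℤ) : F :=
  algebraMap K _ t * Yrat n F q k - algebraMap K _ t⁻¹ * Yrat n F q l

theorem ofPoly_fpoly (k l : ℤ) : ofPoly F (fpoly n q t k l) = frat n F q t k l := by
  rw [fpoly, map_sub, map_mul, map_mul, ← algebraMap_eq, AlgHom.commutes, AlgHom.commutes]
  rfl

variable [IsFractionRing (MvPolynomial (Fin n) K) F]

theorem ofPoly_injective {n : ℕ} [Algebra (MvPolynomial (Fin n) K) F]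
    [IsScalarTower K (MvPolynomial (Fin n) K) F] [IsFractionRing (MvPolynomial (Fin n) K) F] :
    Function.Injective (ofPoly (K := K) (n := n) F) :=
  IsFractionRing.injective _ _

theorem ofPoly_comp_polyAct_injective (hq : q ≠ 0) (w : AffinePerm n) :
    Function.Injective ((ofPoly F).comp (polyAct q w)) := by
  rw [AlgHom.coe_comp]
  exact ofPoly_injective.comp (polyAct_injective hq w)

variable (F) in
/-- The action `Y_k ↦ Y_{w k}` of an affine permutation on rational functions. -/
noncomputable def ratAct (hq : q ≠ 0) (w : AffinePerm n) : F →ₐ[K] F :=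
  IsFractionRing.liftAlgHom (ofPoly_comp_polyAct_injective (F := F) hq w)

theorem ratAct_ofPoly (hq : q ≠ 0) (w : AffinePerm n) (p : MvPolynomial (Fin n) K) :
    ratAct F hq w (ofPoly F p) = ofPoly F (polyAct q w p) := by
  rw [ratAct, IsFractionRing.liftAlgHom_apply]
  exact IsFractionRing.lift_algebraMap _ p

theorem ratAct_Yrat (hq : q ≠ 0) (w : AffinePerm n) (k : ℤ) :
    ratAct F hq w (Yrat n F q k) = Yrat n F q (w.1 k) := by
  rw [Yrat, ratAct_ofPoly, polyAct_Ypoly hq, Yrat]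

theorem ratFun_algHom_ext {n : ℕ} [Algebra (MvPolynomial (Fin n) K) F]
    [IsScalarTower K (MvPolynomial (Fin n) K) F] [IsFractionRing (MvPolynomial (Fin n) K) F]
    {B : Type*} [CommRing B] [Algebra K B] {f g : F →ₐ[K] B}
    (h : ∀ p : MvPolynomial (Fin n) K, f (ofPoly F p) = g (ofPoly F p)) : f = g :=
  IsLocalization.algHom_ext (nonZeroDivisors (MvPolynomial (Fin n) K)) (AlgHom.ext h)

theorem ratAct_one (hq : q ≠ 0) : ratAct (n := n) F hq 1 = AlgHom.id K F :=
  ratFun_algHom_ext (n := n) fun p => by rw [ratAct_ofPoly, polyAct_one]; rfl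

theorem ratAct_ratAct (hq : q ≠ 0) (v w : AffinePerm n) (g : F) :
    ratAct F hq v (ratAct F hq w g) = ratAct F hq (v * w) g := by
  refine AlgHom.congr_fun (φ₁ := (ratAct F hq v).comp (ratAct F hq w)) ?_ g
  refine ratFun_algHom_ext (n := n) fun p => ?_
  rw [AlgHom.comp_apply, ratAct_ofPoly, ratAct_ofPoly, ratAct_ofPoly, polyAct_polyAct hq]

theorem ratAct_ratAct_inv (hq : q ≠ 0) (w : AffinePerm n) (g : F) :
    ratAct F hq w (ratAct F hq w⁻¹ g) = g := by
  rw [ratAct_ratAct, mul_inv_cancel, ratAct_one]; rfl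

theorem linear_ne_zero {n : ℕ} {a b : K} (ha : a ≠ 0) {r s : Fin n} (h : r ≠ s) :
    (C a * X r - C b * X s : MvPolynomial (Fin n) K) ≠ 0 := by
  intro h0
  have h1 := congrArg (eval (Pi.single r (1 : K))) h0
  simp [h.symm] at h1
  exact ha h1

theorem lin_Ypoly_ne_zero (hq : q ≠ 0) {a b : K} (ha : a ≠ 0) {k l : ℤ}
    (h : (k : ZMod n) ≠ (l : ZMod n)) : C a * Ypoly n q k - C b * Ypoly n q l ≠ 0 := by
  rw [Ypoly, Ypoly, ← mul_assoc, ← mul_assoc, ← C_mul, ← C_mul]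
  exact linear_ne_zero (mul_ne_zero ha (zpow_ne_zero _ hq)) (fun h' => h ((resid_eq_iff k l).1 h'))

theorem fpoly_ne_zero (hq : q ≠ 0) (ht : t ≠ 0) {k l : ℤ} (h : (k : ZMod n) ≠ (l : ZMod n)) :
    fpoly n q t k l ≠ 0 :=
  lin_Ypoly_ne_zero hq ht h

theorem Yrat_sub_ne_zero (hq : q ≠ 0) {k l : ℤ} (h : (k : ZMod n) ≠ (l : ZMod n)) :
    Yrat n F q k - Yrat n F q l ≠ 0 := by
  have h1 := lin_Ypoly_ne_zero hq (one_ne_zero (α := K)) (b := 1) h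
  rw [C_1, one_mul, one_mul] at h1
  intro h2
  rw [Yrat, Yrat, ← map_sub] at h2
  exact h1 (ofPoly_injective (F := F) (by rw [h2, map_zero]))

theorem frat_ne_zero (hq : q ≠ 0) (ht : t ≠ 0) {k l : ℤ} (h : (k : ZMod n) ≠ (l : ZMod n)) :
    frat n F q t k l ≠ 0 := by
  rw [← ofPoly_fpoly]
  exact (map_ne_zero_iff _ ofPoly_injective).2 (fpoly_ne_zero hq ht h)

theorem ratAct_frat (hq : q ≠ 0) (w : AffinePerm n) (k l : ℤ) :
    ratAct F hq w (frat n F q t k l) = frat n F q t (w.1 k) (w.1 l) := by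
  simp only [frat, map_sub, map_mul, AlgHom.commutes, ratAct_Yrat]

end Action

end QDaha

namespace QDaha

open MvPolynomial

/-! ### The representation on rational functions -/

section Representation

variable {K : Type*} [Field K] {n : ℕ} [NeZero n] {q t : K}
  {F : Type*} [Field F] [Algebra K F]

variable (F) in
/-- The operator of multiplication by a rational function. -/
noncomputable abbrev mulOp : F →ₐ[K] Module.End K F :=
  Algebra.lmul K F

variable [Algebra (MvPolynomial (Fin n) K) F] [IsScalarTower K (MvPolynomial (Fin n) K) F]
  [IsFractionRing (MvPolynomial (Fin n) K) F]

variable (F) in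
/-- An affine permutation as an operator on rational functions. -/
noncomputable def permOp (hq : q ≠ 0) : AffinePerm n →* Module.End K F where
  toFun w := (ratAct F hq w).toLinearMap
  map_one' := by rw [ratAct_one]; rfl
  map_mul' v w := LinearMap.ext fun g => (ratAct_ratAct hq v w g).symm

theorem permOp_mul_mulOp (hq : q ≠ 0) (w : AffinePerm n) (g : F) :
    permOp F hq w * mulOp F g = mulOp F (ratAct F hq w g) * permOp F hq w :=
  LinearMap.ext fun h => map_mul (ratAct F hq w) g h

theorem mulOp_mul_permOp (hq : q ≠ 0) (w : AffinePerm n) (g : F) :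
    mulOp F g * permOp F hq w = permOp F hq w * mulOp F (ratAct F hq w⁻¹ g) := by
  rw [permOp_mul_mulOp, ratAct_ratAct_inv]

variable (F n) in
/-- The coefficient of `s_k` in the operator `T_k`. -/
noncomputable def coefA (q t : K) (k : ℤ) : F :=
  (algebraMap K _ t⁻¹ * Yrat n F q k - algebraMap K _ t * Yrat n F q (k + 1)) /
    (Yrat n F q k - Yrat n F q (k + 1))

variable (F n) in
/-- The coefficient of the identity in the operator `T_k`. -/
noncomputable def coefB (q t : K) (k : ℤ) : F :=
  -((algebraMap K _ t - algebraMap K _ t⁻¹) * Yrat n F q (k + 1)) /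
    (Yrat n F q k - Yrat n F q (k + 1))

theorem coef_congr (hq : q ≠ 0) {k l : ℤ} (h : (k : ZMod n) = (l : ZMod n)) :
    coefA n F q t k = coefA n F q t l ∧ coefB n F q t k = coefB n F q t l := by
  obtain ⟨m, rfl⟩ := (intCast_eq_iff_exists k l).1 h
  have hc : algebraMap K F (q ^ (-m)) ≠ 0 :=
    (map_ne_zero _).2 (zpow_ne_zero _ hq)
  have e : k + m * n + 1 = k + 1 + m * n := by ring
  constructor
  · rw [coefA, coefA, e, Yrat_add_mul hq, Yrat_add_mul hq, ← mul_sub, mul_left_comm,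
      mul_left_comm (algebraMap K F t), ← mul_sub, mul_div_mul_left _ _ hc]
  · rw [coefB, coefB, e, Yrat_add_mul hq, Yrat_add_mul hq, ← mul_sub, mul_left_comm,
      ← mul_neg (algebraMap K F (q ^ (-m))), mul_div_mul_left _ _ hc]

variable (F) in
/-- The operator `T_i`: it is chosen so that the intertwiner `ν_i` becomes `s_i`. -/
noncomputable def opT (hq : q ≠ 0) (t : K) (i : SimpleIdx n) : Module.End K F :=
  mulOp F (coefA n F q t (i.1.cast : ℤ)) * permOp F hq (simple i) +
    mulOp F (coefB n F q t (i.1.cast : ℤ))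

theorem opT_eq (hq : q ≠ 0) {i : SimpleIdx n} {k : ℤ} (hk : (k : ZMod n) = i.1) :
    opT F hq t i =
      mulOp F (coefA n F q t k) * permOp F hq (simple i) + mulOp F (coefB n F q t k) := by
  obtain ⟨h1, h2⟩ := coef_congr (F := F) (t := t) hq
    (show ((i.1.cast : ℤ) : ZMod n) = (k : ZMod n) by rw [hk, ZMod.intCast_zmod_cast])
  rw [opT, h1, h2]

theorem opT_apply (hq : q ≠ 0) {i : SimpleIdx n} {k : ℤ} (hk : (k : ZMod n) = i.1)
    (g : F) :
    opT F hq t i g = coefA n F q t k * ratAct F hq (simple i) g + coefB n F q t k * g := by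
  rw [opT_eq hq hk]
  rfl

theorem ne_succ {n : ℕ} (i : SimpleIdx n) {k : ℤ} (hk : (k : ZMod n) = i.1) :
    (k : ZMod n) ≠ ((k + 1 : ℤ) : ZMod n) := by
  push_cast
  rw [hk]
  exact i.2.symm

theorem ratAct_simple_left (hq : q ≠ 0) {i : SimpleIdx n} {k : ℤ} (hk : (k : ZMod n) = i.1) :
    ratAct F hq (simple i) (Yrat n F q k) = Yrat n F q (k + 1) := by
  rw [ratAct_Yrat, simple_apply, simpleFun_left hk]

theorem ratAct_simple_right (hq : q ≠ 0) {i : SimpleIdx n} {k : ℤ} (hk : (k : ZMod n) = i.1) :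
    ratAct F hq (simple i) (Yrat n F q (k + 1)) = Yrat n F q k := by
  rw [ratAct_Yrat, simple_apply, simpleFun_right hk]

theorem ratAct_simple_simple (hq : q ≠ 0) (i : SimpleIdx n) (g : F) :
    ratAct F hq (simple i) (ratAct F hq (simple i) g) = g := by
  rw [ratAct_ratAct, simple_mul_self, ratAct_one]; rfl

/-- The quadratic relation for operators of the shape of `opT`, in any field with an involution
exchanging `a` and `b`. -/
theorem quadratic_identity {F : Type*} [Field F] (s : F →+* F) {a b t : F} (hab : a - b ≠ 0)
    (ht : t ≠ 0) (hst : s t = t) (hst' : s t⁻¹ = t⁻¹) (ha : s a = b) (hb : s b = a)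
    (hs : ∀ g, s (s g) = g) (T : F → F)
    (hT : ∀ g, T g = (t⁻¹ * a - t * b) / (a - b) * s g + -((t - t⁻¹) * b) / (a - b) * g) (g : F) :
    T (T g) = (t - t⁻¹) * T g + g := by
  have hba : b - a ≠ 0 := fun h => hab (by linear_combination -h)
  simp only [hT, map_add, map_mul, map_div₀, map_sub, map_neg, ha, hb, hst, hst', hs]
  have : b - a = -(a - b) := by ring
  rw [this]
  field_simp
  ring

/-- The braid relation for operators of the shape of `opT`. -/
theorem braid_identity {F : Type*} [Field F] (s r : F →+* F) {a b c t : F} (hab : a - b ≠ 0)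
    (hbc : b - c ≠ 0) (hac : a - c ≠ 0)
    (ht : t ≠ 0) (hst : s t = t) (hst' : s t⁻¹ = t⁻¹) (hrt : r t = t) (hrt' : r t⁻¹ = t⁻¹)
    (hsa : s a = b) (hsb : s b = a) (hsc : s c = c) (hra : r a = a) (hrb : r b = c) (hrc : r c = b)
    (hs : ∀ g, s (s g) = g) (hr : ∀ g, r (r g) = g) (hsr : ∀ g, s (r (s g)) = r (s (r g)))
    (T U : F → F)
    (hT : ∀ g, T g = (t⁻¹ * a - t * b) / (a - b) * s g + -((t - t⁻¹) * b) / (a - b) * g)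
    (hU : ∀ g, U g = (t⁻¹ * b - t * c) / (b - c) * r g + -((t - t⁻¹) * c) / (b - c) * g) (g : F) :
    T (U (T g)) = U (T (U g)) := by
  have hba : b - a = -(a - b) := by ring
  have hcb : c - b = -(b - c) := by ring
  simp only [hT, hU, map_add, map_mul, map_div₀, map_sub, map_neg, hsa, hsb, hsc, hra, hrb, hrc,
    hst, hst', hrt, hrt', hs, hr, hsr, hba, hcb]
  generalize s g = g1
  generalize r g = g2
  generalize r (s (r g)) = g3
  generalize s (r g) = g4
  generalize r (s g) = g5
  field_simp
  ring

theorem opT_opT (hq : q ≠ 0) (ht : t ≠ 0) (i : SimpleIdx n) (g : F) :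
    opT F hq t i (opT F hq t i g) =
      (algebraMap K _ t - algebraMap K _ t⁻¹) * opT F hq t i g + g := by
  have hk : ((i.1.cast : ℤ) : ZMod n) = i.1 := ZMod.intCast_zmod_cast _
  rw [map_inv₀]
  refine quadratic_identity (ratAct F hq (simple i)).toRingHom
    (Yrat_sub_ne_zero hq (ne_succ i hk)) ((map_ne_zero _).2 ht)
    ((ratAct F hq (simple i)).commutes t) ?_ (ratAct_simple_left hq hk)
    (ratAct_simple_right hq hk) (ratAct_simple_simple hq i) (opT F hq t i) (fun g => ?_) g
  · rw [← map_inv₀]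
    exact (ratAct F hq (simple i)).commutes t⁻¹
  · rw [opT_apply hq hk, coefA, coefB, map_inv₀]
    rfl

theorem opT_hecke (hq : q ≠ 0) (ht : t ≠ 0) (i : SimpleIdx n) :
    (opT F hq t i - algebraMap K _ t) * (opT F hq t i + algebraMap K _ t⁻¹) = 0 := by
  refine LinearMap.ext fun g => ?_
  have h := opT_opT hq ht i g
  change opT F hq t i (opT F hq t i g + t⁻¹ • g) - t • (opT F hq t i g + t⁻¹ • g) = 0
  rw [map_add, map_smul, h, sub_mul, ← Algebra.smul_def, ← Algebra.smul_def, smul_add, smul_smul,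
    mul_inv_cancel₀ ht, one_smul]
  abel

theorem opT_mul (hq : q ≠ 0) {i : SimpleIdx n} {k : ℤ} (hk : (k : ZMod n) = i.1)
    (g : F) :
    opT F hq t i (Yrat n F q k * g) =
      Yrat n F q (k + 1) * (opT F hq t i g - (algebraMap K _ t - algebraMap K _ t⁻¹) * g) := by
  rw [opT_apply hq hk, opT_apply hq hk, map_mul, ratAct_simple_left hq hk]
  have h : coefB n F q t k * (Yrat n F q k - Yrat n F q (k + 1)) =
      -((algebraMap K _ t - algebraMap K _ t⁻¹) * Yrat n F q (k + 1)) :=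
    div_mul_cancel₀ _ (Yrat_sub_ne_zero hq (ne_succ i hk))
  linear_combination g * h

theorem opT_braid (hq : q ≠ 0) (ht : t ≠ 0) {i j : SimpleIdx n} (hn : n ≠ 2)
    (hij : j.1 = i.1 + 1) :
    opT F hq t i * opT F hq t j * opT F hq t i = opT F hq t j * opT F hq t i * opT F hq t j := by
  have hk : ((i.1.cast : ℤ) : ZMod n) = i.1 := ZMod.intCast_zmod_cast _
  generalize (i.1.cast : ℤ) = k at hk
  obtain ⟨e1, e2, hj⟩ := simpleFun_adjacent hn hij hk
  have hac : (k : ZMod n) ≠ ((k + 1 + 1 : ℤ) : ZMod n) := by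
    have h2 := two_ne_zero_of_simpleIdx i hn
    push_cast
    rw [add_assoc, one_add_one_eq_two]
    simpa using h2
  have hst : ∀ (l : SimpleIdx n) (c : K),
      (ratAct F hq (simple l)).toRingHom (algebraMap K _ c) = algebraMap K _ c :=
    fun l c => (ratAct F hq (simple l)).commutes c
  refine LinearMap.ext fun g => ?_
  refine braid_identity (ratAct F hq (simple i)).toRingHom (ratAct F hq (simple j)).toRingHom
    (Yrat_sub_ne_zero hq (ne_succ i hk)) (Yrat_sub_ne_zero hq (ne_succ j hj))
    (Yrat_sub_ne_zero hq hac) ((map_ne_zero (algebraMap K F)).2 ht)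
    (hst i t) ?_ (hst j t) ?_ (ratAct_simple_left hq hk) (ratAct_simple_right hq hk) ?_ ?_
    (ratAct_simple_left hq hj) (ratAct_simple_right hq hj) (ratAct_simple_simple hq i)
    (ratAct_simple_simple hq j) ?_ (opT F hq t i) (opT F hq t j) (fun g => ?_) (fun g => ?_) g
  · rw [← map_inv₀]; exact hst i _
  · rw [← map_inv₀]; exact hst j _
  · exact (ratAct_Yrat hq _ _).trans (by rw [simple_apply, e2])
  · exact (ratAct_Yrat hq _ _).trans (by rw [simple_apply, e1])
  · intro g
    change ratAct F hq _ (ratAct F hq _ (ratAct F hq _ g)) =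
      ratAct F hq _ (ratAct F hq _ (ratAct F hq _ g))
    simp only [ratAct_ratAct]
    rw [← mul_assoc, simple_braid hn hij, mul_assoc]
  · rw [opT_apply hq hk, coefA, coefB, map_inv₀]
    rfl
  · rw [opT_apply hq hj, coefA, coefB, map_inv₀]
    rfl

theorem ratAct_coef (hq : q ≠ 0) (w : AffinePerm n) {k l : ℤ} (h : w.1 k = l)
    (h' : w.1 (k + 1) = l + 1) :
    ratAct F hq w (coefA n F q t k) = coefA n F q t l ∧
      ratAct F hq w (coefB n F q t k) = coefB n F q t l := by
  simp only [coefA, coefB, map_div₀, map_sub, map_mul, map_neg, AlgHom.commutes, ratAct_Yrat, h,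
    h', and_self]

/-- An affine permutation that carries `k, k + 1` to the adjacent `l, l + 1` conjugates `T_k` to
`T_l`. -/
theorem permOp_mul_opT (hq : q ≠ 0) (w : AffinePerm n) {i j : SimpleIdx n} {k l : ℤ}
    (hk : (k : ZMod n) = i.1) (hl : (l : ZMod n) = j.1) (h : w.1 k = l)
    (h' : w.1 (k + 1) = l + 1) :
    permOp F hq w * opT F hq t i = opT F hq t j * permOp F hq w := by
  obtain ⟨h1, h2⟩ := ratAct_coef (F := F) (t := t) hq w h h'
  rw [opT_eq hq hk, opT_eq hq hl, mul_add, add_mul, ← mul_assoc, permOp_mul_mulOp,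
    permOp_mul_mulOp, h1, h2, mul_assoc, mul_assoc, ← map_mul, ← map_mul,
    simple_mul_eq_mul_simple hk hl h h']

theorem opT_mulOp_comm (hq : q ≠ 0) {i : SimpleIdx n} {a : F}
    (ha : ratAct F hq (simple i) a = a) : opT F hq t i * mulOp F a = mulOp F a * opT F hq t i := by
  rw [opT, add_mul, mul_add, mul_assoc, permOp_mul_mulOp, ha, ← mul_assoc, ← mul_assoc,
    ← map_mul, ← map_mul, ← map_mul, ← map_mul, mul_comm a, mul_comm a]

theorem opT_comm (hq : q ≠ 0) {i j : SimpleIdx n} (h1 : j.1 ≠ i.1 + 1) (h2 : i.1 ≠ j.1 + 1) :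
    opT F hq t i * opT F hq t j = opT F hq t j * opT F hq t i := by
  by_cases h3 : i = j
  · rw [h3]
  have h3' : i.1 ≠ j.1 := fun h => h3 (Subtype.ext h)
  have hk : ((i.1.cast : ℤ) : ZMod n) = i.1 := ZMod.intCast_zmod_cast _
  have hl : ((j.1.cast : ℤ) : ZMod n) = j.1 := ZMod.intCast_zmod_cast _
  generalize (i.1.cast : ℤ) = k at hk
  generalize (j.1.cast : ℤ) = l at hl
  have e1 : simpleFun i l = l := simpleFun_other (by rw [hl]; exact h3'.symm) (by rw [hl]; exact h1)
  have e2 : simpleFun i (l + 1) = l + 1 := simpleFun_other (by push_cast [hl]; exact h2.symm)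
    (by push_cast [hl]; simpa using h3'.symm)
  have h := permOp_mul_opT (F := F) (t := t) hq (simple i) hl hl e1 e2
  obtain ⟨a1, a2⟩ := ratAct_coef (F := F) (t := t) hq (simple j) (k := k) (l := k)
    (simpleFun_other (by rw [hk]; exact h3') (by rw [hk]; exact h2))
    (simpleFun_other (by push_cast [hk]; exact h1.symm) (by push_cast [hk]; simpa using h3'))
  rw [opT_eq hq hk, add_mul, mul_add, mul_assoc, h, ← mul_assoc, ← mul_assoc, ← opT_mulOp_comm hq a1,
    ← opT_mulOp_comm hq a2]

variable (F) in
/-- The rational functions contain every localization of the polynomials at nonzero elements. -/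
noncomputable def locToRat {S : Submonoid (MvPolynomial (Fin n) K)}
    (hS : S ≤ nonZeroDivisors _) : Localization S →ₐ[K] F :=
  IsLocalization.liftAlgHom (M := S) (f := ofPoly F) fun y =>
    IsLocalization.map_units (M := nonZeroDivisors (MvPolynomial (Fin n) K)) _ ⟨y.1, hS y.2⟩

theorem locToRat_algebraMap {S : Submonoid (MvPolynomial (Fin n) K)}
    (hS : S ≤ nonZeroDivisors _) (p : MvPolynomial (Fin n) K) :
    locToRat F hS (algebraMap _ _ p) = ofPoly F p :=
  IsLocalization.lift_eq _ _

theorem locToRat_injective {S : Submonoid (MvPolynomial (Fin n) K)}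
    (hS : S ≤ nonZeroDivisors _) : Function.Injective (locToRat F hS) := by
  refine (IsLocalization.lift_injective_iff _).2 fun x y => ?_
  rw [(IsLocalization.injective (Localization S) hS).eq_iff]
  exact ofPoly_injective.eq_iff.symm

theorem denominators_le (hq : q ≠ 0) (ht : t ≠ 0) :
    denominators n q t ≤ nonZeroDivisors (MvPolynomial (Fin n) K) := by
  refine Submonoid.closure_le.2 ?_
  rintro p (⟨i, rfl⟩ | ⟨i, j, hij, rfl⟩)
  · exact mem_nonZeroDivisors_of_ne_zero (X_ne_zero i)
  · exact mem_nonZeroDivisors_of_ne_zero (fpoly_ne_zero hq ht hij)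

theorem opT_Yrat_opT (hq : q ≠ 0) (ht : t ≠ 0) {i : SimpleIdx n} {k : ℤ}
    (hk : (k : ZMod n) = i.1) :
    opT F hq t i * mulOp F (Yrat n F q k) * opT F hq t i = mulOp F (Yrat n F q (k + 1)) := by
  refine LinearMap.ext fun g => ?_
  change opT F hq t i (Yrat n F q k * opT F hq t i g) = Yrat n F q (k + 1) * g
  rw [opT_mul hq hk, opT_opT hq ht, add_sub_cancel_left]

theorem opT_Yrat_comm (hq : q ≠ 0) {i : SimpleIdx n} {k : ℤ} (hk : (k : ZMod n) ≠ i.1)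
    (hk' : (k : ZMod n) ≠ i.1 + 1) :
    opT F hq t i * mulOp F (Yrat n F q k) = mulOp F (Yrat n F q k) * opT F hq t i :=
  opT_mulOp_comm hq (by rw [ratAct_Yrat, simple_apply, simpleFun_other hk hk'])

theorem mulOp_locToRat_Ypoly {S : Submonoid (MvPolynomial (Fin n) K)}
    (hS : S ≤ nonZeroDivisors _) (k : ℤ) :
    ((mulOp F).comp (locToRat F hS)) (algebraMap _ _ (Ypoly n q k)) = mulOp F (Yrat n F q k) :=
  congrArg (mulOp F) (locToRat_algebraMap hS _)

theorem shift_conj_opT (hq : q ≠ 0) {i j : SimpleIdx n} (hij : j.1 = i.1 + 1) :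
    permOp F hq (shift n) * opT F hq t i * permOp F hq (shift n)⁻¹ = opT F hq t j := by
  have hk : ((i.1.cast : ℤ) : ZMod n) = i.1 := ZMod.intCast_zmod_cast _
  have hl : (((i.1.cast : ℤ) + 1 : ℤ) : ZMod n) = j.1 := by push_cast [hk]; rw [hij]
  rw [permOp_mul_opT hq (shift n) hk hl rfl rfl, mul_assoc, ← map_mul, mul_inv_cancel, map_one,
    mul_one]

theorem shift_conj_Yrat (hq : q ≠ 0) (k : ℤ) :
    permOp F hq (shift n) * mulOp F (Yrat n F q k) * permOp F hq (shift n)⁻¹ =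
      mulOp F (Yrat n F q (k + 1)) := by
  rw [permOp_mul_mulOp, ratAct_Yrat, mul_assoc, ← map_mul, mul_inv_cancel, map_one, mul_one]
  rfl

variable (F) in
/-- The operators on rational functions satisfy the relations of the localized algebra. -/
noncomputable def repData (hq : q ≠ 0) (ht : t ≠ 0) :
    HeckeData n q t (denominators n q t) (Module.End K F) where
  T := opT F hq t
  P := Units.map (permOp F hq) (toUnits (shift n))
  Y := (mulOp F).comp (locToRat F (denominators_le hq ht))
  hecke := opT_hecke hq ht
  braid _ _ hn hij := opT_braid hq ht hn hij
  comm _ _ _ h h' := opT_comm hq h h'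
  pi_T _ _ hij := shift_conj_opT hq hij
  T_Y_T i k hk := by
    rw [mulOp_locToRat_Ypoly, mulOp_locToRat_Ypoly]
    exact opT_Yrat_opT hq ht hk
  T_Y i k hk hk' := by
    rw [mulOp_locToRat_Ypoly]
    exact opT_Yrat_comm hq hk hk'
  pi_Y k := by
    rw [mulOp_locToRat_Ypoly, mulOp_locToRat_Ypoly]
    exact shift_conj_Yrat hq k

variable (F) in
/-- The representation of the localized double affine Hecke algebra on rational functions. -/
noncomputable def rep (hq : q ≠ 0) (ht : t ≠ 0) :
    LocDAHA n q t →ₐ[K] Module.End K F :=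
  (repData F hq ht).lift

theorem rep_genT (hq : q ≠ 0) (ht : t ≠ 0) (i : SimpleIdx n) :
    rep F hq ht (genT i) = opT F hq t i :=
  HeckeData.lift_T _ _

theorem rep_genY (hq : q ≠ 0) (ht : t ≠ 0) (a : Localization (denominators n q t)) :
    rep F hq ht (genY a) = mulOp F (locToRat F (denominators_le hq ht) a) :=
  HeckeData.lift_Y _ _

theorem rep_genPi_zpow (hq : q ≠ 0) (ht : t ≠ 0) (k : ℤ) :
    rep F hq ht ((genPi ^ k : (LocDAHA n q t)ˣ) : LocDAHA n q t) = permOp F hq (shift n ^ k) := by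
  have h : Units.map (MonoidHomClass.toMonoidHom (rep (n := n) F hq ht)) genPi =
      Units.map (permOp F hq) (toUnits (shift n)) := Units.ext (HeckeData.lift_Pi _)
  have h1 := congrArg (fun u => ((u ^ k : (Module.End K F)ˣ) :
    Module.End K F)) h
  simp only [← map_zpow] at h1
  exact h1

/-- `T_i (Y_i - Y_{i+1}) + (t - t⁻¹) Y_{i+1} = s_i f_{i,i+1}` as operators. -/
theorem opT_mul_sub (hq : q ≠ 0) {i : SimpleIdx n} {k : ℤ} (hk : (k : ZMod n) = i.1) :
    opT F hq t i * mulOp F (Yrat n F q k - Yrat n F q (k + 1)) +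
      mulOp F ((algebraMap K _ t - algebraMap K _ t⁻¹) * Yrat n F q (k + 1)) =
      permOp F hq (simple i) * mulOp F (frat n F q t k (k + 1)) := by
  refine LinearMap.ext fun g => ?_
  change opT F hq t i ((Yrat n F q k - Yrat n F q (k + 1)) * g) +
    (algebraMap K _ t - algebraMap K _ t⁻¹) * Yrat n F q (k + 1) * g =
    ratAct F hq (simple i) (frat n F q t k (k + 1) * g)
  have h := Yrat_sub_ne_zero (F := F) hq (ne_succ i hk)
  have e : ratAct F hq (simple i) (frat n F q t k (k + 1)) = algebraMap K _ t * Yrat n F q (k + 1) -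
      algebraMap K _ t⁻¹ * Yrat n F q k := by
    rw [ratAct_frat, simple_apply, simple_apply, simpleFun_left hk, simpleFun_right hk]
    rfl
  rw [opT_apply hq hk, map_mul, map_mul, map_sub, ratAct_simple_left hq hk,
    ratAct_simple_right hq hk, e, coefA, coefB]
  field_simp
  ring

theorem rep_nuSimple (hq : q ≠ 0) (ht : t ≠ 0) (i : SimpleIdx n) :
    rep F hq ht (nuSimple i) = permOp F hq (simple i) := by
  have hk : ((i.1.cast : ℤ) : ZMod n) = i.1 := ZMod.intCast_zmod_cast _
  have hf : frat n F q t (i.1.cast : ℤ) ((i.1.cast : ℤ) + 1) ≠ 0 := frat_ne_zero hq ht (ne_succ i hk)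
  rw [nuSimple, map_mul, rep_genY, phi, map_sub, map_mul, map_mul, rep_genT, rep_genY,
    locToRat_algebraMap]
  set k := (i.1.cast : ℤ)
  have h1 : locToRat F (denominators_le hq ht)
      (Localization.mk 1 ⟨fpoly n q t k (k + 1), fpoly_mem i⟩) * frat n F q t k (k + 1) = 1 := by
    rw [← ofPoly_fpoly, ← locToRat_algebraMap (denominators_le hq ht), ← map_mul,
      ← map_one (locToRat F (denominators_le (n := n) hq ht))]
    congr 1
    rw [Localization.mk_eq_mk'_apply]
    exact (IsLocalization.mk'_spec (Localization (denominators n q t)) 1 _).trans (map_one _)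
  have h2 : opT F hq t i * mulOp F (ofPoly F (Ypoly n q k)) -
      mulOp F (ofPoly F (Ypoly n q k)) * opT F hq t i =
      permOp F hq (simple i) * mulOp F (frat n F q t k (k + 1)) := by
    rw [← opT_mul_sub hq hk]
    refine LinearMap.ext fun g => ?_
    change opT F hq t i (Yrat n F q k * g) - Yrat n F q k * opT F hq t i g =
      opT F hq t i ((Yrat n F q k - Yrat n F q (k + 1)) * g) + _ * g
    have h := Yrat_sub_ne_zero (F := F) hq (ne_succ i hk)
    rw [opT_apply hq hk, opT_apply hq hk, opT_apply hq hk, map_mul, map_mul, map_sub,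
      ratAct_simple_left hq hk, ratAct_simple_right hq hk, coefA, coefB]
    field_simp
    ring
  rw [h2, mul_assoc, ← map_mul, mul_comm, h1, map_one, mul_one]

/-- The intertwiners act as affine permutations. -/
theorem rep_nu (hq : q ≠ 0) (ht : t ≠ 0) (w : AffinePerm n) :
    rep F hq ht (nu w) = permOp F hq w := by
  have h : ∀ l : List (SimpleIdx n), rep F hq ht (l.map nuSimple).prod =
      permOp F hq (l.map simple).prod := by
    intro l
    induction l with
    | nil => simp
    | cons i l ih =>
      simp only [List.map_cons, List.prod_cons, map_mul, ih, rep_nuSimple]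
  rw [nu, map_mul, h, rep_genPi_zpow, ← map_mul]
  exact congrArg _ (exists_reduced w).choose_spec.1

end Representation

end QDaha

namespace QDaha

open MvPolynomial

/-! ### Triangularity of the `T_w` in the basis of affine permutations -/

section Triangular

variable {K : Type*} [Field K] {n : ℕ} [NeZero n] {q t : K}
  {F : Type*} [Field F] [Algebra K F] [Algebra (MvPolynomial (Fin n) K) F]
  [IsScalarTower K (MvPolynomial (Fin n) K) F] [IsFractionRing (MvPolynomial (Fin n) K) F]

theorem Ypoly_injective (hq : q ≠ 0) (hq' : ∀ m : ℤ, q ^ m = 1 → m = 0) {k l : ℤ}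
    (h : Ypoly n q k = Ypoly n q l) : k = l := by
  have hr : resid n k = resid n l := by
    by_contra hr
    have h1 := linear_ne_zero (b := q ^ (-((l - 1) / n))) (zpow_ne_zero (-((k - 1) / n)) hq) hr
    exact h1 (sub_eq_zero.2 h)
  rw [Ypoly, Ypoly, hr] at h
  have h2 : q ^ (-((k - 1) / n)) = q ^ (-((l - 1) / n)) :=
    C_injective _ _ (mul_right_cancel₀ (X_ne_zero _) h)
  have h3 := hq' (-((k - 1) / n) - -((l - 1) / n)) (by
    rw [zpow_sub₀ hq, h2, div_self (zpow_ne_zero _ hq)])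
  have h4 := eq_resid_add (n := n) k
  have h5 := eq_resid_add (n := n) l
  rw [hr] at h4
  rw [show (k - 1) / n = (l - 1) / n by omega] at h4
  exact h4.trans h5.symm

theorem ratAct_injective (hq : q ≠ 0) (hq' : ∀ m : ℤ, q ^ m = 1 → m = 0) :
    Function.Injective fun w : AffinePerm n => ((ratAct F hq w : F →ₐ[K] F) : F →* F) := by
  intro v w h
  refine Subtype.ext (Equiv.ext fun k => ?_)
  have h1 : ratAct F hq v (Yrat n F q k) = ratAct F hq w (Yrat n F q k) :=
    DFunLike.congr_fun h (Yrat n F q k)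
  rw [ratAct_Yrat, ratAct_Yrat] at h1
  exact Ypoly_injective hq hq' (ofPoly_injective h1)

variable (F) in
/-- The operator `∑ w φ_w`, with coefficients to the right of the affine permutations. -/
noncomputable def skewSum (hq : q ≠ 0) (φ : AffinePerm n →₀ F) : Module.End K F :=
  φ.sum fun w c => permOp F hq w * mulOp F c

theorem skewSum_single (hq : q ≠ 0) (w : AffinePerm n) (c : F) :
    skewSum F hq (Finsupp.single w c) = permOp F hq w * mulOp F c :=
  Finsupp.sum_single_index (by rw [map_zero, mul_zero])

theorem skewSum_add (hq : q ≠ 0) (φ ψ : AffinePerm n →₀ F) :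
    skewSum F hq (φ + ψ) = skewSum F hq φ + skewSum F hq ψ :=
  Finsupp.sum_add_index' (fun w => by rw [map_zero, mul_zero])
    (fun w a b => by rw [map_add, mul_add])

theorem skewSum_neg (hq : q ≠ 0) (φ : AffinePerm n →₀ F) :
    skewSum F hq (-φ) = -skewSum F hq φ := by
  rw [eq_neg_iff_add_eq_zero, ← skewSum_add, neg_add_cancel]
  rfl

/-- By Dedekind's lemma the affine permutations are linearly independent over rational functions. -/
theorem skewSum_injective (hq : q ≠ 0) (hq' : ∀ m : ℤ, q ^ m = 1 → m = 0) :
    Function.Injective (skewSum (n := n) F hq) := by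
  suffices H : ∀ φ : AffinePerm n →₀ F, skewSum F hq φ = 0 → φ = 0 by
    intro φ ψ h
    have := H (φ + -ψ) (by rw [skewSum_add, skewSum_neg, h, add_neg_cancel])
    exact add_neg_eq_zero.1 this
  intro φ h
  have hli := (linearIndependent_monoidHom F F).comp _ (ratAct_injective (n := n) hq hq')
  rw [linearIndependent_iff'] at hli
  have h1 := hli φ.support (fun w => ratAct F hq w (φ w)) (by
    funext g
    have h2 := congrArg (fun b : Module.End K F => b g) h
    simp only [skewSum, Finsupp.sum, LinearMap.sum_apply, LinearMap.zero_apply] at h2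
    rw [Finset.sum_apply]
    refine Eq.trans (Finset.sum_congr rfl fun w _ => ?_) h2
    exact (map_mul (ratAct F hq w) (φ w) g).symm)
  refine Finsupp.ext fun w => ?_
  by_contra h3
  have h4 := h1 w (Finsupp.mem_support_iff.2 h3)
  exact h3 ((map_eq_zero _).1 h4)

variable (F) in
/-- The operators that are combinations of affine permutations of length less than `m`. -/
def lowerPart (hq : q ≠ 0) (n : ℕ) [NeZero n] [Algebra (MvPolynomial (Fin n) K) F]
    [IsScalarTower K (MvPolynomial (Fin n) K) F] [IsFractionRing (MvPolynomial (Fin n) K) F]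
    (m : ℕ) : AddSubgroup (Module.End K F) :=
  AddSubgroup.closure {b | ∃ (w : AffinePerm n) (c : F), len w < m ∧ b = permOp F hq w * mulOp F c}

theorem exists_of_mem_lowerPart (hq : q ≠ 0) {m : ℕ} {b : Module.End K F}
    (hb : b ∈ lowerPart F hq n m) :
    ∃ φ : AffinePerm n →₀ F, b = skewSum F hq φ ∧ ∀ w, φ w ≠ 0 → len w < m := by
  induction hb using AddSubgroup.closure_induction with
  | mem b hb =>
    obtain ⟨w, c, h1, rfl⟩ := hb
    refine ⟨Finsupp.single w c, (skewSum_single hq w c).symm, fun v hv => ?_⟩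
    by_cases h : w = v
    · rwa [← h]
    · exact absurd (Finsupp.single_eq_of_ne' h) hv
  | zero => exact ⟨0, rfl, fun w hw => absurd rfl hw⟩
  | add a b _ _ ha hb =>
    obtain ⟨φ, rfl, h1⟩ := ha
    obtain ⟨ψ, rfl, h2⟩ := hb
    refine ⟨φ + ψ, (skewSum_add hq φ ψ).symm, fun w hw => ?_⟩
    by_cases h : φ w = 0
    · exact h2 w (fun h' => hw (by rw [Finsupp.add_apply, h, h', add_zero]))
    · exact h1 w h
  | neg a _ ha =>
    obtain ⟨φ, rfl, h1⟩ := ha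
    exact ⟨-φ, (skewSum_neg hq φ).symm, fun w hw => h1 w (by simpa using hw)⟩

theorem lowerPart_mono (hq : q ≠ 0) {m m' : ℕ} (h : m ≤ m') :
    lowerPart F hq n m ≤ lowerPart F hq n m' := by
  refine AddSubgroup.closure_mono ?_
  rintro b ⟨w, c, h1, rfl⟩
  exact ⟨w, c, h1.trans_le h, rfl⟩

theorem permOp_mul_mem_lowerPart (hq : q ≠ 0) {m : ℕ} {w : AffinePerm n} (h : len w < m) (c : F) :
    permOp F hq w * mulOp F c ∈ lowerPart F hq n m :=
  AddSubgroup.subset_closure ⟨w, c, h, rfl⟩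

theorem lowerPart_mul_mulOp (hq : q ≠ 0) {m : ℕ} {b : Module.End K F}
    (hb : b ∈ lowerPart F hq n m) (c : F) : b * mulOp F c ∈ lowerPart F hq n m := by
  induction hb using AddSubgroup.closure_induction with
  | mem b hb =>
    obtain ⟨w, d, h1, rfl⟩ := hb
    rw [mul_assoc, ← map_mul]
    exact permOp_mul_mem_lowerPart hq h1 _
  | zero => rw [zero_mul]; exact zero_mem _
  | add a b _ _ ha hb => rw [add_mul]; exact add_mem ha hb
  | neg a _ ha =>
    rw [show -a * mulOp F c = -(a * mulOp F c) from LinearMap.ext fun _ => rfl]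
    exact neg_mem ha

variable (n F) in
/-- The coefficient `f_{k,k+1} / (Y_k - Y_{k+1})` of `s_k` in `T_k`, to the right of `s_k`. -/
noncomputable def simpleLead (q t : K) (k : ℤ) : F :=
  frat n F q t k (k + 1) / (Yrat n F q k - Yrat n F q (k + 1))

theorem opT_eq_permOp_mul (hq : q ≠ 0) {i : SimpleIdx n} {k : ℤ} (hk : (k : ZMod n) = i.1) :
    opT F hq t i = permOp F hq (simple i) * mulOp F (simpleLead n F q t k) +
      mulOp F (coefB n F q t k) := by
  rw [opT_eq hq hk, permOp_mul_mulOp]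
  congr 3
  rw [simpleLead, map_div₀, map_sub, ratAct_frat, ratAct_simple_left hq hk,
    ratAct_simple_right hq hk, simple_apply, simple_apply, simpleFun_left hk, simpleFun_right hk,
    coefA, ← neg_div_neg_eq, frat, neg_sub, neg_sub]

theorem opT_mul_lowerPart (hq : q ≠ 0) (i : SimpleIdx n) {m : ℕ} {b : Module.End K F}
    (hb : b ∈ lowerPart F hq n m) : opT F hq t i * b ∈ lowerPart F hq n (m + 1) := by
  have hk : ((i.1.cast : ℤ) : ZMod n) = i.1 := ZMod.intCast_zmod_cast _
  induction hb using AddSubgroup.closure_induction with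
  | mem b hb =>
    obtain ⟨w, d, h1, rfl⟩ := hb
    rw [opT_eq_permOp_mul hq hk, add_mul, ← mul_assoc, ← mul_assoc, mul_assoc (permOp F hq _),
      mulOp_mul_permOp, mulOp_mul_permOp, ← mul_assoc, ← map_mul (permOp F hq), mul_assoc, mul_assoc,
      ← map_mul, ← map_mul]
    refine add_mem (permOp_mul_mem_lowerPart hq ?_ _) (permOp_mul_mem_lowerPart hq ?_ _)
    · have := len_simple_mul_le i w
      omega
    · omega
  | zero => rw [mul_zero]; exact zero_mem _
  | add a b _ _ ha hb => rw [mul_add]; exact add_mem ha hb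
  | neg a _ ha =>
    rw [show opT F hq t i * -a = -(opT F hq t i * a) from LinearMap.ext fun g =>
      map_neg (opT F hq t i) (a g)]
    exact neg_mem ha

variable (F) in
/-- The operator `T_{i₁} ⋯ T_{iₘ} π ^ k` of a word. -/
noncomputable def wordOp (hq : q ≠ 0) (t : K) (p : List (SimpleIdx n) × ℤ) : Module.End K F :=
  (p.1.map (opT F hq t)).prod * permOp F hq (shift n ^ p.2)

variable (F) in
/-- The coefficient of `s_{i₁} ⋯ s_{iₘ} π ^ k` in the operator `T_{i₁} ⋯ T_{iₘ} π ^ k`. -/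
noncomputable def wordLead (hq : q ≠ 0) (t : K) : List (SimpleIdx n) → ℤ → F
  | [], _ => 1
  | i :: l, k => ratAct F hq (evalWord (l, k))⁻¹ (simpleLead n F q t (i.1.cast : ℤ)) *
      wordLead hq t l k

theorem simpleLead_ne_zero (hq : q ≠ 0) (ht : t ≠ 0) {i : SimpleIdx n} {k : ℤ}
    (hk : (k : ZMod n) = i.1) : simpleLead n F q t k ≠ 0 :=
  div_ne_zero (frat_ne_zero hq ht (ne_succ i hk)) (Yrat_sub_ne_zero hq (ne_succ i hk))

theorem wordLead_ne_zero (hq : q ≠ 0) (ht : t ≠ 0) (l : List (SimpleIdx n)) (k : ℤ) :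
    wordLead F hq t l k ≠ 0 := by
  induction l with
  | nil => exact one_ne_zero
  | cons i l ih =>
    exact mul_ne_zero ((map_ne_zero _).2 (simpleLead_ne_zero hq ht (ZMod.intCast_zmod_cast i.1))) ih

theorem len_evalWord_le {n : ℕ} (l : List (SimpleIdx n)) (k : ℤ) : len (evalWord (l, k)) ≤ l.length :=
  len_le_length rfl

/-- Expanding the product along a word: proper subwords give permutations of smaller length. -/
theorem wordOp_sub_mem (hq : q ≠ 0) (l : List (SimpleIdx n)) (k : ℤ) :
    wordOp F hq t (l, k) - permOp F hq (evalWord (l, k)) * mulOp F (wordLead F hq t l k) ∈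
      lowerPart F hq n l.length := by
  induction l with
  | nil =>
    have h : wordOp (n := n) F hq t ([], k) -
        permOp F hq (evalWord (([] : List (SimpleIdx n)), k)) *
          mulOp F (wordLead (n := n) F hq t [] k) = 0 := by
      simp only [wordOp, evalWord, wordLead, map_one, mul_one, List.map_nil, List.prod_nil, one_mul,
        sub_self]
    rw [h]
    exact zero_mem _
  | cons i l ih =>
    have hk : ((i.1.cast : ℤ) : ZMod n) = i.1 := ZMod.intCast_zmod_cast _
    have h1 : wordOp F hq t (i :: l, k) = opT F hq t i * wordOp F hq t (l, k) := by
      simp only [wordOp, List.map_cons, List.prod_cons, mul_assoc]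
    have h2 : opT F hq t i * (permOp F hq (evalWord (l, k)) * mulOp F (wordLead F hq t l k)) =
        permOp F hq (evalWord (i :: l, k)) * mulOp F (wordLead F hq t (i :: l) k) +
        permOp F hq (evalWord (l, k)) *
          mulOp F (ratAct F hq (evalWord (l, k))⁻¹ (coefB n F q t (i.1.cast : ℤ)) *
            wordLead F hq t l k) := by
      rw [opT_eq_permOp_mul hq hk, add_mul, ← mul_assoc, ← mul_assoc, mul_assoc (permOp F hq _),
        mulOp_mul_permOp, mulOp_mul_permOp, ← mul_assoc, ← map_mul (permOp F hq), mul_assoc,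
        mul_assoc, ← map_mul, ← map_mul, evalWord_cons, wordLead]
    have h3 : wordOp F hq t (i :: l, k) -
        permOp F hq (evalWord (i :: l, k)) * mulOp F (wordLead F hq t (i :: l) k) =
        opT F hq t i * (wordOp F hq t (l, k) -
          permOp F hq (evalWord (l, k)) * mulOp F (wordLead F hq t l k)) +
        permOp F hq (evalWord (l, k)) *
          mulOp F (ratAct F hq (evalWord (l, k))⁻¹ (coefB n F q t (i.1.cast : ℤ)) *
            wordLead F hq t l k) := by
      rw [mul_sub, h2, h1]
      abel
    rw [h3]
    refine add_mem (opT_mul_lowerPart hq i ih) (permOp_mul_mem_lowerPart hq ?_ _)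
    rw [List.length_cons, Nat.lt_succ_iff]
    exact len_evalWord_le l k

variable (F) in
/-- The coefficient of `w` in the operator `T_w`. -/
noncomputable def leadCoef (hq : q ≠ 0) (t : K) (w : AffinePerm n) : F :=
  wordLead F hq t (redWord w).1 (redWord w).2

theorem redWord_spec (w : AffinePerm n) : IsReduced w (redWord w) := (exists_reduced w).choose_spec

theorem leadCoef_ne_zero (hq : q ≠ 0) (ht : t ≠ 0) (w : AffinePerm n) : leadCoef F hq t w ≠ 0 :=
  wordLead_ne_zero hq ht _ _

theorem rep_Tw (hq : q ≠ 0) (ht : t ≠ 0) (w : AffinePerm n) :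
    rep F hq ht (Tw w) = wordOp F hq t (redWord w) := by
  have h : ∀ l : List (SimpleIdx n), rep F hq ht (l.map genT).prod =
      (l.map (opT F hq t)).prod := by
    intro l
    induction l with
    | nil => simp
    | cons i l ih => simp only [List.map_cons, List.prod_cons, map_mul, ih, rep_genT]
  rw [Tw, map_mul, h, rep_genPi_zpow, wordOp]

theorem rep_Tw_sub_mem (hq : q ≠ 0) (ht : t ≠ 0) (w : AffinePerm n) :
    rep F hq ht (Tw w) - permOp F hq w * mulOp F (leadCoef F hq t w) ∈
      lowerPart F hq n (len w) := by
  have h := wordOp_sub_mem (F := F) (t := t) hq (redWord w).1 (redWord w).2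
  rw [(redWord_spec w).1, (redWord_spec w).2] at h
  rw [rep_Tw]
  exact h

variable (F) in
/-- The operator `∑ T_x g_x`. -/
noncomputable def normalSum (hq : q ≠ 0) (ht : t ≠ 0) (g : AffinePerm n →₀ F) : Module.End K F :=
  g.sum fun x c => rep F hq ht (Tw x) * mulOp F c

/-- In `∑ T_x g_x` the permutations of maximal length have the expected coefficients. -/
theorem exists_skewSum_eq (hq : q ≠ 0) (ht : t ≠ 0) (g : AffinePerm n →₀ F) {m : ℕ}
    (hm : ∀ x, g x ≠ 0 → len x ≤ m) :
    ∃ φ : AffinePerm n →₀ F, normalSum F hq ht g = skewSum F hq φ ∧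
      ∀ x, len x = m → φ x = leadCoef F hq t x * g x := by
  let ψ : AffinePerm n →₀ F := Finsupp.onFinset g.support (fun x => leadCoef F hq t x * g x)
    (fun x hx => Finsupp.mem_support_iff.2 (right_ne_zero_of_mul hx))
  have h1 : skewSum F hq ψ =
      ∑ x ∈ g.support, permOp F hq x * mulOp F (leadCoef F hq t x * g x) :=
    Finsupp.onFinset_sum _ (fun x => by rw [map_zero, mul_zero])
  have h2 : normalSum F hq ht g - skewSum F hq ψ ∈ lowerPart F hq n m := by
    rw [h1, normalSum, Finsupp.sum, ← Finset.sum_sub_distrib]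
    refine sum_mem fun x hx => ?_
    rw [map_mul, ← mul_assoc, ← sub_mul]
    exact lowerPart_mul_mulOp hq (lowerPart_mono hq (hm x (Finsupp.mem_support_iff.1 hx))
      (rep_Tw_sub_mem hq ht x)) _
  obtain ⟨χ, h3, h4⟩ := exists_of_mem_lowerPart hq h2
  refine ⟨χ + ψ, by rw [skewSum_add, ← h3, sub_add_cancel], fun x hx => ?_⟩
  have h5 : χ x = 0 := by
    by_contra h
    exact (h4 x h).ne hx
  rw [Finsupp.add_apply, h5, zero_add]
  rfl

/-- The operators `T_w` are linearly independent over rational functions. -/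
theorem eq_zero_of_normalSum_eq_zero (hq : q ≠ 0) (hq' : ∀ m : ℤ, q ^ m = 1 → m = 0) (ht : t ≠ 0)
    {g : AffinePerm n →₀ F} (h : normalSum F hq ht g = 0) : g = 0 := by
  by_contra hg
  obtain ⟨x, hx, hmax⟩ := Finset.exists_max_image g.support len (Finsupp.support_nonempty_iff.2 hg)
  obtain ⟨φ, h1, h2⟩ := exists_skewSum_eq hq ht g
    (fun y hy => hmax y (Finsupp.mem_support_iff.2 hy))
  rw [h] at h1
  have h3 : φ = 0 := skewSum_injective hq hq' h1.symm
  have h4 := h2 x rfl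
  rw [h3] at h4
  exact mul_ne_zero (leadCoef_ne_zero hq ht x) (Finsupp.mem_support_iff.1 hx) h4.symm

/-- If `∑ T_x g_x` is the operator `w`, then it has leading term `T_w`, whose coefficient is the
inverse of the coefficient of `w` in `T_w`. -/
theorem leading_of_normalSum_eq_permOp (hq : q ≠ 0) (hq' : ∀ m : ℤ, q ^ m = 1 → m = 0) (ht : t ≠ 0)
    {g : AffinePerm n →₀ F} {w : AffinePerm n} (h : normalSum F hq ht g = permOp F hq w) :
    leadCoef F hq t w * g w = 1 ∧ ∀ x, x ≠ w → g x ≠ 0 → len x < len w := by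
  have hg : g ≠ 0 := by
    rintro rfl
    have h1 := congrArg (fun b : Module.End K F => b 1) h
    have h2 : (0 : F) = ratAct F hq w 1 := h1
    rw [map_one] at h2
    exact zero_ne_one h2
  obtain ⟨x, hx, hmax⟩ := Finset.exists_max_image g.support len (Finsupp.support_nonempty_iff.2 hg)
  obtain ⟨φ, h1, h2⟩ := exists_skewSum_eq hq ht g
    (fun y hy => hmax y (Finsupp.mem_support_iff.2 hy))
  have h3 : φ = Finsupp.single w 1 := by
    refine skewSum_injective hq hq' ?_
    rw [← h1, h, skewSum_single, map_one, mul_one]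
  have top : ∀ y, g y ≠ 0 → len y = len x → y = w := by
    intro y hy hl
    by_contra hne
    have h4 := h2 y hl
    rw [h3, Finsupp.single_eq_of_ne hne] at h4
    exact mul_ne_zero (leadCoef_ne_zero hq ht y) hy h4.symm
  have hxw := top x (Finsupp.mem_support_iff.1 hx) rfl
  subst hxw
  refine ⟨?_, fun y hy hy' => ?_⟩
  · rw [← h2 x rfl, h3, Finsupp.single_eq_same]
  · exact lt_of_le_of_ne (hmax y (Finsupp.mem_support_iff.2 hy')) fun hl => hy (top y hy' hl)

end Triangular

end QDaha

namespace QDaha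

open MvPolynomial

/-! ### Existence of normal orderings -/

section HeckeRelations

variable {K : Type*} [Field K] {n : ℕ} [NeZero n] {q t : K}
  {S : Submonoid (MvPolynomial (Fin n) K)}

theorem genT_sq (ht : t ≠ 0) (i : SimpleIdx n) :
    (genT i * genT i : HeckeOver n q t S) = (t - t⁻¹) • genT i + 1 := by
  have h := quot_rel (Rel.hecke (n := n) (q := q) (t := t) (S := S) i)
  rw [map_mul, map_sub, map_add, map_zero, AlgHom.commutes, AlgHom.commutes] at h
  change (genT i - algebraMap K (HeckeOver n q t S) t) *
    (genT i + algebraMap K (HeckeOver n q t S) t⁻¹) = 0 at h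
  rw [sub_mul, mul_add, mul_add, ← map_mul, mul_inv_cancel₀ ht, map_one, ← Algebra.commutes,
    ← Algebra.smul_def, ← Algebra.smul_def] at h
  rw [eq_sub_of_add_eq (sub_eq_zero.1 h), sub_smul]
  abel

theorem genT_braid (i j : SimpleIdx n) (hn : n ≠ 2) (hij : j.1 = i.1 + 1) :
    (genT i * genT j * genT i : HeckeOver n q t S) = genT j * genT i * genT j := by
  have h := quot_rel (Rel.braid (n := n) (q := q) (t := t) (S := S) i j hn hij)
  simp only [map_mul] at h
  exact h

theorem genT_comm (i j : SimpleIdx n) (hn : n ≠ 2) (hij : j.1 ≠ i.1 + 1) (hji : i.1 ≠ j.1 + 1) :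
    (genT i * genT j : HeckeOver n q t S) = genT j * genT i := by
  have h := quot_rel (Rel.comm (n := n) (q := q) (t := t) (S := S) i j hn hij hji)
  simp only [map_mul] at h
  exact h

theorem Tw_eq {w : AffinePerm n} {p : List (SimpleIdx n) × ℤ} (h : IsReduced w p) :
    (Tw w : HeckeOver n q t S) = (p.1.map genT).prod *
      ((genPi ^ p.2 : (HeckeOver n q t S)ˣ) : HeckeOver n q t S) :=
  prod_eq_of_isReduced genT (fun k => ((genPi ^ k : (HeckeOver n q t S)ˣ) : HeckeOver n q t S))
    genT_braid genT_comm (redWord_spec w) h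

theorem genT_mul_Tw_of_not_isDescent {i : SimpleIdx n} {w : AffinePerm n} (h : ¬ IsDescent i w) :
    (genT i * Tw w : HeckeOver n q t S) = Tw (simple i * w) := by
  have h1 : IsReduced (simple i * w) (i :: (redWord w).1, (redWord w).2) :=
    isReduced_cons.2 ⟨isDescent_simple_mul.2 h, by rw [simple_mul_cancel]; exact redWord_spec w⟩
  rw [Tw_eq h1, Tw_eq (redWord_spec w), List.map_cons, List.prod_cons, mul_assoc]

theorem genT_mul_Tw_of_isDescent (ht : t ≠ 0) {i : SimpleIdx n} {w : AffinePerm n}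
    (h : IsDescent i w) :
    (genT i * Tw w : HeckeOver n q t S) = (t - t⁻¹) • Tw w + Tw (simple i * w) := by
  have h1 : ¬ IsDescent i (simple i * w) := fun h' => isDescent_simple_mul.1 h' h
  have h2 := genT_mul_Tw_of_not_isDescent (q := q) (t := t) (S := S) h1
  rw [simple_mul_cancel] at h2
  rw [← h2, ← mul_assoc, genT_sq ht, add_mul, smul_mul_assoc, one_mul]

/-- The simple reflection with label shifted by `c`. -/
def idxAdd (c : ℤ) (i : SimpleIdx n) : SimpleIdx n :=
  ⟨i.1 + c, by
    rw [add_right_comm]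
    exact fun h => i.2 (add_right_cancel h)⟩

theorem simple_idxAdd_mul {n : ℕ} (c : ℤ) (i : SimpleIdx n) :
    shift n ^ c * simple i = simple (idxAdd c i) * shift n ^ c := by
  have hk : ((i.1.cast : ℤ) : ZMod n) = i.1 := ZMod.intCast_zmod_cast _
  refine (simple_mul_eq_mul_simple hk (k := (i.1.cast : ℤ) + c) ?_ ?_ ?_).symm
  · push_cast [hk]
    rfl
  · rw [shift_zpow_apply]
  · rw [shift_zpow_apply, add_right_comm]

theorem shift_zpow_mul_evalWord {n : ℕ} (c : ℤ) (l : List (SimpleIdx n)) (k : ℤ) :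
    shift n ^ c * evalWord (l, k) = evalWord (l.map (idxAdd c), c + k) := by
  induction l with
  | nil => simp [evalWord, zpow_add]
  | cons i l ih =>
    rw [List.map_cons, evalWord_cons, evalWord_cons, ← ih, ← mul_assoc, simple_idxAdd_mul,
      mul_assoc]

theorem len_shift_zpow_mul (c : ℤ) (w : AffinePerm n) : len (shift n ^ c * w) = len w := by
  have H : ∀ (c : ℤ) (w : AffinePerm n), len (shift n ^ c * w) ≤ len w := by
    intro c w
    obtain ⟨⟨l, k⟩, h1, h2⟩ := exists_reduced w
    rw [← h2, ← h1, shift_zpow_mul_evalWord]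
    exact (len_evalWord_le _ _).trans_eq (List.length_map _)
  refine le_antisymm (H c w) ?_
  have h := H (-c) (shift n ^ c * w)
  rwa [← mul_assoc, ← zpow_add, neg_add_cancel, zpow_zero, one_mul] at h

theorem isReduced_shift_zpow_mul (c : ℤ) {w : AffinePerm n} {p : List (SimpleIdx n) × ℤ}
    (h : IsReduced w p) : IsReduced (shift n ^ c * w) (p.1.map (idxAdd c), c + p.2) :=
  ⟨by rw [← shift_zpow_mul_evalWord]; exact congrArg _ h.1,
    by rw [len_shift_zpow_mul, List.length_map]; exact h.2⟩

theorem genPi_mul_genT (i : SimpleIdx n) :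
    ((genPi : (HeckeOver n q t S)ˣ) : HeckeOver n q t S) * genT i =
      genT (idxAdd 1 i) * ((genPi : (HeckeOver n q t S)ˣ) : HeckeOver n q t S) := by
  have h := quot_rel (Rel.pi_T (n := n) (q := q) (t := t) (S := S) i (idxAdd 1 i)
    (by simp [idxAdd]))
  rw [map_mul, map_mul] at h
  change ((genPi : (HeckeOver n q t S)ˣ) : HeckeOver n q t S) * genT i *
    ((genPi⁻¹ : (HeckeOver n q t S)ˣ) : HeckeOver n q t S) =
    genT (idxAdd 1 i) at h
  rwa [Units.mul_inv_eq_iff_eq_mul] at h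

theorem genPi_inv_mul_genT (i : SimpleIdx n) :
    ((genPi⁻¹ : (HeckeOver n q t S)ˣ) : HeckeOver n q t S) * genT i =
      genT (idxAdd (-1) i) * ((genPi⁻¹ : (HeckeOver n q t S)ˣ) : HeckeOver n q t S) := by
  have h := genPi_mul_genT (q := q) (t := t) (S := S) (idxAdd (-1) i)
  have h1 : idxAdd 1 (idxAdd (-1) i) = i := Subtype.ext (by simp [idxAdd])
  rw [h1] at h
  rw [Units.inv_mul_eq_iff_eq_mul, ← mul_assoc, h, mul_assoc, Units.mul_inv, mul_one]

theorem genPi_zpow_mul_genT (c : ℤ) (i : SimpleIdx n) :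
    ((genPi ^ c : (HeckeOver n q t S)ˣ) : HeckeOver n q t S) * genT i =
      genT (idxAdd c i) * ((genPi ^ c : (HeckeOver n q t S)ˣ) : HeckeOver n q t S) := by
  induction c using Int.induction_on generalizing i with
  | zero =>
    have h1 : idxAdd 0 i = i := Subtype.ext (by simp [idxAdd])
    rw [h1]
    simp
  | succ m ih =>
    have h1 : idxAdd m (idxAdd 1 i) = idxAdd (m + 1) i :=
      Subtype.ext (by simp only [idxAdd]; push_cast; ring)
    rw [zpow_add_one, Units.val_mul, mul_assoc, genPi_mul_genT, ← mul_assoc, ih, h1, mul_assoc]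
  | pred m ih =>
    have h1 : idxAdd (-m) (idxAdd (-1) i) = idxAdd (-m - 1) i :=
      Subtype.ext (by simp only [idxAdd]; push_cast; ring)
    rw [zpow_sub_one, Units.val_mul, mul_assoc, genPi_inv_mul_genT, ← mul_assoc, ih, h1, mul_assoc]

theorem genPi_zpow_mul_Tw (c : ℤ) (w : AffinePerm n) :
    ((genPi ^ c : (HeckeOver n q t S)ˣ) : HeckeOver n q t S) * Tw w = Tw (shift n ^ c * w) := by
  rw [Tw_eq (isReduced_shift_zpow_mul c (redWord_spec w)), Tw_eq (redWord_spec w)]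
  generalize (redWord w).2 = k
  simp only
  induction (redWord w).1 with
  | nil => simp [zpow_add]
  | cons i l ih =>
    simp only [List.map_cons, List.prod_cons]
    rw [mul_assoc, ← mul_assoc _ (genT i), genPi_zpow_mul_genT, mul_assoc, ih, ← mul_assoc]

end HeckeRelations

section NormalOrdering

variable {K : Type*} [Field K] {n : ℕ} [NeZero n] {q t : K}

theorem genY_add {S : Submonoid (MvPolynomial (Fin n) K)} (a b : Localization S) :
    (genY (a + b) : HeckeOver n q t S) = genY a + genY b := map_add genYHom a b

theorem genY_mul {S : Submonoid (MvPolynomial (Fin n) K)} (a b : Localization S) :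
    (genY (a * b) : HeckeOver n q t S) = genY a * genY b := map_mul genYHom a b

theorem genY_neg {S : Submonoid (MvPolynomial (Fin n) K)} (a : Localization S) :
    (genY (-a) : HeckeOver n q t S) = -genY a := map_neg genYHom a

theorem genY_zero {S : Submonoid (MvPolynomial (Fin n) K)} :
    (genY 0 : HeckeOver n q t S) = 0 := map_zero genYHom

theorem genY_one {S : Submonoid (MvPolynomial (Fin n) K)} :
    (genY 1 : HeckeOver n q t S) = 1 := map_one genYHom

theorem genY_algebraMap {S : Submonoid (MvPolynomial (Fin n) K)} (c : K) :
    (genY (algebraMap K _ c) : HeckeOver n q t S) = algebraMap K _ c :=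
  (genYHom (n := n) (q := q) (t := t) (S := S)).commutes c

/-- `a` can be moved to the right past `z`, where it becomes `a'`, up to an element of the
commutative subalgebra. -/
def Passes (z : LocDAHA n q t) (a a' : Localization (denominators n q t)) : Prop :=
  ∃ b, genY a * z = z * genY a' + genY b

theorem Passes.add {z : LocDAHA n q t} {a a' b b' : Localization (denominators n q t)}
    (h : Passes z a a') (h' : Passes z b b') : Passes z (a + b) (a' + b') := by
  obtain ⟨c, hc⟩ := h
  obtain ⟨d, hd⟩ := h'
  refine ⟨c + d, ?_⟩
  rw [genY_add, genY_add, genY_add, add_mul, mul_add, hc, hd]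
  abel

theorem Passes.mul {z : LocDAHA n q t} {a a' b b' : Localization (denominators n q t)}
    (h : Passes z a a') (h' : Passes z b b') : Passes z (a * b) (a' * b') := by
  obtain ⟨c, hc⟩ := h
  obtain ⟨d, hd⟩ := h'
  refine ⟨c * b' + a * d, ?_⟩
  rw [genY_mul, genY_mul, genY_add, genY_mul, genY_mul, mul_assoc, hd, mul_add, ← mul_assoc, hc,
    add_mul, mul_assoc, add_assoc]

theorem passes_algebraMap (z : LocDAHA n q t) (c : K) :
    Passes z (algebraMap K _ c) (algebraMap K _ c) :=
  ⟨0, by rw [genY_algebraMap, Algebra.commutes, genY_zero, add_zero]⟩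

theorem Passes.inv {z : LocDAHA n q t} {a a' b b' : Localization (denominators n q t)}
    (h : Passes z a a') (hb : a * b = 1) (hb' : a' * b' = 1) : Passes z b b' := by
  obtain ⟨c, hc⟩ := h
  refine ⟨-(b * c * b'), ?_⟩
  have h1 : genY b * (genY a * z) * genY b' = genY b * z * (genY a' * genY b') +
      genY b * genY c * genY b' := by
    rw [hc]
    noncomm_ring
  rw [← genY_mul, hb', genY_one, mul_one, ← mul_assoc, ← genY_mul, mul_comm b a, hb, genY_one,
    one_mul, ← genY_mul, ← genY_mul] at h1
  rw [genY_neg, h1, add_neg_cancel_right]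

/-- The image of a denominator under an affine permutation is invertible. -/
theorem isUnit_polyAct (hq : q ≠ 0) (w : AffinePerm n) {p : MvPolynomial (Fin n) K}
    (hp : p ∈ denominators n q t) :
    IsUnit (algebraMap _ (Localization (denominators n q t)) (polyAct q w p)) := by
  have units : ∀ p ∈ denominators n q t,
      IsUnit (algebraMap _ (Localization (denominators n q t)) p) :=
    fun p hp => IsLocalization.map_units (M := denominators n q t) _ ⟨p, hp⟩
  induction hp using Submonoid.closure_induction with
  | mem p hp =>
    rcases hp with ⟨r, rfl⟩ | ⟨k, l, hkl, rfl⟩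
    · rw [← Ypoly_val_add_one (q := q) r, polyAct_Ypoly hq, Ypoly, map_mul]
      refine IsUnit.mul ?_ (units _ (Submonoid.subset_closure (Or.inl ⟨_, rfl⟩)))
      exact (((zpow_ne_zero _ hq).isUnit).map C).map _
    · have h1 : polyAct q w (fpoly n q t k l) = fpoly n q t (w.1 k) (w.1 l) := by
        rw [fpoly, map_sub, map_mul, map_mul, polyAct_Ypoly hq, polyAct_Ypoly hq, fpoly,
          ← algebraMap_eq, AlgHom.commutes, AlgHom.commutes]
      rw [h1]
      refine units _ (Submonoid.subset_closure (Or.inr ⟨_, _, fun h => hkl ?_, rfl⟩))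
      obtain ⟨m, hm⟩ := (intCast_eq_iff_exists _ _).1 h
      rw [← affine_add_mul] at hm
      rw [w.1.injective hm]
      simp
  | one => rw [map_one, map_one]; exact isUnit_one
  | mul a b _ _ ha hb => rw [map_mul, map_mul]; exact ha.mul hb

/-- If every `Y_k` can be moved past `z` and becomes `Y_{w k}`, then so can every element of the
localized commutative algebra. -/
theorem exists_passes (hq : q ≠ 0) (w : AffinePerm n) {z : LocDAHA n q t}
    (hz : ∀ k, Passes z (algebraMap _ _ (Ypoly n q k)) (algebraMap _ _ (Ypoly n q (w.1 k))))
    (a : Localization (denominators n q t)) : ∃ a', Passes z a a' := by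
  have hpoly : ∀ p, Passes z (algebraMap _ _ p) (algebraMap _ _ (polyAct q w p)) := by
    intro p
    induction p using MvPolynomial.induction_on with
    | C c =>
      rw [← algebraMap_eq, AlgHom.commutes,
        ← IsScalarTower.algebraMap_apply K (MvPolynomial (Fin n) K)
          (Localization (denominators n q t))]
      exact passes_algebraMap z c
    | add p p' h h' => rw [map_add, map_add, map_add]; exact h.add h'
    | mul_X p r h =>
      rw [map_mul, map_mul, map_mul, ← Ypoly_val_add_one (q := q) r, polyAct_Ypoly hq]
      exact h.mul (hz _)
  obtain ⟨⟨p, s⟩, hp⟩ := IsLocalization.surj (denominators n q t) a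
  obtain ⟨b, hb⟩ := (IsLocalization.map_units (Localization (denominators n q t)) s).exists_right_inv
  obtain ⟨b', hb'⟩ := (isUnit_polyAct hq w s.2).exists_right_inv
  refine ⟨algebraMap _ _ (polyAct q w p) * b', ?_⟩
  have h1 : a = algebraMap _ _ p * b := by
    rw [← hp, mul_assoc, hb, mul_one]
  rw [h1]
  exact (hpoly p).mul ((hpoly s).inv hb hb')

theorem genY_mul_genT (ht : t ≠ 0) (i : SimpleIdx n) (k : ℤ) :
    Passes (genT i : LocDAHA n q t) (algebraMap _ _ (Ypoly n q k))
      (algebraMap _ _ (Ypoly n q ((simple i).1 k))) := by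
  rw [simple_apply]
  by_cases h1 : (k : ZMod n) = i.1
  · have h2 := quot_rel (Rel.T_Y_T (q := q) (t := t) (S := denominators n q t) i k h1)
    rw [map_mul, map_mul] at h2
    change genT i * genY _ * genT i = genY _ at h2
    refine ⟨-(algebraMap K _ (t - t⁻¹) * algebraMap _ _ (Ypoly n q (k + 1))), ?_⟩
    have h3 : (genT i * genT i : LocDAHA n q t) - algebraMap K _ (t - t⁻¹) * genT i = 1 := by
      rw [genT_sq ht, Algebra.smul_def, add_sub_cancel_left]
    rw [simpleFun_left h1, genY_neg, genY_mul, genY_algebraMap, ← h2]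
    have h4 : ∀ y : LocDAHA n q t, y * genT i = (genT i * genT i -
        algebraMap K _ (t - t⁻¹) * genT i) * (y * genT i) := fun y => by rw [h3, one_mul]
    rw [h4]
    noncomm_ring
  · by_cases h1' : (k : ZMod n) = i.1 + 1
    · have h5 : ((k - 1 : ℤ) : ZMod n) = i.1 := by push_cast; rw [h1', add_sub_cancel_right]
      have h2 := quot_rel (Rel.T_Y_T (q := q) (t := t) (S := denominators n q t) i (k - 1) h5)
      rw [map_mul, map_mul, sub_add_cancel] at h2
      change genT i * genY _ * genT i = genY _ at h2
      have h6 : simpleFun i k = k - 1 := by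
        conv_lhs => rw [← sub_add_cancel k 1]
        exact simpleFun_right h5
      refine ⟨algebraMap K _ (t - t⁻¹) * algebraMap _ _ (Ypoly n q k), ?_⟩
      rw [h6, genY_mul, genY_algebraMap, ← h2, mul_assoc, genT_sq ht, mul_add, mul_one,
        mul_smul_comm, Algebra.smul_def, add_comm]
    · have h2 := quot_rel (Rel.T_Y (q := q) (t := t) (S := denominators n q t) i k h1 h1')
      rw [map_mul, map_mul] at h2
      rw [simpleFun_other h1 h1']
      exact ⟨0, by rw [genY_zero, add_zero]; exact h2.symm⟩

theorem genPi_mul_genY_Ypoly (k : ℤ) :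
    ((genPi : (LocDAHA n q t)ˣ) : LocDAHA n q t) * genY (algebraMap _ _ (Ypoly n q k)) =
      genY (algebraMap _ _ (Ypoly n q (k + 1))) *
        ((genPi : (LocDAHA n q t)ˣ) : LocDAHA n q t) := by
  have h := quot_rel (Rel.pi_Y (q := q) (t := t) (S := denominators n q t) k)
  rw [map_mul, map_mul] at h
  change ((genPi : (LocDAHA n q t)ˣ) : LocDAHA n q t) * genY _ *
    ((genPi⁻¹ : (LocDAHA n q t)ˣ) : LocDAHA n q t) = genY _ at h
  rwa [Units.mul_inv_eq_iff_eq_mul] at h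

theorem genY_mul_genPi (k : ℤ) :
    Passes ((genPi : (LocDAHA n q t)ˣ) : LocDAHA n q t) (algebraMap _ _ (Ypoly n q k))
      (algebraMap _ _ (Ypoly n q ((shift n)⁻¹.1 k))) := by
  refine ⟨0, ?_⟩
  rw [genY_zero, add_zero, genPi_mul_genY_Ypoly]
  have h : (shift n)⁻¹.1 k + 1 = k := apply_inv_self (shift n) k
  rw [h]

theorem genY_mul_genPi_inv (k : ℤ) :
    Passes ((genPi⁻¹ : (LocDAHA n q t)ˣ) : LocDAHA n q t) (algebraMap _ _ (Ypoly n q k))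
      (algebraMap _ _ (Ypoly n q ((shift n).1 k))) := by
  refine ⟨0, ?_⟩
  have h : (shift n).1 k = k + 1 := rfl
  rw [genY_zero, add_zero, h, Units.mul_inv_eq_iff_eq_mul, mul_assoc, ← genPi_mul_genY_Ypoly,
    ← mul_assoc, Units.inv_mul, one_mul]

/-- The elements with a normal ordering. -/
noncomputable def orderable (n : ℕ) [NeZero n] (q t : K) : AddSubgroup (LocDAHA n q t) :=
  AddSubgroup.closure {h | ∃ (x : AffinePerm n) (a : _), h = Tw x * genY a}

theorem exists_isNormalOrdering {h : LocDAHA n q t} (hh : h ∈ orderable n q t) :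
    ∃ g, IsNormalOrdering h g := by
  have hz : ∀ x : AffinePerm n, (Tw x * genY 0 : LocDAHA n q t) = 0 := fun x => by
    rw [genY_zero, mul_zero]
  have hadd : ∀ (x : AffinePerm n) a b,
      (Tw x * genY (a + b) : LocDAHA n q t) = Tw x * genY a + Tw x * genY b := fun x a b => by
    rw [genY_add, mul_add]
  induction hh using AddSubgroup.closure_induction with
  | mem h hh =>
    obtain ⟨x, a, rfl⟩ := hh
    exact ⟨Finsupp.single x a, by rw [IsNormalOrdering, Finsupp.sum_single_index (hz x)]⟩
  | zero => exact ⟨0, rfl⟩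
  | add a b _ _ ha hb =>
    obtain ⟨g, hg⟩ := ha
    obtain ⟨g', hg'⟩ := hb
    refine ⟨g + g', ?_⟩
    rw [IsNormalOrdering] at hg hg' ⊢
    rw [Finsupp.sum_add_index' hz hadd, ← hg, ← hg']
  | neg a _ ha =>
    obtain ⟨g, hg⟩ := ha
    refine ⟨-g, ?_⟩
    rw [IsNormalOrdering] at hg ⊢
    rw [Finsupp.sum_neg_index hz, hg, Finsupp.sum, Finsupp.sum, ← Finset.sum_neg_distrib]
    exact Finset.sum_congr rfl fun x _ => by rw [genY_neg, mul_neg]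

theorem Tw_mem_orderable (x : AffinePerm n) (a : Localization (denominators n q t)) :
    Tw x * genY a ∈ orderable n q t :=
  AddSubgroup.subset_closure ⟨x, a, rfl⟩

/-- A left multiplication preserves `orderable` if it does so on the elements `T_x g`. -/
theorem mul_mem_orderable {z h : LocDAHA n q t}
    (hz : ∀ x a, z * (Tw x * genY a) ∈ orderable n q t) (hh : h ∈ orderable n q t) :
    z * h ∈ orderable n q t := by
  induction hh using AddSubgroup.closure_induction with
  | mem h hh =>
    obtain ⟨x, a, rfl⟩ := hh
    exact hz x a
  | zero => rw [mul_zero]; exact zero_mem _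
  | add a b _ _ ha hb => rw [mul_add]; exact add_mem ha hb
  | neg a _ ha => rw [mul_neg]; exact neg_mem ha

theorem genT_mul_mem_orderable (ht : t ≠ 0) (i : SimpleIdx n) {h : LocDAHA n q t}
    (hh : h ∈ orderable n q t) : genT i * h ∈ orderable n q t := by
  refine mul_mem_orderable (fun x a => ?_) hh
  rw [← mul_assoc]
  by_cases hd : IsDescent i x
  · rw [genT_mul_Tw_of_isDescent ht hd, add_mul, Algebra.smul_def, Algebra.commutes,
      ← genY_algebraMap, mul_assoc, ← genY_mul]
    exact add_mem (Tw_mem_orderable _ _) (Tw_mem_orderable _ _)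
  · rw [genT_mul_Tw_of_not_isDescent hd]
    exact Tw_mem_orderable _ _

theorem genPi_zpow_mul_mem_orderable (c : ℤ) {h : LocDAHA n q t} (hh : h ∈ orderable n q t) :
    ((genPi ^ c : (LocDAHA n q t)ˣ) : LocDAHA n q t) * h ∈ orderable n q t := by
  refine mul_mem_orderable (fun x a => ?_) hh
  rw [← mul_assoc, genPi_zpow_mul_Tw]
  exact Tw_mem_orderable _ _

theorem orderable_mul_genY {h : LocDAHA n q t} (hh : h ∈ orderable n q t)
    (b : Localization (denominators n q t)) : h * genY b ∈ orderable n q t := by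
  induction hh using AddSubgroup.closure_induction with
  | mem h hh =>
    obtain ⟨x, a, rfl⟩ := hh
    rw [mul_assoc, ← genY_mul]
    exact Tw_mem_orderable _ _
  | zero => rw [zero_mul]; exact zero_mem _
  | add a b _ _ ha hb => rw [add_mul]; exact add_mem ha hb
  | neg a _ ha => rw [neg_mul]; exact neg_mem ha

theorem genPi_zpow_mem_orderable (k : ℤ) :
    ((genPi ^ k : (LocDAHA n q t)ˣ) : LocDAHA n q t) ∈ orderable n q t := by
  have h : IsReduced (shift n ^ k) (([], k) : List (SimpleIdx n) × ℤ) := by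
    have h1 : evalWord (([], k) : List (SimpleIdx n) × ℤ) = shift n ^ k := by simp [evalWord]
    exact ⟨h1, (Nat.le_zero.1 (len_le_length h1)).symm⟩
  have h2 := Tw_mem_orderable (shift n ^ k) (1 : Localization (denominators n q t))
  rw [Tw_eq h, genY_one, mul_one] at h2
  simpa using h2

theorem genY_mul_mem_orderable (hq : q ≠ 0) (ht : t ≠ 0) {h : LocDAHA n q t}
    (hh : h ∈ orderable n q t) (a : Localization (denominators n q t)) :
    genY a * h ∈ orderable n q t := by
  -- If all `genY a` can be multiplied to `h`, then also to `z * h` when `z` can be passed.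
  have step : ∀ (w : AffinePerm n) (z : LocDAHA n q t),
      (∀ k, Passes z (algebraMap _ _ (Ypoly n q k)) (algebraMap _ _ (Ypoly n q (w.1 k)))) →
      (∀ h ∈ orderable n q t, z * h ∈ orderable n q t) →
      ∀ h : LocDAHA n q t, (∀ a, genY a * h ∈ orderable n q t) →
        ∀ a, genY a * (z * h) ∈ orderable n q t := by
    intro w z hz hz' h hh a
    obtain ⟨a', b, hb⟩ := exists_passes hq w hz a
    rw [← mul_assoc, hb, add_mul, mul_assoc]
    exact add_mem (hz' _ (hh a')) (hh b)
  have hone : ∀ a, genY a * 1 ∈ orderable n q t := by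
    intro a
    rw [mul_one]
    have h1 := orderable_mul_genY (genPi_zpow_mem_orderable (n := n) (q := q) (t := t) 0) a
    simpa using h1
  have hpi : ∀ (k : ℤ) a, genY a * ((genPi ^ k : (LocDAHA n q t)ˣ) : LocDAHA n q t) ∈
      orderable n q t := by
    intro k
    induction k using Int.induction_on with
    | zero => simpa using hone
    | succ m ih =>
      intro a
      rw [add_comm, zpow_add, zpow_one, Units.val_mul]
      refine step (shift n)⁻¹ _ genY_mul_genPi (fun h hh => ?_) _ ih a
      simpa using genPi_zpow_mul_mem_orderable 1 hh
    | pred m ih =>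
      intro a
      rw [sub_eq_neg_add, zpow_add, zpow_neg_one, Units.val_mul]
      refine step (shift n) _ genY_mul_genPi_inv (fun h hh => ?_) _ ih a
      simpa using genPi_zpow_mul_mem_orderable (-1) hh
  refine mul_mem_orderable (fun x b => ?_) hh
  rw [← mul_assoc]
  refine orderable_mul_genY ?_ b
  rw [Tw]
  revert a
  induction (redWord x).1 with
  | nil => simpa using hpi _
  | cons i l ih =>
    intro a
    rw [List.map_cons, List.prod_cons, mul_assoc]
    exact step (simple i) _ (genY_mul_genT ht i) (fun h hh => genT_mul_mem_orderable ht i hh) _ ih a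

/-- The intertwiners have normal orderings. -/
theorem nu_mem_orderable (hq : q ≠ 0) (ht : t ≠ 0) (w : AffinePerm n) :
    (nu w : LocDAHA n q t) ∈ orderable n q t := by
  rw [nu]
  induction (redWord w).1 with
  | nil => simpa using genPi_zpow_mem_orderable _
  | cons i l ih =>
    rw [List.map_cons, List.prod_cons, mul_assoc, nuSimple, phi, mul_assoc, sub_mul, mul_assoc,
      mul_assoc]
    have h1 := genY_mul_mem_orderable hq ht ih
      (Localization.mk 1 ⟨fpoly n q t (i.1.cast : ℤ) ((i.1.cast : ℤ) + 1), fpoly_mem i⟩)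
    exact sub_mem (genT_mul_mem_orderable ht i (genY_mul_mem_orderable hq ht h1 _))
      (genY_mul_mem_orderable hq ht (genT_mul_mem_orderable ht i h1) _)

end NormalOrdering

end QDaha

namespace QDaha

open MvPolynomial

/-! ### Operators regular at a point -/

section Regular

variable {K : Type*} [Field K] {n : ℕ} {q t : K}
  {F : Type*} [Field F] [Algebra K F] [Algebra (MvPolynomial (Fin n) K) F]
  [IsScalarTower K (MvPolynomial (Fin n) K) F]

variable (F) in
/-- The local ring of rational functions without a pole at the point `a`. -/
def regularAt (a : Fin n → K) : Subring F where
  carrier := {g | ∃ P Q : MvPolynomial (Fin n) K, eval a Q ≠ 0 ∧ g * ofPoly F Q = ofPoly F P}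
  one_mem' := ⟨1, 1, by simp, by simp⟩
  zero_mem' := ⟨0, 1, by simp, by simp⟩
  add_mem' := by
    rintro g g' ⟨P, Q, h, h1⟩ ⟨P', Q', h', h1'⟩
    refine ⟨P * Q' + P' * Q, Q * Q', by rw [map_mul]; exact mul_ne_zero h h', ?_⟩
    rw [map_mul, map_add, map_mul, map_mul, ← h1, ← h1']
    ring
  mul_mem' := by
    rintro g g' ⟨P, Q, h, h1⟩ ⟨P', Q', h', h1'⟩
    refine ⟨P * P', Q * Q', by rw [map_mul]; exact mul_ne_zero h h', ?_⟩
    rw [map_mul, map_mul, ← h1, ← h1']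
    ring
  neg_mem' := by
    rintro g ⟨P, Q, h, h1⟩
    exact ⟨-P, Q, h, by rw [map_neg, ← h1, neg_mul]⟩

theorem ofPoly_mem_regularAt (a : Fin n → K) (P : MvPolynomial (Fin n) K) :
    ofPoly F P ∈ regularAt F a :=
  ⟨P, 1, by simp, by simp⟩

theorem algebraMap_mem_regularAt (a : Fin n → K) (c : K) : algebraMap K F c ∈ regularAt F a := by
  have h := ofPoly_mem_regularAt (F := F) a (C c)
  rwa [← algebraMap_eq, AlgHom.commutes] at h

theorem Yrat_mem_regularAt [NeZero n] (a : Fin n → K) (k : ℤ) : Yrat n F q k ∈ regularAt F a :=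
  ofPoly_mem_regularAt a _

variable [IsFractionRing (MvPolynomial (Fin n) K) F]

theorem ofPoly_ne_zero {a : Fin n → K} {Q : MvPolynomial (Fin n) K} (h : eval a Q ≠ 0) :
    ofPoly F Q ≠ 0 := by
  refine (map_ne_zero_iff _ ofPoly_injective).2 ?_
  rintro rfl
  exact h (map_zero _)

theorem inv_ofPoly_mem_regularAt {a : Fin n → K} {Q : MvPolynomial (Fin n) K} (h : eval a Q ≠ 0) :
    (ofPoly F Q)⁻¹ ∈ regularAt F a :=
  ⟨1, Q, h, by rw [map_one, inv_mul_cancel₀ (ofPoly_ne_zero h)]⟩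

/-- The point `Y_k = t ^ (2 e_k)`, for an integral sequence with `e_{k + n} = e_k + 1`. -/
def expPoint (n : ℕ) (t : K) (e : ℤ → ℤ) : Fin n → K := fun r => t ^ (2 * e ((r : ℕ) + 1))

theorem quasi_add_mul {e : ℤ → ℤ} (he : ∀ k, e (k + n) = e k + 1) (k m : ℤ) :
    e (k + m * n) = e k + m := by
  induction m using Int.induction_on with
  | zero => simp
  | succ m ih => rw [add_mul, one_mul, ← add_assoc, he, ih]; ring
  | pred m ih =>
    have := he (k + (-(m : ℤ) - 1) * n)
    rw [show k + (-(m : ℤ) - 1) * n + n = k + (-(m : ℤ)) * n by ring, ih] at this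
    linarith

theorem quasi_comp {e : ℤ → ℤ} (he : ∀ k, e (k + n) = e k + 1) (w : AffinePerm n) (k : ℤ) :
    e (w.1 (k + n)) = e (w.1 k) + 1 := by
  rw [affine_add, he]

variable [NeZero n]

theorem eval_Ypoly (hqt : q = t ^ (-2 : ℤ)) (ht : t ≠ 0) {e : ℤ → ℤ}
    (he : ∀ k, e (k + n) = e k + 1) (k : ℤ) :
    eval (expPoint n t e) (Ypoly n q k) = t ^ (2 * e k) := by
  conv_rhs => rw [eq_resid_add (n := n) k, quasi_add_mul he]
  rw [Ypoly, map_mul, eval_C, eval_X, expPoint, hqt, ← zpow_mul, ← zpow_add₀ ht]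
  congr 1
  ring

theorem eval_polyAct (hqt : q = t ^ (-2 : ℤ)) (ht : t ≠ 0) {e : ℤ → ℤ}
    (he : ∀ k, e (k + n) = e k + 1) (w : AffinePerm n) (P : MvPolynomial (Fin n) K) :
    eval (expPoint n t e) (polyAct q w P) = eval (expPoint n t fun k => e (w.1 k)) P := by
  induction P using MvPolynomial.induction_on with
  | C c => rw [← algebraMap_eq, AlgHom.commutes, algebraMap_eq, eval_C, eval_C]
  | add P P' h h' => rw [map_add, map_add, map_add, h, h']
  | mul_X P r h =>
    rw [map_mul, map_mul, map_mul, h, polyAct, aeval_X, eval_Ypoly hqt ht he, eval_X, expPoint]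

theorem ratAct_mem_regularAt (hq : q ≠ 0) (hqt : q = t ^ (-2 : ℤ)) (ht : t ≠ 0) {e : ℤ → ℤ}
    (he : ∀ k, e (k + n) = e k + 1) (w : AffinePerm n) {g : F}
    (hg : g ∈ regularAt F (expPoint n t fun k => e (w.1 k))) :
    ratAct F hq w g ∈ regularAt F (expPoint n t e) := by
  obtain ⟨P, Q, h, h1⟩ := hg
  refine ⟨polyAct q w P, polyAct q w Q, by rwa [eval_polyAct hqt ht he], ?_⟩
  rw [← ratAct_ofPoly hq, ← ratAct_ofPoly hq, ← map_mul, h1]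

theorem zpow_two_ne (ht : t ≠ 0) (ht' : ∀ m : ℤ, t ^ m = 1 → m = 0) {a b : ℤ} (h : a ≠ b) :
    t ^ a ≠ t ^ b := by
  intro h1
  have h2 := ht' (a - b) (by rw [zpow_sub₀ ht, h1, div_self (zpow_ne_zero _ ht)])
  omega

theorem eval_fpoly_ne_zero (hqt : q = t ^ (-2 : ℤ)) (ht : t ≠ 0) (ht' : ∀ m : ℤ, t ^ m = 1 → m = 0)
    {e : ℤ → ℤ} (he : ∀ k, e (k + n) = e k + 1) {k l : ℤ} (h : e l ≠ e k + 1) :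
    eval (expPoint n t e) (fpoly n q t k l) ≠ 0 := by
  rw [fpoly, map_sub, map_mul, map_mul, eval_C, eval_C, eval_Ypoly hqt ht he, eval_Ypoly hqt ht he,
    ← zpow_neg_one, ← zpow_one_add₀ ht, ← zpow_add₀ ht, sub_ne_zero]
  exact zpow_two_ne ht ht' (by omega)

theorem inv_frat_mem_regularAt (hqt : q = t ^ (-2 : ℤ)) (ht : t ≠ 0)
    (ht' : ∀ m : ℤ, t ^ m = 1 → m = 0)
    {e : ℤ → ℤ} (he : ∀ k, e (k + n) = e k + 1) {k l : ℤ} (h : e l ≠ e k + 1) :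
    (frat n F q t k l)⁻¹ ∈ regularAt F (expPoint n t e) := by
  rw [← ofPoly_fpoly]
  exact inv_ofPoly_mem_regularAt (eval_fpoly_ne_zero hqt ht ht' he h)

theorem exists_sub_polyAct_eq (hq : q ≠ 0) {i : SimpleIdx n} {k : ℤ} (hk : (k : ZMod n) = i.1)
    (P : MvPolynomial (Fin n) K) :
    ∃ D, P - polyAct q (simple i) P = (Ypoly n q k - Ypoly n q (k + 1)) * D := by
  have hY : ∀ m : ℤ, ∃ D, Ypoly n q m - Ypoly n q (simpleFun i m) =
      (Ypoly n q k - Ypoly n q (k + 1)) * D := by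
    intro m
    by_cases h1 : (m : ZMod n) = i.1
    · obtain ⟨j, rfl⟩ := (intCast_eq_iff_exists k m).1 (hk.trans h1.symm)
      refine ⟨C (q ^ (-j)), ?_⟩
      rw [simpleFun_left h1, add_right_comm, Ypoly_add_mul hq, Ypoly_add_mul hq]
      ring
    · by_cases h2 : (m : ZMod n) = i.1 + 1
      · obtain ⟨j, rfl⟩ := (intCast_eq_iff_exists (n := n) (k + 1) m).1 (by
          push_cast; rw [hk, h2])
        refine ⟨-C (q ^ (-j)), ?_⟩
        rw [add_right_comm, simpleFun_right (by simp [hk]), add_right_comm, Ypoly_add_mul hq,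
          Ypoly_add_mul hq]
        ring
      · exact ⟨0, by rw [simpleFun_other h1 h2, sub_self, mul_zero]⟩
  induction P using MvPolynomial.induction_on with
  | C c => exact ⟨0, by rw [← algebraMap_eq, AlgHom.commutes, sub_self, mul_zero]⟩
  | add P P' h h' =>
    obtain ⟨D, hD⟩ := h
    obtain ⟨D', hD'⟩ := h'
    refine ⟨D + D', ?_⟩
    rw [map_add]
    linear_combination hD + hD'
  | mul_X P r h =>
    obtain ⟨D, hD⟩ := h
    obtain ⟨D', hD'⟩ := hY ((r : ℕ) + 1)
    refine ⟨D * X r + polyAct q (simple i) P * D', ?_⟩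
    rw [map_mul, ← Ypoly_val_add_one (q := q) r, polyAct_Ypoly hq, simple_apply]
    linear_combination Ypoly n q ((r : ℕ) + 1 : ℤ) * hD + polyAct q (simple i) P * hD'

/-- At a point fixed by `s_i`, Demazure's difference quotient of a regular function is regular. -/
theorem sub_ratAct_div_mem_regularAt (hq : q ≠ 0) (hqt : q = t ^ (-2 : ℤ)) (ht : t ≠ 0) {e : ℤ → ℤ}
    (he : ∀ k, e (k + n) = e k + 1) {i : SimpleIdx n} {k : ℤ} (hk : (k : ZMod n) = i.1)
    (hei : (fun m => e ((simple i).1 m)) = e) {g : F} (hg : g ∈ regularAt F (expPoint n t e)) :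
    (g - ratAct F hq (simple i) g) * (Yrat n F q k - Yrat n F q (k + 1))⁻¹ ∈
      regularAt F (expPoint n t e) := by
  obtain ⟨P, Q, h, h1⟩ := hg
  obtain ⟨D, hD⟩ := exists_sub_polyAct_eq hq hk P
  obtain ⟨D', hD'⟩ := exists_sub_polyAct_eq hq hk Q
  have hQ' : eval (expPoint n t e) (polyAct q (simple i) Q) ≠ 0 := by
    rwa [eval_polyAct hqt ht he, hei]
  have h2 := congrArg (ratAct F hq (simple i)) h1
  rw [map_mul, ratAct_ofPoly, ratAct_ofPoly] at h2
  have hy := Yrat_sub_ne_zero (F := F) hq (ne_succ i hk)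
  have hD := congrArg (ofPoly F) hD
  have hD' := congrArg (ofPoly F) hD'
  rw [map_sub, map_mul, map_sub] at hD hD'
  change _ = (Yrat n F q k - Yrat n F q (k + 1)) * _ at hD
  change _ = (Yrat n F q k - Yrat n F q (k + 1)) * _ at hD'
  refine ⟨D * polyAct q (simple i) Q - polyAct q (simple i) P * D', Q * polyAct q (simple i) Q,
    by rw [map_mul]; exact mul_ne_zero h hQ', ?_⟩
  rw [map_sub, map_mul, map_mul, map_mul]
  set y := Yrat n F q k - Yrat n F q (k + 1)
  have h3 : (g - ratAct F hq (simple i) g) * (ofPoly F Q * ofPoly F (polyAct q (simple i) Q)) =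
      y * (ofPoly F D * ofPoly F (polyAct q (simple i) Q) -
        ofPoly F (polyAct q (simple i) P) * ofPoly F D') := by
    linear_combination ofPoly F (polyAct q (simple i) Q) * h1 - ofPoly F Q * h2 +
      ofPoly F (polyAct q (simple i) Q) * hD - ofPoly F (polyAct q (simple i) P) * hD'
  rw [mul_right_comm, h3, mul_right_comm, mul_inv_cancel₀ hy, one_mul]

variable (F) in
/-- The operators `∑ T_x g_x` whose coefficients are regular at the point with exponents `e`. -/
noncomputable def regularOps (hq : q ≠ 0) (ht : t ≠ 0) (e : ℤ → ℤ) :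
    AddSubgroup (Module.End K F) :=
  AddSubgroup.closure {b | ∃ (x : AffinePerm n) (g : F), g ∈ regularAt F (expPoint n t e) ∧
    b = rep F hq ht (Tw x) * mulOp F g}

theorem normalSum_add (hq : q ≠ 0) (ht : t ≠ 0) (g g' : AffinePerm n →₀ F) :
    normalSum F hq ht (g + g') = normalSum F hq ht g + normalSum F hq ht g' :=
  Finsupp.sum_add_index' (fun x => by rw [map_zero, mul_zero])
    (fun x a b => by rw [map_add, mul_add])

theorem normalSum_neg (hq : q ≠ 0) (ht : t ≠ 0) (g : AffinePerm n →₀ F) :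
    normalSum F hq ht (-g) = -normalSum F hq ht g := by
  rw [eq_neg_iff_add_eq_zero, ← normalSum_add, neg_add_cancel]
  rfl

theorem exists_of_mem_regularOps (hq : q ≠ 0) (ht : t ≠ 0) {e : ℤ → ℤ} {b : Module.End K F}
    (hb : b ∈ regularOps (n := n) F hq ht e) : ∃ g : AffinePerm n →₀ F,
      b = normalSum F hq ht g ∧ ∀ x, g x ∈ regularAt F (expPoint n t e) := by
  induction hb using AddSubgroup.closure_induction with
  | mem b hb =>
    obtain ⟨x, g, hg, rfl⟩ := hb
    refine ⟨Finsupp.single x g, ?_, fun y => ?_⟩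
    · rw [normalSum, Finsupp.sum_single_index (by rw [map_zero, mul_zero])]
    · classical
      rw [Finsupp.single_apply]
      split_ifs
      · exact hg
      · exact zero_mem _
  | zero => exact ⟨0, rfl, fun x => zero_mem _⟩
  | add a b _ _ ha hb =>
    obtain ⟨g, rfl, h1⟩ := ha
    obtain ⟨g', rfl, h2⟩ := hb
    exact ⟨g + g', (normalSum_add hq ht g g').symm, fun x => add_mem (h1 x) (h2 x)⟩
  | neg a _ ha =>
    obtain ⟨g, rfl, h1⟩ := ha
    exact ⟨-g, (normalSum_neg hq ht g).symm, fun x => neg_mem (h1 x)⟩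

/-- Left multiplications can be checked on the elements `T_x g`. -/
theorem regularOps_induction (hq : q ≠ 0) (ht : t ≠ 0) {e e' : ℤ → ℤ} {b c d : Module.End K F}
    (hc : ∀ (x : AffinePerm n) (g : F), g ∈ regularAt F (expPoint n t e) →
      c * (rep F hq ht (Tw x) * mulOp F g) * d ∈ regularOps (n := n) F hq ht e')
    (hb : b ∈ regularOps (n := n) F hq ht e) : c * b * d ∈ regularOps (n := n) F hq ht e' := by
  induction hb using AddSubgroup.closure_induction with
  | mem b hb =>
    obtain ⟨x, g, hg, rfl⟩ := hb
    exact hc x g hg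
  | zero => rw [mul_zero, zero_mul]; exact zero_mem _
  | add a b _ _ ha hb => rw [mul_add, add_mul]; exact add_mem ha hb
  | neg a _ ha =>
    rw [show c * -a * d = -(c * a * d) from LinearMap.ext fun g => map_neg c (a (d g))]
    exact neg_mem ha

theorem Tw_mul_mem_regularOps (hq : q ≠ 0) (ht : t ≠ 0) {e : ℤ → ℤ} (x : AffinePerm n) {g : F}
    (hg : g ∈ regularAt F (expPoint n t e)) :
    rep F hq ht (Tw x) * mulOp F g ∈ regularOps (n := n) F hq ht e :=
  AddSubgroup.subset_closure ⟨x, g, hg, rfl⟩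

theorem regularOps_mul_mulOp (hq : q ≠ 0) (ht : t ≠ 0) {e : ℤ → ℤ} {b : Module.End K F}
    (hb : b ∈ regularOps (n := n) F hq ht e) {g : F} (hg : g ∈ regularAt F (expPoint n t e)) :
    b * mulOp F g ∈ regularOps (n := n) F hq ht e := by
  have h := regularOps_induction (c := 1) (d := mulOp F g) (e' := e) hq ht (fun x g' hg' => ?_) hb
  · rwa [one_mul] at h
  · rw [one_mul, mul_assoc, ← map_mul]
    exact Tw_mul_mem_regularOps hq ht x (mul_mem hg' hg)

theorem opT_mul_mem_regularOps (hq : q ≠ 0) (ht : t ≠ 0) {e : ℤ → ℤ} (i : SimpleIdx n)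
    {b : Module.End K F} (hb : b ∈ regularOps (n := n) F hq ht e) :
    opT F hq t i * b ∈ regularOps (n := n) F hq ht e := by
  have h := regularOps_induction (c := opT F hq t i) (d := 1) (e' := e) hq ht (fun x g hg => ?_) hb
  · rwa [mul_one] at h
  · rw [mul_one, ← mul_assoc, ← rep_genT hq ht, ← map_mul]
    by_cases hd : IsDescent i x
    · rw [genT_mul_Tw_of_isDescent ht hd, map_add, map_smul, add_mul, smul_mul_assoc,
        ← mul_smul_comm, ← map_smul, Algebra.smul_def]
      exact add_mem (Tw_mul_mem_regularOps hq ht _ (mul_mem (algebraMap_mem_regularAt _ _) hg))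
        (Tw_mul_mem_regularOps hq ht _ hg)
    · rw [genT_mul_Tw_of_not_isDescent hd]
      exact Tw_mul_mem_regularOps hq ht _ hg

theorem rep_Tw_mul_mem_regularOps (hq : q ≠ 0) (ht : t ≠ 0) {e : ℤ → ℤ} (x : AffinePerm n)
    {b : Module.End K F} (hb : b ∈ regularOps (n := n) F hq ht e) :
    rep F hq ht (Tw x) * b ∈ regularOps (n := n) F hq ht e := by
  rw [rep_Tw, wordOp]
  induction (redWord x).1 with
  | nil =>
    have h := regularOps_induction (c := permOp F hq (shift n ^ (redWord x).2)) (d := 1) (e' := e)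
      hq ht (fun y g hg => ?_) hb
    · rwa [mul_one] at h
    · rw [mul_one, ← rep_genPi_zpow hq ht, ← mul_assoc, ← map_mul, genPi_zpow_mul_Tw]
      exact Tw_mul_mem_regularOps hq ht _ hg
  | cons i l ih =>
    rw [List.map_cons, List.prod_cons, mul_assoc, mul_assoc]
    rw [mul_assoc] at ih
    exact opT_mul_mem_regularOps hq ht i ih

theorem Tw_one {S : Submonoid (MvPolynomial (Fin n) K)} : (Tw 1 : HeckeOver n q t S) = 1 := by
  have h1 : evalWord (([], 0) : List (SimpleIdx n) × ℤ) = 1 := by simp [evalWord]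
  have h : IsReduced (1 : AffinePerm n) (([], 0) : List (SimpleIdx n) × ℤ) :=
    ⟨h1, (Nat.le_zero.1 (len_le_length h1)).symm⟩
  rw [Tw_eq h]
  simp

theorem mulOp_mem_regularOps (hq : q ≠ 0) (ht : t ≠ 0) {e : ℤ → ℤ} {g : F}
    (hg : g ∈ regularAt F (expPoint n t e)) : mulOp F g ∈ regularOps (n := n) F hq ht e := by
  have h := Tw_mul_mem_regularOps hq ht (1 : AffinePerm n) hg
  rwa [Tw_one, map_one, one_mul] at h

/-- Composition: if `v` is regular at `e`, operators regular at the image of the point under `v`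
can be multiplied to it from the left. -/
theorem mul_permOp_mem_regularOps (hq : q ≠ 0) (hqt : q = t ^ (-2 : ℤ)) (ht : t ≠ 0) {e : ℤ → ℤ}
    (he : ∀ k, e (k + n) = e k + 1) {v : AffinePerm n} {b : Module.End K F}
    (hv : permOp F hq v ∈ regularOps (n := n) F hq ht e)
    (hb : b ∈ regularOps (n := n) F hq ht fun k => e (v⁻¹.1 k)) :
    b * permOp F hq v ∈ regularOps (n := n) F hq ht e := by
  have h := regularOps_induction (c := 1) (d := permOp F hq v) (e' := e) hq ht (fun x g hg => ?_) hb
  · rwa [one_mul] at h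
  · rw [one_mul, mul_assoc, mulOp_mul_permOp]
    exact rep_Tw_mul_mem_regularOps hq ht x
      (regularOps_mul_mulOp hq ht hv (ratAct_mem_regularAt hq hqt ht he _ hg))

theorem permOp_simple_eq (hq : q ≠ 0) (ht : t ≠ 0) {i : SimpleIdx n} {k : ℤ}
    (hk : (k : ZMod n) = i.1) :
    permOp F hq (simple i) = (opT F hq t i * mulOp F (Yrat n F q k - Yrat n F q (k + 1)) +
      mulOp F ((algebraMap K _ t - algebraMap K _ t⁻¹) * Yrat n F q (k + 1))) *
        mulOp F (frat n F q t k (k + 1))⁻¹ := by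
  rw [opT_mul_sub hq hk, mul_assoc, ← map_mul,
    mul_inv_cancel₀ (frat_ne_zero hq ht (ne_succ i hk)), map_one, mul_one]

theorem numerator_mem_regularOps (hq : q ≠ 0) (ht : t ≠ 0) (e : ℤ → ℤ) (i : SimpleIdx n) (k : ℤ) :
    opT F hq t i * mulOp F (Yrat n F q k - Yrat n F q (k + 1)) +
      mulOp F ((algebraMap K _ t - algebraMap K _ t⁻¹) * Yrat n F q (k + 1)) ∈
        regularOps (n := n) F hq ht e := by
  refine add_mem (opT_mul_mem_regularOps hq ht i (mulOp_mem_regularOps hq ht ?_))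
    (mulOp_mem_regularOps hq ht ?_)
  · exact sub_mem (Yrat_mem_regularAt _ _) (Yrat_mem_regularAt _ _)
  · exact mul_mem (sub_mem (algebraMap_mem_regularAt _ _) (algebraMap_mem_regularAt _ _))
      (Yrat_mem_regularAt _ _)

theorem permOp_simple_mem_regularOps (hq : q ≠ 0) (hqt : q = t ^ (-2 : ℤ)) (ht : t ≠ 0)
    (ht' : ∀ m : ℤ, t ^ m = 1 → m = 0)
    {e : ℤ → ℤ} (he : ∀ k, e (k + n) = e k + 1) {i : SimpleIdx n} {k : ℤ} (hk : (k : ZMod n) = i.1)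
    (h : e (k + 1) ≠ e k + 1) :
    permOp F hq (simple i) ∈ regularOps (n := n) F hq ht e := by
  rw [permOp_simple_eq hq ht hk]
  exact regularOps_mul_mulOp hq ht (numerator_mem_regularOps hq ht e i k)
    (inv_frat_mem_regularAt hqt ht ht' he h)

/-- At a point fixed by `s_i`, the operator `(1 - s_i) (Y_i - Y_{i+1})⁻¹` is regular, and can be
multiplied from the right to every regular operator. -/
theorem mul_one_sub_simple_mem_regularOps (hq : q ≠ 0) (hqt : q = t ^ (-2 : ℤ)) (ht : t ≠ 0)
    (ht' : ∀ m : ℤ, t ^ m = 1 → m = 0)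
    {e : ℤ → ℤ} (he : ∀ k, e (k + n) = e k + 1) {i : SimpleIdx n} {k : ℤ} (hk : (k : ZMod n) = i.1)
    (h : e (k + 1) = e k) {b : Module.End K F} (hb : b ∈ regularOps (n := n) F hq ht e) :
    b * ((1 - permOp F hq (simple i)) * mulOp F (Yrat n F q k - Yrat n F q (k + 1))⁻¹) ∈
      regularOps (n := n) F hq ht e := by
  have hei : (fun m => e ((simple i).1 m)) = e := by
    funext m
    rw [simple_apply]
    by_cases h1 : (m : ZMod n) = i.1
    · obtain ⟨j, rfl⟩ := (intCast_eq_iff_exists k m).1 (hk.trans h1.symm)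
      rw [simpleFun_left h1, add_right_comm, quasi_add_mul he, quasi_add_mul he, h]
    · by_cases h2 : (m : ZMod n) = i.1 + 1
      · obtain ⟨j, rfl⟩ := (intCast_eq_iff_exists (n := n) (k + 1) m).1 (by
          push_cast; rw [hk, h2])
        rw [add_right_comm, simpleFun_right (by simp [hk]), add_right_comm, quasi_add_mul he,
          quasi_add_mul he, h]
      · rw [simpleFun_other h1 h2]
  set y := Yrat n F q k - Yrat n F q (k + 1) with hy
  have hy0 : y ≠ 0 := Yrat_sub_ne_zero hq (ne_succ i hk)
  have hf0 : frat n F q t k (k + 1) ≠ 0 := frat_ne_zero hq ht (ne_succ i hk)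
  -- The operator is `(t - T_i) f_{i,i+1}⁻¹`.
  have key : (1 - permOp F hq (simple i)) * mulOp F y⁻¹ =
      mulOp F (algebraMap K F t * (frat n F q t k (k + 1))⁻¹) -
        opT F hq t i * mulOp F (frat n F q t k (k + 1))⁻¹ := by
    rw [permOp_simple_eq hq ht hk, ← hy, sub_mul, one_mul, mul_assoc, ← map_mul, add_mul, mul_assoc,
      ← map_mul, ← map_mul, ← sub_sub, sub_right_comm, ← map_sub]
    congr 3
    · have hf : frat n F q t k (k + 1) - (algebraMap K F t - algebraMap K F t⁻¹) *
          Yrat n F q (k + 1) = algebraMap K F t * y := by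
        rw [frat, hy]
        ring
      generalize algebraMap K F t⁻¹ = c at hf ⊢
      field_simp
      linear_combination hf
    · field_simp
  have h1 := regularOps_induction (c := 1) (e' := e)
    (d := (1 - permOp F hq (simple i)) * mulOp F y⁻¹) hq ht (fun x g hg => ?_) hb
  · rwa [one_mul] at h1
  · rw [one_mul, mul_assoc]
    refine rep_Tw_mul_mem_regularOps hq ht x ?_
    have hsg : ratAct F hq (simple i) g ∈ regularAt F (expPoint n t e) :=
      ratAct_mem_regularAt hq hqt ht he _ (by rwa [hei])
    have h2 : mulOp F g * ((1 - permOp F hq (simple i)) * mulOp F y⁻¹) =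
        mulOp F ((g - ratAct F hq (simple i) g) * y⁻¹) +
          (1 - permOp F hq (simple i)) * mulOp F y⁻¹ * mulOp F (ratAct F hq (simple i) g) := by
      rw [← mul_assoc, mul_sub, mul_one, mulOp_mul_permOp, inv_simple, sub_mul, mul_assoc,
        sub_mul, sub_mul, one_mul, map_sub, sub_mul, mul_assoc, ← map_mul, ← map_mul, ← map_mul,
        mul_comm y⁻¹]
      abel
    rw [h2, key]
    refine add_mem (mulOp_mem_regularOps hq ht
      (sub_ratAct_div_mem_regularAt hq hqt ht he hk hei hg)) ?_
    have hf : (frat n F q t k (k + 1))⁻¹ ∈ regularAt F (expPoint n t e) :=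
      inv_frat_mem_regularAt hqt ht ht' he (by omega)
    refine regularOps_mul_mulOp hq ht (sub_mem (mulOp_mem_regularOps hq ht ?_)
      (opT_mul_mem_regularOps hq ht i (mulOp_mem_regularOps hq ht hf))) hsg
    exact mul_mem (algebraMap_mem_regularAt _ _) hf

end Regular

end QDaha

namespace QDaha

open MvPolynomial

/-! ### Conjugates of finite reflections -/

section Cycle

variable {n : ℕ} (h1 : (1 : ZMod n) ≠ 0)

/-- The label of `s_a`, for an integer `a`. -/
def intIdx (a : ℤ) : SimpleIdx n := ⟨a, by simpa using h1⟩

/-- The affine permutation `s_a s_{a+1} ⋯ s_{a+m-1}`. For `m < n` it maps `a + m` to `a` and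
`a + l` to `a + l + 1` for `0 ≤ l < m`. -/
def up : ℤ → ℕ → AffinePerm n
  | _, 0 => 1
  | a, m + 1 => simple (intIdx h1 a) * up (a + 1) m

theorem up_succ_apply (a : ℤ) (m : ℕ) (k : ℤ) :
    (up h1 a (m + 1)).1 k = simpleFun (intIdx h1 a) ((up h1 (a + 1) m).1 k) := rfl

theorem simpleFun_intIdx_add {d : ℕ} (a : ℤ) (hd : 2 ≤ d) (hd' : d < n) :
    simpleFun (intIdx h1 a) (a + d) = a + d := by
  refine simpleFun_other (fun h => ?_) (fun h => ?_)
  · obtain ⟨m, hm⟩ := (intCast_eq_iff_exists a (a + d)).1 h.symm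
    have hd3 : (d : ℤ) = m * n := by linarith
    rcases le_or_gt m 0 with h0 | h0 <;> nlinarith
  · obtain ⟨m, hm⟩ := (intCast_eq_iff_exists (n := n) (a + 1) (a + d)).1 (by
      rw [h]; push_cast; rfl)
    have hd3 : (d : ℤ) = m * n + 1 := by linarith
    rcases le_or_gt m 0 with h0 | h0 <;> nlinarith

theorem up_apply_top (a : ℤ) (m : ℕ) : (up h1 a m).1 (a + m) = a := by
  induction m generalizing a with
  | zero => simp [up]
  | succ m ih =>
    rw [up_succ_apply, show a + ((m + 1 : ℕ) : ℤ) = a + 1 + m by push_cast; ring, ih]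
    rw [simpleFun_right (by simp [intIdx])]

theorem up_apply_of_lt (a : ℤ) {m d : ℕ} (hd : m < d) (hd' : d < n) :
    (up h1 a m).1 (a + d) = a + d := by
  induction m generalizing a d with
  | zero => rfl
  | succ m ih =>
    obtain ⟨d, rfl⟩ := Nat.exists_eq_succ_of_ne_zero (show d ≠ 0 by omega)
    rw [up_succ_apply, show a + (d.succ : ℤ) = a + 1 + d by push_cast; ring,
      ih (a + 1) (by omega) (by omega), show a + 1 + d = a + (d.succ : ℤ) by push_cast; ring,
      simpleFun_intIdx_add h1 a (by omega) hd']

theorem up_apply_pred (a : ℤ) {m : ℕ} (hm : m + 1 < n) : (up h1 (a + 1) m).1 a = a := by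
  have h := up_apply_of_lt h1 (a + 1) (show m < n - 1 by omega) (by omega)
  rw [show a + 1 + ((n - 1 : ℕ) : ℤ) = a + n by push_cast [show 1 ≤ n by omega]; ring,
    affine_add] at h
  linarith

theorem up_apply_add (a : ℤ) {m l : ℕ} (hl : l < m) (hm : m < n) :
    (up h1 a m).1 (a + l) = a + l + 1 := by
  induction m generalizing a l with
  | zero => omega
  | succ m ih =>
    rw [up_succ_apply]
    cases l with
    | zero =>
      rw [Nat.cast_zero, add_zero, up_apply_pred h1 a hm, simpleFun_left (by simp [intIdx])]
    | succ l =>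
      rw [show a + ((l + 1 : ℕ) : ℤ) = a + 1 + l by push_cast; ring,
        ih (a + 1) (by omega) (by omega), show a + 1 + l + 1 = a + (l + 2 : ℕ) by push_cast; ring,
        simpleFun_intIdx_add h1 a (by omega) (by omega)]

theorem up_inv_top (a : ℤ) (m : ℕ) : (up h1 a m)⁻¹.1 a = a + m := by
  have h := inv_apply_self (up h1 a m) (a + m)
  rwa [up_apply_top] at h

theorem up_inv_pred (a : ℤ) {m : ℕ} (hm : m + 1 < n) : (up h1 (a + 1) m)⁻¹.1 a = a := by
  have h := inv_apply_self (up h1 (a + 1) m) a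
  rwa [up_apply_pred h1 a hm] at h

end Cycle

section NoPoles

variable {K : Type*} [Field K] {n : ℕ} [NeZero n] {q t : K}
  {F : Type*} [Field F] [Algebra K F] [Algebra (MvPolynomial (Fin n) K) F]
  [IsScalarTower K (MvPolynomial (Fin n) K) F] [IsFractionRing (MvPolynomial (Fin n) K) F]

/-- The poles of `s_{a+m-1} ⋯ s_a` lie on the divisors of `f_{a,a+l}` with `0 < l ≤ m`. -/
theorem permOp_up_inv_mem_regularOps (hq : q ≠ 0) (hqt : q = t ^ (-2 : ℤ)) (ht : t ≠ 0)
    (ht' : ∀ m : ℤ, t ^ m = 1 → m = 0) (h1 : (1 : ZMod n) ≠ 0) {e : ℤ → ℤ}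
    (he : ∀ k, e (k + n) = e k + 1) {a : ℤ} {m : ℕ} (hm : m < n)
    (h : ∀ l : ℕ, l < m → e (a + l + 1) ≠ e a + 1) :
    permOp F hq (up h1 a m)⁻¹ ∈ regularOps (n := n) F hq ht e := by
  induction m generalizing a e with
  | zero =>
    rw [up, inv_one, map_one, ← map_one (mulOp F)]
    exact mulOp_mem_regularOps hq ht (one_mem _)
  | succ m ih =>
    rw [up, mul_inv_rev, inv_simple, map_mul]
    have h0 := h 0 (by omega)
    rw [Nat.cast_zero, add_zero] at h0
    refine mul_permOp_mem_regularOps hq hqt ht he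
      (permOp_simple_mem_regularOps hq hqt ht ht' he (k := a) rfl h0) ?_
    refine ih (quasi_comp he _) (by omega) fun l hl => ?_
    have ha : simpleFun (intIdx h1 a) (a + 1) = a := simpleFun_right rfl
    rw [inv_simple, simple_apply, simple_apply, ha,
      show a + 1 + l + 1 = a + (l + 2 : ℕ) by push_cast; ring,
      simpleFun_intIdx_add h1 a (by omega) (by omega)]
    have := h (l + 1) (by omega)
    rwa [show a + ((l + 1 : ℕ) : ℤ) + 1 = a + (l + 2 : ℕ) by push_cast; ring] at this

/-- The poles of `s_a ⋯ s_{a+m-1}` lie on the divisors of `f_{a+l,a+m}` with `0 ≤ l < m`. -/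
theorem permOp_up_mem_regularOps (hq : q ≠ 0) (hqt : q = t ^ (-2 : ℤ)) (ht : t ≠ 0)
    (ht' : ∀ m : ℤ, t ^ m = 1 → m = 0) (h1 : (1 : ZMod n) ≠ 0) {e : ℤ → ℤ}
    (he : ∀ k, e (k + n) = e k + 1) {a : ℤ} {m : ℕ} (hm : m < n)
    (h : ∀ l : ℕ, l < m → e (a + m) ≠ e (a + l) + 1) :
    permOp F hq (up h1 a m) ∈ regularOps (n := n) F hq ht e := by
  induction m generalizing a with
  | zero =>
    rw [up, map_one, ← map_one (mulOp F)]
    exact mulOp_mem_regularOps hq ht (one_mem _)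
  | succ m ih =>
    rw [up, map_mul]
    refine mul_permOp_mem_regularOps hq hqt ht he (ih (by omega) fun l hl => ?_)
      (permOp_simple_mem_regularOps hq hqt ht ht' (quasi_comp he _) (k := a) rfl ?_)
    · have := h (l + 1) (by omega)
      push_cast at this
      rwa [← add_assoc, ← add_assoc, add_right_comm, add_right_comm a (l : ℤ)] at this
    · have := h 0 (by omega)
      rw [up_inv_top, up_inv_pred h1 a hm]
      push_cast at this
      rwa [← add_assoc, add_right_comm, add_zero] at this

/-- The only pole of `s_c (s_{c+1} ⋯ s_{c+n-2})` comes from its leftmost factor `s_c`, and is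
simple. It lies on the wall of `s_{c+n-1}`. -/
theorem permOp_up_eq (hq : q ≠ 0) (hqt : q = t ^ (-2 : ℤ)) (ht : t ≠ 0) (h1 : (1 : ZMod n) ≠ 0)
    (c : ℤ) {m : ℕ} (hm : m + 2 = n) :
    permOp F hq (up h1 c (m + 1)) =
      (opT F hq t (intIdx h1 c) * mulOp F (Yrat n F q c - Yrat n F q (c + 1)) +
        mulOp F ((algebraMap K _ t - algebraMap K _ t⁻¹) * Yrat n F q (c + 1))) *
      permOp F hq (up h1 (c + 1) m) * mulOp F (algebraMap K F (-t)) *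
      mulOp F (Yrat n F q (c + (m + 1)) - Yrat n F q (c + (m + 1) + 1))⁻¹ := by
  rw [up, map_mul, permOp_simple_eq hq ht (k := c) rfl, mul_assoc, mulOp_mul_permOp, mul_assoc,
    mul_assoc, ← map_mul]
  congr 3
  have ht0 : algebraMap K F t ≠ 0 := (map_ne_zero _).2 ht
  rw [map_inv₀, ratAct_frat, up_inv_pred h1 c (by omega), up_inv_top, frat,
    show c + (m + 1 : ℤ) + 1 = c + 1 * n by rw [← hm]; push_cast; ring, Yrat_add_mul hq,
    show c + 1 + (m : ℤ) = c + (m + 1) by ring, hqt]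
  generalize Yrat n F (t ^ (-2 : ℤ)) c = x
  generalize Yrat n F (t ^ (-2 : ℤ)) (c + (m + 1)) = z
  rw [← zpow_mul, show (-2 : ℤ) * -1 = (2 : ℕ) by norm_num, zpow_natCast, map_pow, map_neg, map_inv₀]
  rw [show algebraMap K F t * x - (algebraMap K F t)⁻¹ * z =
    (-algebraMap K F t)⁻¹ * (z - algebraMap K F t ^ 2 * x) by field_simp; ring, mul_inv, inv_inv]

/-- The two poles met in passing from `v` to `v s_j`, with `v = s_c ⋯ s_{c+n-2}`, cancel in the sum
`v + v s_j`, because `(Y_j - Y_{j+1})⁻¹ (1 + s_j) = (1 - s_j) (Y_j - Y_{j+1})⁻¹` is regular. -/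
theorem permOp_conj_mem_regularOps (hq : q ≠ 0) (hqt : q = t ^ (-2 : ℤ)) (ht : t ≠ 0)
    (ht' : ∀ m : ℤ, t ^ m = 1 → m = 0) (h1 : (1 : ZMod n) ≠ 0) {e : ℤ → ℤ}
    (he : ∀ k, e (k + n) = e k + 1) {c : ℤ} {m : ℕ} (hm : m + 2 = n)
    (hc : e (c + 1) + 1 = e c) (hc1 : ∀ l : ℕ, l < m + 1 → e (c + l + 1) ≠ e c + 1)
    (hc2 : ∀ l : ℕ, l < m → e c ≠ e (c + l + 2) + 1) :
    permOp F hq (up h1 c (m + 1) * simple (intIdx h1 (c + (m + 1))) * (up h1 c (m + 1))⁻¹) ∈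
      regularOps (n := n) F hq ht e := by
  set v := up h1 c (m + 1) with hv
  set j := c + ((m : ℤ) + 1) with hj
  set y := Yrat n F q j - Yrat n F q (j + 1) with hy
  have hvj : v.1 j = c := by
    have := up_apply_top h1 c (m + 1)
    rwa [Nat.cast_add, Nat.cast_one] at this
  have hvl : ∀ l : ℕ, l < m + 1 → v.1 (c + l) = c + l + 1 :=
    fun l hl => up_apply_add h1 c hl (by omega)
  have hvj1 : v.1 (j + 1) = c + 1 + n := by
    have h := hvl 0 (by omega)
    rw [Nat.cast_zero, add_zero] at h
    rw [← h, ← affine_add]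
    congr 1
    rw [hj]
    omega
  have he' : ∀ k, e (v.1 (k + n)) = e (v.1 k) + 1 := quasi_comp he v
  have hE := permOp_up_eq (F := F) hq hqt ht h1 c hm
  rw [← hv, ← hj, ← hy] at hE
  set E := (opT F hq t (intIdx h1 c) * mulOp F (Yrat n F q c - Yrat n F q (c + 1)) +
        mulOp F ((algebraMap K _ t - algebraMap K _ t⁻¹) * Yrat n F q (c + 1))) *
      permOp F hq (up h1 (c + 1) m) * mulOp F (algebraMap K F (-t)) with hEdef
  have hE1 : E ∈ regularOps (n := n) F hq ht fun k => e (v.1 k) := by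
    refine regularOps_mul_mulOp hq ht (mul_permOp_mem_regularOps hq hqt ht he'
      (permOp_up_mem_regularOps hq hqt ht ht' h1 he' (by omega) fun l hl => ?_)
      (numerator_mem_regularOps hq ht _ _ c)) (algebraMap_mem_regularAt _ _)
    have h2 := hvl (l + 1) (by omega)
    rw [show c + 1 + (m : ℤ) = j by rw [hj]; ring, hvj,
      show c + 1 + (l : ℤ) = c + (l + 1 : ℕ) by push_cast; ring, h2]
    have := hc2 l hl
    push_cast
    rwa [show c + ((l : ℤ) + 1) + 1 = c + l + 2 by ring]
  have hL : permOp F hq v * (1 + permOp F hq (simple (intIdx h1 j))) ∈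
      regularOps (n := n) F hq ht fun k => e (v.1 k) := by
    have h3 := mul_one_sub_simple_mem_regularOps hq hqt ht ht' he'
      (i := intIdx h1 j) (k := j) rfl (by rw [hvj1, hvj, he, hc]) hE1
    have hsy : ratAct F hq (simple (intIdx h1 j)) y = -y := by
      rw [hy, map_sub, ratAct_simple_left hq rfl, ratAct_simple_right hq rfl, neg_sub]
    have h4 : mulOp F y⁻¹ * (1 + permOp F hq (simple (intIdx h1 j))) =
        (1 - permOp F hq (simple (intIdx h1 j))) * mulOp F y⁻¹ := by
      rw [mul_add, mul_one, mulOp_mul_permOp, inv_simple, map_inv₀ (ratAct F hq _), hsy, inv_neg,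
        ← zero_sub, map_sub, map_zero, mul_sub, mul_zero, sub_mul, one_mul, ← add_sub_assoc, add_zero]
    rw [hE, mul_assoc, h4]
    exact h3
  have hR : permOp F hq v⁻¹ ∈ regularOps (n := n) F hq ht e :=
    permOp_up_inv_mem_regularOps hq hqt ht ht' h1 he (by omega) hc1
  have h5 := mul_permOp_mem_regularOps hq hqt ht he hR (b := _)
    (by simpa only [inv_inv] using hL)
  have h6 : permOp F hq (v * simple (intIdx h1 j) * v⁻¹) =
      permOp F hq v * (1 + permOp F hq (simple (intIdx h1 j))) * permOp F hq v⁻¹ - 1 := by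
    rw [mul_add, mul_one, add_mul, ← map_mul, ← map_mul, ← map_mul, mul_inv_cancel, map_one,
      add_sub_cancel_left]
  rw [h6]
  refine sub_mem h5 ?_
  rw [← map_one (mulOp F)]
  exact mulOp_mem_regularOps hq ht (one_mem _)

end NoPoles

/-! ### The point `t^{-2ρ}` -/

section Rho

variable {n : ℕ} [NeZero n]

theorem gamma_apply (k : ℤ) : (gamma n).1 k = k + n * -((resid n k : ℕ) : ℤ) := rfl

theorem gamma_apply_of_mem {k : ℤ} (h0 : 1 ≤ k) (h1 : k ≤ n) :
    (gamma n).1 k = k + n * (1 - k) := by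
  have h : ((resid n k : ℕ) : ℤ) = k - 1 := by
    rw [resid, Int.toNat_of_nonneg (Int.emod_nonneg _ (by exact_mod_cast NeZero.ne n))]
    exact Int.emod_eq_of_lt (by omega) (by omega)
  rw [gamma_apply, h]
  ring

/-- The exponents of the point `t^{-2ρ}`: `e_i = 1 - i` for `1 ≤ i ≤ n`. -/
def rhoExp (n : ℕ) [NeZero n] (k : ℤ) : ℤ := ((gamma n).1 k - 1) / n

theorem rhoExp_add (k : ℤ) : rhoExp n (k + n) = rhoExp n k + 1 := by
  have hn := cast_pos (n := n)
  rw [rhoExp, affine_add, rhoExp, add_sub_right_comm, Int.add_ediv_of_dvd_right (dvd_refl _),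
    Int.ediv_self hn.ne']

theorem rhoExp_of_mem {k : ℤ} (h0 : 1 ≤ k) (h1 : k ≤ n) : rhoExp n k = 1 - k := by
  have hn := cast_pos (n := n)
  rw [rhoExp, gamma_apply_of_mem h0 h1, add_sub_right_comm, Int.add_mul_ediv_left _ _ hn.ne',
    Int.ediv_eq_zero_of_lt (by omega) (by omega), zero_add]

theorem rhoExp_add_of_mem {k : ℤ} (h0 : n + 1 ≤ k) (h1 : k ≤ 2 * n) : rhoExp n k = n + 2 - k := by
  have h := rhoExp_add (n := n) (k - n)
  rw [sub_add_cancel, rhoExp_of_mem (k := k - n) (by omega) (by omega)] at h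
  rw [h]
  ring

theorem expPoint_rhoExp {K : Type*} [Field K] (t : K) : expPoint n t (rhoExp n) = tRho n t := by
  funext r
  rw [expPoint, tRho, rhoExp_of_mem (by omega) (by omega)]
  congr 1
  ring

theorem rhoExp_conj {w : AffinePerm n} (hw : w ∈ finSymm n) (k : ℤ) :
    rhoExp n (((gamma n)⁻¹ * w * gamma n).1 k) = rhoExp n k := by
  have h : (gamma n).1 (((gamma n)⁻¹ * w * gamma n).1 k) = w.1 ((gamma n).1 k) :=
    apply_inv_self (gamma n) _
  rw [rhoExp, h, rhoExp]
  exact hw _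

theorem simple_mem_finSymm {i : SimpleIdx n} {k : ℤ} (hk : (k : ZMod n) = i.1) (h0 : 1 ≤ k)
    (h1 : k < n) : simple i ∈ finSymm n := by
  have hn := cast_pos (n := n)
  intro m
  rw [simple_apply]
  by_cases h : (m : ZMod n) = i.1
  · obtain ⟨j, rfl⟩ := (intCast_eq_iff_exists k m).1 (hk.trans h.symm)
    rw [simpleFun_left h, add_sub_cancel_right, add_sub_right_comm, Int.add_mul_ediv_right _ _ hn.ne',
      Int.add_mul_ediv_right _ _ hn.ne', Int.ediv_eq_zero_of_lt (by omega) (by omega),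
      Int.ediv_eq_zero_of_lt (by omega) (by omega)]
  · by_cases h2 : (m : ZMod n) = i.1 + 1
    · obtain ⟨j, rfl⟩ := (intCast_eq_iff_exists (n := n) (k + 1) m).1 (by
        push_cast; rw [hk, h2])
      have hs : simpleFun i (k + 1 + j * n) = k + j * n := by
        rw [add_right_comm]
        exact simpleFun_right (by simp [hk])
      rw [hs, add_sub_right_comm,
        show k + 1 + j * n - 1 = k + j * n by ring, Int.add_mul_ediv_right _ _ hn.ne',
        Int.add_mul_ediv_right _ _ hn.ne', Int.ediv_eq_zero_of_lt (by omega) (by omega),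
        Int.ediv_eq_zero_of_lt (by omega) (by omega)]
    · rw [simpleFun_other h h2]

theorem exists_rep_mem (i : ZMod n) : ∃ k : ℤ, (k : ZMod n) = i ∧ 1 ≤ k ∧ k ≤ n := by
  have hn := cast_pos (n := n)
  refine ⟨((i.cast : ℤ) - 1) % n + 1, ?_, ?_, ?_⟩
  · rw [Int.emod_def]
    simp
  · have := Int.emod_nonneg ((i.cast : ℤ) - 1) hn.ne'
    omega
  · have := Int.emod_lt_of_pos ((i.cast : ℤ) - 1) hn
    omega

/-- A left descent of a finite permutation is a finite simple reflection. -/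
theorem exists_rep_lt_of_isDescent {w : AffinePerm n} (hw : w ∈ finSymm n) {i : SimpleIdx n}
    (hd : IsDescent i w) : ∃ k : ℤ, (k : ZMod n) = i.1 ∧ 1 ≤ k ∧ k < n := by
  obtain ⟨k, hk, h0, h1⟩ := exists_rep_mem i.1
  refine ⟨k, hk, h0, lt_of_le_of_ne h1 ?_⟩
  rintro rfl
  have hn := cast_pos (n := n)
  rw [isDescent_iff hk] at hd
  have h2 := inv_mem hw (n : ℤ)
  have h3 := inv_mem hw ((n : ℤ) + 1)
  rw [add_sub_cancel_right, Int.ediv_self hn.ne'] at h3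
  rw [Int.ediv_eq_zero_of_lt (a := (n : ℤ) - 1) (by omega) (by omega)] at h2
  have h4 : (w⁻¹.1 ((n : ℤ) + 1) - 1) / n ≤ (w⁻¹.1 (n : ℤ) - 1) / n :=
    Int.ediv_le_ediv hn (by omega)
  omega

theorem eq_one_of_shift_zpow_mem {k : ℤ} (h : shift n ^ k ∈ finSymm n) : shift n ^ k = 1 := by
  have hn := cast_pos (n := n)
  have h1 := h 1
  have h2 := h n
  rw [shift_zpow_apply] at h1 h2
  rw [sub_self, Int.zero_ediv, add_sub_cancel_left] at h1
  rw [Int.ediv_eq_zero_of_lt (a := (n : ℤ) - 1) (by omega) (by omega)] at h2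
  have h4 : 0 ≤ k := by
    by_contra hk
    have := Int.ediv_neg_of_neg_of_pos (show k < 0 by omega) hn
    omega
  have h5 : (n : ℤ) + k - 1 < n := by
    by_contra hk
    have := (Int.le_ediv_iff_mul_le (a := 1) (b := (n : ℤ) + k - 1) hn).2 (by omega)
    omega
  rw [show k = 0 by omega, zpow_zero]

/-- With `v = s_k ⋯ s_{k+n-2}` and `j = k + n - 1`, both sides are conjugates of simple reflections,
and they agree because `γ v` carries `j, j + 1` to adjacent integers congruent to `k, k + 1`. -/
theorem conj_simple_eq (h1 : (1 : ZMod n) ≠ 0) {m : ℕ} (hm : m + 2 = n) {i : SimpleIdx n} {k : ℤ}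
    (hk : (k : ZMod n) = i.1) (h0 : 1 ≤ k) (hkn : k < n) :
    (gamma n)⁻¹ * simple i * gamma n =
      up h1 k (m + 1) * simple (intIdx h1 (k + (m + 1))) * (up h1 k (m + 1))⁻¹ := by
  have hu := up_apply_top h1 k (m + 1)
  rw [Nat.cast_add, Nat.cast_one] at hu
  have hu1 := up_apply_add h1 k (m := m + 1) (l := 0) (by omega) (by omega)
  rw [Nat.cast_zero, add_zero] at hu1
  have hu2 : (up h1 k (m + 1)).1 (k + (m + 1) + 1) = k + 1 + n := by
    rw [← hu1, ← affine_add]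
    congr 1
    omega
  have h : simple i * (gamma n * up h1 k (m + 1)) =
      gamma n * up h1 k (m + 1) * simple (intIdx h1 (k + (m + 1))) := by
    refine simple_mul_eq_mul_simple (c := k + (m + 1)) (k := k + n * (1 - k)) rfl (by simp [hk])
      ?_ ?_
    · change (gamma n).1 ((up h1 k (m + 1)).1 _) = _
      rw [hu, gamma_apply_of_mem h0 (by omega)]
    · change (gamma n).1 ((up h1 k (m + 1)).1 _) = _
      rw [hu2, affine_add, gamma_apply_of_mem (by omega) (by omega)]
      ring
  rw [eq_mul_inv_iff_mul_eq, mul_assoc, mul_assoc, inv_mul_eq_iff_eq_mul, h, mul_assoc]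

end Rho

section NoPolesRho

variable {K : Type*} [Field K] {n : ℕ} [NeZero n] {q t : K}
  {F : Type*} [Field F] [Algebra K F] [Algebra (MvPolynomial (Fin n) K) F]
  [IsScalarTower K (MvPolynomial (Fin n) K) F] [IsFractionRing (MvPolynomial (Fin n) K) F]

theorem permOp_conj_simple_mem_regularOps (hq : q ≠ 0) (hqt : q = t ^ (-2 : ℤ)) (ht : t ≠ 0)
    (ht' : ∀ m : ℤ, t ^ m = 1 → m = 0) {i : SimpleIdx n} {k : ℤ}
    (hk : (k : ZMod n) = i.1) (h0 : 1 ≤ k) (hkn : k < n) :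
    permOp F hq ((gamma n)⁻¹ * simple i * gamma n) ∈ regularOps (n := n) F hq ht (rhoExp n) := by
  obtain ⟨m, hm⟩ : ∃ m : ℕ, m + 2 = n := ⟨n - 2, by omega⟩
  have h1 : (1 : ZMod n) ≠ 0 := by simpa using i.2
  rw [conj_simple_eq h1 hm hk h0 hkn]
  have hek : rhoExp n k = 1 - k := rhoExp_of_mem h0 (by omega)
  refine permOp_conj_mem_regularOps hq hqt ht ht' h1 rhoExp_add hm ?_ (fun l hl => ?_)
    (fun l hl => ?_)
  · rw [hek, rhoExp_of_mem (by omega) (by omega)]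
    ring
  · rcases le_or_gt (k + l + 1) n with h | h
    · rw [hek, rhoExp_of_mem (by omega) h]
      omega
    · rw [hek, rhoExp_add_of_mem (by omega) (by omega)]
      omega
  · rcases le_or_gt (k + l + 2) n with h | h
    · rw [hek, rhoExp_of_mem (by omega) h]
      omega
    · rw [hek, rhoExp_add_of_mem (by omega) (by omega)]
      omega

/-- For `w` in the finite symmetric group, `γ⁻¹ w γ` is regular at `t^{-2ρ}`. -/
theorem permOp_conj_mem_regularOps_rho (hq : q ≠ 0) (hqt : q = t ^ (-2 : ℤ)) (ht : t ≠ 0)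
    (ht' : ∀ m : ℤ, t ^ m = 1 → m = 0) {w : AffinePerm n} (hw : w ∈ finSymm n) :
    permOp F hq ((gamma n)⁻¹ * w * gamma n) ∈ regularOps (n := n) F hq ht (rhoExp n) := by
  obtain ⟨⟨l, k⟩, hl⟩ := exists_reduced w
  induction l generalizing w with
  | nil =>
    have h : shift n ^ k = w := by simpa [evalWord] using hl.1
    rw [← h] at hw ⊢
    rw [eq_one_of_shift_zpow_mem hw, mul_one, inv_mul_cancel, map_one, ← map_one (mulOp F)]
    exact mulOp_mem_regularOps hq ht (one_mem _)
  | cons i l ih =>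
    rw [isReduced_cons] at hl
    obtain ⟨c, hc, h0, h1⟩ := exists_rep_lt_of_isDescent hw hl.1
    have hs := simple_mem_finSymm hc h0 h1
    have hsw := mul_mem hs hw
    have h2 : (gamma n)⁻¹ * w * gamma n =
        (gamma n)⁻¹ * simple i * gamma n * ((gamma n)⁻¹ * (simple i * w) * gamma n) := by
      conv_lhs => rw [← simple_mul_cancel i w]
      group
    rw [h2, map_mul]
    refine mul_permOp_mem_regularOps hq hqt ht rhoExp_add (ih hsw hl.2) ?_
    have h3 : (fun k => rhoExp n (((gamma n)⁻¹ * (simple i * w) * gamma n)⁻¹.1 k)) = rhoExp n := by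
      funext k
      rw [← rhoExp_conj hsw, apply_inv_self]
    rw [h3]
    exact permOp_conj_simple_mem_regularOps hq hqt ht ht' hc h0 h1

end NoPolesRho

end QDaha

namespace QDaha

open MvPolynomial

/-! ### The leading coefficient at `t^{-2ρ}` -/

section Level

variable {n : ℕ} [NeZero n]

/-- The elements of the level set `rhoExp = 0`, in increasing order. -/
def levelPt (n : ℕ) (r : Fin n) : ℤ := (r : ℕ) * (n + 1) + 1

theorem eq_levelPt_add (k : ℤ) : k = levelPt n (resid n k) + rhoExp n k * n := by
  have hn := cast_pos (n := n)
  have h := eq_resid_add (n := n) k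
  have h1 : rhoExp n k = (k - 1) / n - (resid n k : ℕ) := by
    rw [rhoExp, gamma_apply, add_sub_right_comm, Int.add_mul_ediv_left _ _ hn.ne']
    ring
  rw [h1, levelPt]
  linear_combination h

theorem resid_levelPt (r : Fin n) : resid n (levelPt n r) = r := by
  have h : resid n (levelPt n r) = resid n ((r : ℕ) + 1 : ℤ) := by
    rw [resid_eq_iff, levelPt]
    push_cast
    simp
  rw [h, resid_val_add_one]

theorem rhoExp_levelPt (r : Fin n) : rhoExp n (levelPt n r) = 0 := by
  have h := eq_levelPt_add (n := n) (levelPt n r)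
  rw [resid_levelPt] at h
  have hn := cast_pos (n := n)
  have h1 : rhoExp n (levelPt n r) * n = 0 := by linarith
  exact (mul_eq_zero.1 h1).resolve_right hn.ne'

theorem rhoExp_add_mul (k m : ℤ) : rhoExp n (k + m * n) = rhoExp n k + m :=
  quasi_add_mul rhoExp_add k m

theorem levelPt_lt {n : ℕ} {r s : Fin n} (h : r < s) : levelPt n r + n + 1 ≤ levelPt n s := by
  have h1 : (r : ℤ) + 1 ≤ s := by exact_mod_cast h
  rw [levelPt, levelPt]
  nlinarith [r.pos]

theorem levelPt_cast_ne {r s : Fin n} (h : r ≠ s) :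
    (levelPt n r : ZMod n) ≠ (levelPt n s : ZMod n) := by
  rw [Ne, ← resid_eq_iff, resid_levelPt, resid_levelPt]
  exact h

theorem simple_mul_lt_iff {n : ℕ} {i : SimpleIdx n} {v : AffinePerm n} {c : ℤ}
    (hc : (c : ZMod n) = i.1) (hv : v⁻¹.1 c < v⁻¹.1 (c + 1)) {k l : ℤ} (hkl : k < l) :
    (simple i * v).1 l < (simple i * v).1 k ↔
      v.1 l < v.1 k ∨ ∃ j : ℤ, k = v⁻¹.1 c + j * n ∧ l = v⁻¹.1 (c + 1) + j * n := by
  change simpleFun i (v.1 l) < simpleFun i (v.1 k) ↔ _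
  have hpos : ∀ p p' : ℤ, v.1 p' = v.1 p + 1 → (v.1 p : ZMod n) = i.1 →
      ∃ j : ℤ, p = v⁻¹.1 c + j * n ∧ p' = v⁻¹.1 (c + 1) + j * n := by
    intro p p' h1 h2
    obtain ⟨j, hj⟩ := (intCast_eq_iff_exists c _).1 (hc.trans h2.symm)
    refine ⟨j, ?_, ?_⟩
    · rw [← affine_add_mul, ← hj, inv_apply_self]
    · rw [← affine_add_mul, add_right_comm, ← hj, ← h1, inv_apply_self]
  have hne : v.1 k ≠ v.1 l := fun h => hkl.ne (v.1.injective h)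
  constructor
  · intro h
    rcases lt_or_gt_of_ne hne with h1 | h1
    · obtain ⟨h2, h3⟩ := simpleFun_reverses h1 h
      exact Or.inr (hpos k l h2 h3)
    · exact Or.inl h1
  · rintro (h | ⟨j, rfl, rfl⟩)
    · by_contra h1
      have h2 : simpleFun i (v.1 k) < simpleFun i (v.1 l) :=
        lt_of_le_of_ne (not_lt.1 h1) fun h3 => hne ((simpleFun_invol i).injective h3)
      obtain ⟨h3, h4⟩ := simpleFun_reverses h h2
      obtain ⟨j, hj, hj'⟩ := hpos l k h3 h4
      omega
    · have h1 : ((c + j * n : ℤ) : ZMod n) = i.1 := by simp [hc]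
      rw [affine_add_mul, affine_add_mul, apply_inv_self, apply_inv_self, simpleFun_left h1,
        add_right_comm, simpleFun_right h1]
      omega

end Level

section LeadingCoefficient

variable {K : Type*} [Field K] {n : ℕ} [NeZero n] {q t : K}
  {F : Type*} [Field F] [Algebra K F] [Algebra (MvPolynomial (Fin n) K) F]
  [IsScalarTower K (MvPolynomial (Fin n) K) F]

variable (F) in
/-- `Y_x - Y_{x'}` for two elements `x, x'` of the level set. -/
noncomputable def levelDiff (q : K) (p : Fin n × Fin n) : F :=
  Yrat n F q (levelPt n p.1) - Yrat n F q (levelPt n p.2)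

variable (F) in
/-- The product of the differences `Y_x - Y_{x'}` over the pairs `x < x'` of elements of the level
set for which `w` reverses the order of `x` and `x' + d n`. -/
noncomputable def levelProd (q : K) (w : AffinePerm n) (d : ℤ) : F :=
  ∏ p ∈ Finset.univ.filter fun p : Fin n × Fin n => p.1 < p.2,
    if w.1 (levelPt n p.2 + d * n) < w.1 (levelPt n p.1) then levelDiff F q p else 1

theorem levelProd_shift (k : ℤ) {d : ℤ} (hd : 0 ≤ d) :
    levelProd F q (shift n ^ k) d = 1 := by
  refine Finset.prod_eq_one fun p hp => if_neg ?_
  have h := levelPt_lt (Finset.mem_filter.1 hp).2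
  have h1 := mul_nonneg hd (cast_pos (n := n)).le
  rw [shift_zpow_apply, shift_zpow_apply]
  omega

theorem levelProd_simple_mul {i : SimpleIdx n} {v : AffinePerm n} {c : ℤ}
    (hc : (c : ZMod n) = i.1) (hv : v⁻¹.1 c < v⁻¹.1 (c + 1)) {d : ℤ} (hd : 0 ≤ d) :
    levelProd F q (simple i * v) d = levelProd F q v d *
      ∏ p ∈ Finset.univ.filter fun p : Fin n × Fin n => p.1 < p.2,
        if levelPt n p.1 = v⁻¹.1 c + -rhoExp n (v⁻¹.1 c) * n ∧
          levelPt n p.2 + d * n = v⁻¹.1 (c + 1) + -rhoExp n (v⁻¹.1 c) * n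
        then levelDiff F q p else 1 := by
  rw [levelProd, levelProd, ← Finset.prod_mul_distrib]
  refine Finset.prod_congr rfl fun p hp => ?_
  have h := levelPt_lt (Finset.mem_filter.1 hp).2
  have h1 := mul_nonneg hd (cast_pos (n := n)).le
  have h2 : levelPt n p.1 < levelPt n p.2 + d * n := by omega
  have h3 := simple_mul_lt_iff hc hv h2
  have h4 : (∃ j : ℤ, levelPt n p.1 = v⁻¹.1 c + j * n ∧
      levelPt n p.2 + d * n = v⁻¹.1 (c + 1) + j * n) ↔
      (levelPt n p.1 = v⁻¹.1 c + -rhoExp n (v⁻¹.1 c) * n ∧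
        levelPt n p.2 + d * n = v⁻¹.1 (c + 1) + -rhoExp n (v⁻¹.1 c) * n) := by
    refine ⟨?_, fun h => ⟨_, h⟩⟩
    rintro ⟨j, h5, h6⟩
    have h7 := rhoExp_levelPt p.1
    rw [h5, rhoExp_add_mul] at h7
    obtain rfl : j = -rhoExp n (v⁻¹.1 c) := by omega
    exact ⟨h5, h6⟩
  rw [h4] at h3
  -- The two alternatives on the right of `h3` exclude each other.
  have h5 : (levelPt n p.1 = v⁻¹.1 c + -rhoExp n (v⁻¹.1 c) * n ∧
        levelPt n p.2 + d * n = v⁻¹.1 (c + 1) + -rhoExp n (v⁻¹.1 c) * n) →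
        ¬ v.1 (levelPt n p.2 + d * n) < v.1 (levelPt n p.1) := by
    rintro ⟨h6, h7⟩
    rw [h6, h7, affine_add_mul, affine_add_mul, apply_inv_self, apply_inv_self]
    omega
  by_cases h6 : levelPt n p.1 = v⁻¹.1 c + -rhoExp n (v⁻¹.1 c) * n ∧
        levelPt n p.2 + d * n = v⁻¹.1 (c + 1) + -rhoExp n (v⁻¹.1 c) * n
  · rw [if_pos (h3.2 (Or.inr h6)), if_neg (h5 h6), if_pos h6, one_mul]
  · rw [if_neg h6, mul_one]
    refine if_congr ?_ rfl rfl
    rw [h3, or_iff_left h6]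

theorem levelProd_simple_mul_of_ne {i : SimpleIdx n} {v : AffinePerm n} {c : ℤ}
    (hc : (c : ZMod n) = i.1) (hv : v⁻¹.1 c < v⁻¹.1 (c + 1)) {d : ℤ} (hd : 0 ≤ d)
    (h : rhoExp n (v⁻¹.1 (c + 1)) ≠ rhoExp n (v⁻¹.1 c) + d) :
    levelProd F q (simple i * v) d = levelProd F q v d := by
  rw [levelProd_simple_mul hc hv hd, Finset.prod_eq_one, mul_one]
  intro p _
  refine if_neg ?_
  rintro ⟨-, h1⟩
  have h2 := rhoExp_levelPt p.2
  have h3 := congrArg (rhoExp n) h1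
  rw [rhoExp_add_mul, rhoExp_add_mul, h2] at h3
  omega

theorem levelProd_simple_mul_of_eq (hq : q ≠ 0) {i : SimpleIdx n} {v : AffinePerm n} {c : ℤ}
    (hc : (c : ZMod n) = i.1) (hv : v⁻¹.1 c < v⁻¹.1 (c + 1)) {d : ℤ} (hd : 0 ≤ d) (hd1 : d ≤ 1)
    (h : rhoExp n (v⁻¹.1 (c + 1)) = rhoExp n (v⁻¹.1 c) + d) :
    ∃ z : K, z ≠ 0 ∧ levelProd F q (simple i * v) d = levelProd F q v d *
      (algebraMap K F z * (Yrat n F q (v⁻¹.1 c) - Yrat n F q (v⁻¹.1 (c + 1) + -d * n))) := by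
  set a := v⁻¹.1 c with ha
  set b := v⁻¹.1 (c + 1) with hb
  have ha1 := eq_levelPt_add (n := n) a
  have hb1 := eq_levelPt_add (n := n) b
  rw [h] at hb1
  have hab : resid n a ≠ resid n b := by
    rw [Ne, resid_eq_iff, intCast_eq_iff_exists]
    rintro ⟨m, hm⟩
    rw [hb, ha, ← affine_add_mul] at hm
    have := v⁻¹.1.injective hm
    refine i.2 ?_
    have h2 := congrArg (Int.cast : ℤ → ZMod n) this
    push_cast at h2
    rwa [ZMod.natCast_self, mul_zero, add_zero, hc] at h2
  have hlt : resid n a < resid n b := by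
    refine lt_of_le_of_ne (not_lt.1 fun h2 => ?_) hab
    have h3 := levelPt_lt h2
    have hn := cast_pos (n := n)
    nlinarith
  refine ⟨q ^ (rhoExp n a), zpow_ne_zero _ hq, ?_⟩
  rw [levelProd_simple_mul hc hv hd, ← ha, ← hb]
  congr 1
  rw [Finset.prod_eq_single (resid n a, resid n b), if_pos, levelDiff]
  · have h2 : levelPt n (resid n a) = a + -rhoExp n a * n := by linarith
    have h3 : levelPt n (resid n b) = b + -d * n + -rhoExp n a * n := by linarith
    rw [h2, h3, Yrat_add_mul hq, Yrat_add_mul hq _ (-rhoExp n a), neg_neg, mul_sub]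
  · constructor <;> dsimp only <;> linarith
  · intro p _ hp
    refine if_neg ?_
    rintro ⟨h2, h3⟩
    refine hp (Prod.ext ?_ ?_)
    · have h4 : resid n (levelPt n p.1) = resid n a := by
        rw [h2, resid_eq_iff]
        simp
      rwa [resid_levelPt] at h4
    · have h4 : resid n (levelPt n p.2) = resid n b := by
        rw [show levelPt n p.2 = b + -rhoExp n a * n + -d * n by linarith, resid_eq_iff]
        simp
      rwa [resid_levelPt] at h4
  · intro h2
    exact absurd (Finset.mem_filter.2 ⟨Finset.mem_univ (resid n a, resid n b), hlt⟩) h2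

theorem frat_mem_regularAt (a : Fin n → K) (k l : ℤ) : frat n F q t k l ∈ regularAt F a := by
  rw [← ofPoly_fpoly]
  exact ofPoly_mem_regularAt _ _

variable [IsFractionRing (MvPolynomial (Fin n) K) F]

theorem inv_Yrat_sub_mem_regularAt (hqt : q = t ^ (-2 : ℤ)) (ht : t ≠ 0)
    (ht' : ∀ m : ℤ, t ^ m = 1 → m = 0)
    {e : ℤ → ℤ} (he : ∀ k, e (k + n) = e k + 1) {k l : ℤ} (h : e k ≠ e l) :
    (Yrat n F q k - Yrat n F q l)⁻¹ ∈ regularAt F (expPoint n t e) := by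
  rw [Yrat, Yrat, ← map_sub]
  refine inv_ofPoly_mem_regularAt ?_
  rw [map_sub, eval_Ypoly hqt ht he, eval_Ypoly hqt ht he, sub_ne_zero]
  exact zpow_two_ne ht ht' (by omega)

/-- Adding an inversion `a < b` multiplies the leading coefficient by `f_{a,b} / (Y_a - Y_b)`. This
has a pole at `t^{-2ρ}` if `a` and `b` have the same level, and a zero if `b` has the next level;
the two products record the poles and the zeros. -/
theorem wordLead_mul_levelProd (hq : q ≠ 0) (hqt : q = t ^ (-2 : ℤ)) (ht : t ≠ 0)
    (ht' : ∀ m : ℤ, t ^ m = 1 → m = 0) {w : AffinePerm n} {l : List (SimpleIdx n)} {k : ℤ}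
    (hl : IsReduced w (l, k)) :
    ∃ u ∈ regularAt F (expPoint n t (rhoExp n)),
      wordLead F hq t l k * levelProd F q w 0 = u * levelProd F q w 1 := by
  induction l generalizing w with
  | nil =>
    have h : shift n ^ k = w := by simpa [evalWord] using hl.1
    refine ⟨1, one_mem _, ?_⟩
    rw [← h, levelProd_shift k le_rfl, levelProd_shift k zero_le_one, wordLead]
  | cons i l ih =>
    have hl1 := hl.1
    rw [isReduced_cons] at hl
    rw [evalWord_cons] at hl1
    obtain ⟨u, hu, hu1⟩ := ih hl.2
    set v := simple i * w with hv
    have hw : w = simple i * v := (simple_mul_cancel i w).symm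
    have hev : evalWord (l, k) = v := hl.2.1
    set c : ℤ := (i.1.cast : ℤ)
    have hc : (c : ZMod n) = i.1 := ZMod.intCast_zmod_cast _
    have hvd : v⁻¹.1 c < v⁻¹.1 (c + 1) := by
      rw [← not_isDescent_iff hc, hv, isDescent_simple_mul, not_not]
      exact hl.1
    rw [wordLead, hev, simpleLead, map_div₀, map_sub, ratAct_frat, ratAct_Yrat, ratAct_Yrat, hw]
    have hab : (v⁻¹.1 c : ZMod n) ≠ (v⁻¹.1 (c + 1) : ZMod n) := by
      rw [Ne, intCast_eq_iff_exists]
      rintro ⟨m, hm⟩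
      rw [← affine_add_mul] at hm
      refine ne_succ i hc ?_
      rw [v⁻¹.1.injective hm]
      simp
    have hy := Yrat_sub_ne_zero (F := F) hq hab
    set a := v⁻¹.1 c
    set b := v⁻¹.1 (c + 1)
    by_cases h0 : rhoExp n b = rhoExp n a
    · obtain ⟨z, hz, h1⟩ := levelProd_simple_mul_of_eq (F := F) hq hc hvd le_rfl zero_le_one
        (h0.trans (add_zero _).symm)
      rw [neg_zero, zero_mul, add_zero] at h1
      refine ⟨algebraMap K F z * frat n F q t a b * u,
        mul_mem (mul_mem (algebraMap_mem_regularAt _ _) (frat_mem_regularAt _ _ _)) hu, ?_⟩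
      rw [h1, levelProd_simple_mul_of_ne hc hvd zero_le_one
        fun h => (lt_add_one (rhoExp n a)).ne (h0.symm.trans h)]
      change _ / (Yrat n F q a - Yrat n F q b) * _ * (_ * (_ * (Yrat n F q a - Yrat n F q b))) = _
      field_simp
      linear_combination algebraMap K F z * frat n F q t a b * hu1
    rw [levelProd_simple_mul_of_ne hc hvd le_rfl (by rw [add_zero]; exact h0)]
    have hyr := inv_Yrat_sub_mem_regularAt (F := F) hqt ht ht' rhoExp_add (Ne.symm h0)
    by_cases h1 : rhoExp n b = rhoExp n a + 1
    · obtain ⟨z, hz, h2⟩ := levelProd_simple_mul_of_eq (F := F) hq hc hvd zero_le_one le_rfl h1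
      have h3 : frat n F q t a b =
          algebraMap K F t * (Yrat n F q a - Yrat n F q (b + -1 * n)) := by
        have ht0 : algebraMap K F t ≠ 0 := (map_ne_zero _).2 ht
        have h4 : algebraMap K F q = (algebraMap K F t ^ 2)⁻¹ := by
          rw [hqt, map_zpow₀, zpow_neg]
          norm_cast
        rw [frat, Yrat_add_mul hq, neg_neg, zpow_one, h4, map_inv₀]
        field_simp
      refine ⟨algebraMap K F (t * z⁻¹) * (Yrat n F q a - Yrat n F q b)⁻¹ * u,
        mul_mem (mul_mem (algebraMap_mem_regularAt _ _) hyr) hu, ?_⟩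
      have hz0 : algebraMap K F z ≠ 0 := (map_ne_zero _).2 hz
      rw [h2, h3, map_mul, map_inv₀]
      change _ = _ * (_ * (_ * (Yrat n F q a - Yrat n F q (b + -1 * n))))
      field_simp
      linear_combination algebraMap K F t * (Yrat n F q a - Yrat n F q (b + -1 * n)) * hu1
    · rw [levelProd_simple_mul_of_ne hc hvd zero_le_one h1]
      refine ⟨frat n F q t a b * (Yrat n F q a - Yrat n F q b)⁻¹ * u,
        mul_mem (mul_mem (frat_mem_regularAt _ _ _) hyr) hu, ?_⟩
      linear_combination frat n F q t a b * (Yrat n F q a - Yrat n F q b)⁻¹ * hu1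

theorem levelProd_ne_zero (hq : q ≠ 0) (w : AffinePerm n) (d : ℤ) : levelProd F q w d ≠ 0 := by
  refine Finset.prod_ne_zero_iff.2 fun p hp => ?_
  split_ifs
  · exact Yrat_sub_ne_zero (F := F) hq (levelPt_cast_ne (Finset.mem_filter.1 hp).2.ne)
  · exact one_ne_zero

/-- Elements preserving the levels permute the level set, whose elements are at least `n + 1`
apart. So the zeros and poles cancel. -/
theorem leadCoef_mem_regularAt (hq : q ≠ 0) (hqt : q = t ^ (-2 : ℤ)) (ht : t ≠ 0)
    (ht' : ∀ m : ℤ, t ^ m = 1 → m = 0) {w : AffinePerm n}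
    (hw : ∀ k, rhoExp n (w.1 k) = rhoExp n k) :
    leadCoef F hq t w ∈ regularAt F (expPoint n t (rhoExp n)) := by
  obtain ⟨u, hu, h⟩ := wordLead_mul_levelProd (F := F) hq hqt ht ht' (redWord_spec w)
  have hlev : ∀ r : Fin n, ∃ s : Fin n, w.1 (levelPt n r) = levelPt n s := fun r =>
    ⟨_, by
      conv_lhs => rw [eq_levelPt_add (n := n) (w.1 (levelPt n r)), hw, rhoExp_levelPt, zero_mul,
        add_zero]⟩
  have h1 : levelProd F q w 1 = levelProd F q w 0 := by
    refine Finset.prod_congr rfl fun p _ => if_congr ?_ rfl rfl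
    obtain ⟨r, hr⟩ := hlev p.1
    obtain ⟨s, hs⟩ := hlev p.2
    rw [affine_add_mul, affine_add_mul, hr, hs, one_mul, zero_mul, add_zero]
    have hn := cast_pos (n := n)
    refine ⟨fun h => by omega, fun h => ?_⟩
    rcases lt_trichotomy s r with h2 | rfl | h2
    · have := levelPt_lt h2
      omega
    · omega
    · have := levelPt_lt h2
      omega
  rw [h1] at h
  have h2 : leadCoef F hq t w = u := mul_right_cancel₀ (levelProd_ne_zero hq w 0) h
  rwa [h2]

end LeadingCoefficient

end QDaha

namespace QDaha

open MvPolynomial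

/-! ### Normal orderings -/

section NormalOrdering

variable {K : Type*} [Field K] {n : ℕ} [NeZero n] {q t : K}
  {F : Type*} [Field F] [Algebra K F] [Algebra (MvPolynomial (Fin n) K) F]
  [IsScalarTower K (MvPolynomial (Fin n) K) F] [IsFractionRing (MvPolynomial (Fin n) K) F]

theorem IsNormalOrdering.rep_eq (hq : q ≠ 0) (ht : t ≠ 0) {h : LocDAHA n q t}
    {g : AffinePerm n →₀ Localization (denominators n q t)} (hg : IsNormalOrdering h g) :
    rep F hq ht h = normalSum F hq ht
      (g.mapRange (locToRat F (denominators_le hq ht)) (map_zero _)) := by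
  have h1 : h = g.sum fun x c => Tw x * genY c := hg
  rw [h1, normalSum, Finsupp.sum_mapRange_index fun x => by rw [map_zero, mul_zero], map_finsuppSum]
  refine Finsupp.sum_congr fun x _ => ?_
  rw [map_mul, rep_genY]

theorem normalSum_injective (hq : q ≠ 0) (hq' : ∀ m : ℤ, q ^ m = 1 → m = 0) (ht : t ≠ 0) :
    Function.Injective (normalSum (n := n) F hq ht) := by
  intro g g' h
  have h1 := normalSum_add hq ht g (-g')
  rw [normalSum_neg, h, add_neg_cancel] at h1
  have h2 := eq_zero_of_normalSum_eq_zero hq hq' ht h1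
  rwa [← sub_eq_add_neg, sub_eq_zero] at h2

theorem not_hasPoleAt_of_mem {S : Submonoid (MvPolynomial (Fin n) K)} (hS : S ≤ nonZeroDivisors _)
    {a : Fin n → K} {c : Localization S} (h : locToRat F hS c ∈ regularAt F a) :
    ¬ HasPoleAt a c := by
  obtain ⟨P, Q, hQ, h1⟩ := h
  rw [HasPoleAt, not_not]
  refine ⟨P, Q, hQ, locToRat_injective (F := F) hS ?_⟩
  rw [map_mul, locToRat_algebraMap, locToRat_algebraMap, h1]

theorem not_hasZeroAt_of_mul_eq_one {S : Submonoid (MvPolynomial (Fin n) K)}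
    (hS : S ≤ nonZeroDivisors _) {a : Fin n → K} {c : Localization S} {u : F}
    (hu : u ∈ regularAt F a) (h : u * locToRat F hS c = 1) : ¬ HasZeroAt a c := by
  obtain ⟨P, Q, hQ, h1⟩ := hu
  rintro ⟨P', Q', hQ', hP', h2⟩
  have h2 := congrArg (locToRat F hS) h2
  rw [map_mul, locToRat_algebraMap, locToRat_algebraMap] at h2
  have h3 : ofPoly F (Q * Q') = ofPoly F (P * P') := by
    rw [map_mul, map_mul, ← h1, ← h2]
    linear_combination -(ofPoly F Q * ofPoly F Q') * h
  have h4 := congrArg (eval a) (ofPoly_injective h3)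
  rw [map_mul, map_mul, hP', mul_zero] at h4
  exact mul_ne_zero hQ hQ' h4

end NormalOrdering

end QDaha

theorem mainTheorem7 {K : Type*} [Field K] [CharZero K] (t : K) (ht0 : t ≠ 0)
    (ht : ∀ m : ℕ, 0 < m → t ^ m ≠ 1) (n : ℕ) [NeZero n]
    (w : QDaha.AffinePerm n) (hw : w ∈ QDaha.finSymm n) :
    ∃ g : QDaha.AffinePerm n →₀ Localization (QDaha.denominators n (t ^ (-2 : ℤ)) t),
      QDaha.IsNormalOrdering (QDaha.nu ((QDaha.gamma n)⁻¹ * w * QDaha.gamma n)) g ∧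
      (∀ g', QDaha.IsNormalOrdering (QDaha.nu ((QDaha.gamma n)⁻¹ * w * QDaha.gamma n)) g' →
        g' = g) ∧
      QDaha.HasLeadingTerm g ((QDaha.gamma n)⁻¹ * w * QDaha.gamma n) ∧
      ¬ QDaha.HasZeroAt (QDaha.tRho n t) (g ((QDaha.gamma n)⁻¹ * w * QDaha.gamma n)) ∧
      ¬ QDaha.HasPoleAt (QDaha.tRho n t) (g ((QDaha.gamma n)⁻¹ * w * QDaha.gamma n)) ∧
      ∀ x, x ≠ (QDaha.gamma n)⁻¹ * w * QDaha.gamma n →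
        ¬ QDaha.HasPoleAt (QDaha.tRho n t) (g x) := by
  have ht' : ∀ m : ℤ, t ^ m = 1 → m = 0 := by
    intro m hm
    by_contra h
    refine ht m.natAbs (Int.natAbs_pos.2 h) ?_
    rcases Int.natAbs_eq m with h1 | h1
    · rwa [h1, zpow_natCast] at hm
    · rwa [h1, zpow_neg, inv_eq_one, zpow_natCast] at hm
  have hq : t ^ (-2 : ℤ) ≠ 0 := zpow_ne_zero _ ht0
  have hq' : ∀ m : ℤ, (t ^ (-2 : ℤ)) ^ m = 1 → m = 0 := by
    intro m hm
    rw [← zpow_mul] at hm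
    have := ht' _ hm
    omega
  let F := FractionRing (MvPolynomial (Fin n) K)
  have hS := QDaha.denominators_le (n := n) hq ht0
  have hιinj : Function.Injective (QDaha.locToRat F hS) := QDaha.locToRat_injective hS
  set x := (QDaha.gamma n)⁻¹ * w * QDaha.gamma n with hx
  obtain ⟨g, hg⟩ := QDaha.exists_isNormalOrdering (QDaha.nu_mem_orderable hq ht0 x)
  have hrep := hg.rep_eq (F := F) hq ht0
  have hperm := hrep.symm.trans (QDaha.rep_nu hq ht0 x)
  obtain ⟨hlead, hlen⟩ := QDaha.leading_of_normalSum_eq_permOp hq hq' ht0 hperm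
  -- The coefficients of the normal ordering are those of the operator `γ⁻¹ w γ`.
  have hreg : ∀ y, QDaha.locToRat F hS (g y) ∈ QDaha.regularAt F (QDaha.tRho n t) := by
    obtain ⟨g', hg', hreg⟩ := QDaha.exists_of_mem_regularOps hq ht0
      (QDaha.permOp_conj_mem_regularOps_rho (F := F) hq rfl ht0 ht' hw)
    have h := QDaha.normalSum_injective hq hq' ht0 (hperm.trans hg')
    rw [QDaha.expPoint_rhoExp] at hreg
    intro y
    have h1 := hreg y
    rwa [← h, Finsupp.mapRange_apply] at h1
  have hcoef : QDaha.leadCoef F hq t x ∈ QDaha.regularAt F (QDaha.tRho n t) := by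
    rw [← QDaha.expPoint_rhoExp]
    exact QDaha.leadCoef_mem_regularAt hq rfl ht0 ht' (QDaha.rhoExp_conj hw)
  rw [Finsupp.mapRange_apply] at hlead
  refine ⟨g, hg, fun g' hg' => ?_, ⟨fun h => ?_, fun y hy hgy => hlen y hy ?_⟩,
    QDaha.not_hasZeroAt_of_mul_eq_one hS hcoef hlead, QDaha.not_hasPoleAt_of_mem hS (hreg x),
    fun y _ => QDaha.not_hasPoleAt_of_mem hS (hreg y)⟩
  · exact Finsupp.mapRange_injective _ (map_zero _) hιinj
      (QDaha.normalSum_injective hq hq' ht0 ((hg'.rep_eq (F := F) hq ht0).symm.trans hrep))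
  · rw [h, map_zero, mul_zero] at hlead
    exact zero_ne_one hlead
  · rw [Finsupp.mapRange_apply]
    exact (map_ne_zero_iff _ hιinj).2 hgy
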